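/- Let $n\ge 0$ be an integer, let $\mathbb{R}_+^{n+1}$ be the set of $x=(x_0,\dots,x_n)\in\mathbb{R}^{n+1}$ with all coordinates positive, and let $$\Delta^n=\Big\{x\in\mathbb{R}_+^{n+1}\ :\ \sum_{j=0}^n x_j=1\Big\}.$$ Let $q\ge 0$ be a real number and let $\varphi:\mathbb{R}_+^{n+1}\to\mathbb{R}$ be a function such that * $\varphi$ is $(1/2)$-convex, i.e. $(x_0,\dots,x_n)\mapsto\varphi(x_0^2,\dots,x_n^2)$ is convex on $\mathbb{R}_+^{n+1}$; * $\varphi$ is smooth up to the boundary in $\Delta^n$, i.e. $\varphi|_{\Delta^n}$ is the restriction of a $C^\infty$ function on $\mathbb{R}^{n+1}$; * $\varphi$ is homogeneous of degree $q$, i.e. $\varphi(tx)=t^q\varphi(x)$ for all $t>0$ and $x\in\mathbb{R}_+^{n+1}$. Put $M=\sup_{x\in\Delta^n}\varphi(x)$ and assume that $$Mq\le n,$$ or, alternatively, that the following condition holds. Let $F(z)=\varphi(|z_0|^2/4,\dots,|z_n|^2/4)$, let $S=\{z\in\mathbb{C}^{n+1}:|z|=2\}$, regard $\mathbb{C}^{n+1}$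 as a real Euclidean space, let $\nabla^2F$ be the Euclidean Hessian of $F$, and for $p\in S$ let $E_p\subset T_pS$ be the real linear span of the gradients at $p$, on the Riemannian manifold $S$, of the functions $|z_0|^2,\dots,|z_n|^2$; then $$\langle(\nabla^2F)(p)\,U,U\rangle+\frac{n-qF(p)}{2}|U|^2\ge 0\qquad\text{for all } p\in S \text{ with all coordinates non-zero and all } U\in E_p.$$ Let $\nu$ be the finite Borel measure on $\Delta^n$ with density $e^{-\varphi}$ with respect to Lebesgue measure on $\Delta^n$ (normalized so that the projection $(x_0,\dots,x_n)\mapsto(x_1,\dots,x_n)$ is measure preserving). Then for every Lipschitz function $f:\Delta^n\to\mathbb{R}$ with $\int_{\Delta^n}f\,d\nu=0$, $$\int_{\Delta^n}f^2\,d\nu\le 4\int_{\Delta^n}\Big(\sum_{k=0}^n\frac{x_k^2}{1-2x_k}\Big)^{-1}\sum_{0\le i<j\le n}\frac{x_i^2x_j^2}{(1-2x_i)(1-2x_j)}\,|E^{ij}f(x)|^2\,d\nu(x),$$ where $E^{ij}f=\left(\frac{\partial}{\partial x_i}-\frac{\partial}{\partial x_j}\right)f$ is the derivative of $f$ in the direction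 $e_i-e_j$ tangent to $\Delta^n$, which exists almost everywhere. The integrand on the right is defined and nonnegative almost everywhere on $\Delta^n$, and its integral is understood as an element of $[0,\infty]$. -/

import Mathlib

open MeasureTheory
open scoped ContDiff ENNReal

namespace SimplexPoincare

noncomputable section

/-- The open orthant of all `x ∈ ℝᵐ` with positive coordinates. -/
def orthant (m : ℕ) : Set (Fin m → ℝ) := {x | ∀ i, 0 < x i}

/-- `φ` is `p`-convex on the orthant (`0 < p ≤ 1`): the function
`x ↦ φ (x₁ ^ (1/p), …, xₘ ^ (1/p))` is convex there. -/
def IsPConvex {m : ℕ} (p : ℝ) (φ : (Fin m → ℝ) → ℝ) : Prop :=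
  ConvexOn ℝ (orthant m) (fun x => φ (fun i => x i ^ (1 / p)))

/-- `φ` is positively homogeneous of degree `q` on the orthant. -/
def IsHomogeneousOfDegree {m : ℕ} (q : ℝ) (φ : (Fin m → ℝ) → ℝ) : Prop :=
  ∀ t : ℝ, 0 < t → ∀ x ∈ orthant m, φ (t • x) = t ^ q * φ x

/-- The (open) regular simplex `Δⁿ ⊂ ℝⁿ⁺¹`: positive coordinates `x₀, …, xₙ` with sum `1`. -/
def simplex (n : ℕ) : Set (Fin (n + 1) → ℝ) := {x | x ∈ orthant (n + 1) ∧ ∑ i, x i = 1}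

/-- `φ` is smooth up to the boundary in `Δⁿ`: on `Δⁿ` it agrees with a `C^∞` function that is
defined beyond the boundary of `Δⁿ`. -/
def SmoothUpToBoundary (n : ℕ) (φ : (Fin (n + 1) → ℝ) → ℝ) : Prop :=
  ∃ g : (Fin (n + 1) → ℝ) → ℝ, ContDiff ℝ ∞ g ∧ Set.EqOn φ g (simplex n)

/-- The open simplex in `ℝⁿ` with vertices `0, e₁, …, eₙ`. -/
def cornerSimplex (n : ℕ) : Set (Fin n → ℝ) := {y | y ∈ orthant n ∧ ∑ i, y i < 1}

/-- The inverse `(x₁, …, xₙ) ↦ (1 - ∑ xᵢ, x₁, …, xₙ)` of the projection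
`(x₀, …, xₙ) ↦ (x₁, …, xₙ)` from `Δⁿ` to the corner simplex. -/
def simplexLift (n : ℕ) (y : Fin n → ℝ) : Fin (n + 1) → ℝ := Fin.cons (1 - ∑ i, y i) y

/-- Lebesgue measure on `Δⁿ`, normalized so that the projection
`(x₀, …, xₙ) ↦ (x₁, …, xₙ)` from `Δⁿ` to the corner simplex is measure preserving. -/
def simplexMeasure (n : ℕ) : Measure (Fin (n + 1) → ℝ) :=
  ((volume : Measure (Fin n → ℝ)).restrict (cornerSimplex n)).map (simplexLift n)

/-- The measure on `Δⁿ` with density `exp (-φ)` with respect to Lebesgue measure on `Δⁿ`. -/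
def weightedMeasure (n : ℕ) (φ : (Fin (n + 1) → ℝ) → ℝ) : Measure (Fin (n + 1) → ℝ) :=
  (simplexMeasure n).withDensity (fun x => ENNReal.ofReal (Real.exp (-φ x)))

/-- `E^{ij} f (x) = (∂/∂xᵢ - ∂/∂xⱼ) f (x)`, the derivative of `f` at `x` in the direction
`eᵢ - eⱼ`. This direction is tangent to `Δⁿ`, so that for `x ∈ Δⁿ` only the values of `f` on `Δⁿ`
matter. -/
def tangentDeriv {n : ℕ} (i j : Fin (n + 1)) (f : (Fin (n + 1) → ℝ) → ℝ)
    (x : Fin (n + 1) → ℝ) : ℝ :=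
  lineDeriv ℝ f x (Pi.single i 1 - Pi.single j 1)

/-- The quadratic expression in the tangential derivatives of `f` on the right-hand side:
`(∑ₖ xₖ² / (1 - 2xₖ))⁻¹ * ∑ xᵢ² xⱼ² / ((1 - 2xᵢ) (1 - 2xⱼ)) * |E^{ij} f (x)|²`, where the second sum
runs over the `n (n + 1) / 2` unordered pairs of distinct indices.
No denominator vanishes, and the value is nonnegative, at every `x ∈ Δⁿ` that has no coordinate
equal to `1/2`, thus almost everywhere on `Δⁿ`. -/
def energyDensity {n : ℕ} (f : (Fin (n + 1) → ℝ) → ℝ) (x : Fin (n + 1) → ℝ) : ℝ :=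
  (∑ k, x k ^ 2 / (1 - 2 * x k))⁻¹ *
    ∑ i, ∑ j ∈ Finset.Ioi i,
      x i ^ 2 * x j ^ 2 / ((1 - 2 * x i) * (1 - 2 * x j)) * |tangentDeriv i j f x| ^ 2

/-- The function `z ↦ φ (|z₀|² / 4, …, |zₙ|² / 4)` on `ℂⁿ⁺¹`. -/
def complexLift {n : ℕ} (φ : (Fin (n + 1) → ℝ) → ℝ) (z : EuclideanSpace ℂ (Fin (n + 1))) : ℝ :=
  φ (fun k => ‖z k‖ ^ 2 / 4)

/-- The subspace `E_p` of the tangent space `pᗮ` at `p` to the sphere centred at `0` through `p` in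
`ℂⁿ⁺¹`, regarded as a real Euclidean space: it is spanned by the gradients on the sphere of the
functions `|z₀|², …, |zₙ|²`, that is, by the tangential parts of their Euclidean gradients. -/
def radialSubspace {n : ℕ} (p : EuclideanSpace ℂ (Fin (n + 1))) :
    Submodule ℝ (EuclideanSpace ℂ (Fin (n + 1))) :=
  Submodule.span ℝ (Set.range fun k : Fin (n + 1) =>
    (Submodule.span ℝ {p})ᗮ.starProjection
      (gradient (fun w : EuclideanSpace ℂ (Fin (n + 1)) => ‖w k‖ ^ 2) p))

/-- With `F (z) = φ (|z₀|² / 4, …, |zₙ|² / 4)`: one has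
`⟨(∇²F) U, U⟩ + (n - q F (p)) / 2 * |U|² ≥ 0` for all `p` in the sphere of radius `2` in `ℂⁿ⁺¹` and
all `U ∈ E_p`. It is only required at points `p` with non-zero coordinates, where
`(|p₀|² / 4, …, |pₙ|² / 4)` belongs to the open orthant; when `φ` is homogeneous and smooth up to
the boundary, the inequality then holds on the whole sphere by continuity. -/
def CurvatureCondition (n : ℕ) (q : ℝ) (φ : (Fin (n + 1) → ℝ) → ℝ) : Prop :=
  ∀ p : EuclideanSpace ℂ (Fin (n + 1)), p ∈ Metric.sphere 0 2 → (∀ k, p k ≠ 0) →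
    ∀ U ∈ radialSubspace p,
      0 ≤ fderiv ℝ (fderiv ℝ (complexLift φ)) p U U
        + ((n : ℝ) - q * complexLift φ p) / 2 * ‖U‖ ^ 2

end

end SimplexPoincare

open SimplexPoincare

/-!
The proof is a duality argument of Hörmander type in the coordinates `y = (x₁, …, xₙ)`, in which the
measure has density `exp (-ψ)` on the corner simplex, with `ψ = φ` on `Δⁿ`.

Give the simplex the metric of the sphere of radius `2` with coordinates `2 √xₖ`. The gradient of a
polynomial `p` has barycentric components `xₖ bₖ` with `∑ xₖ bₖ = 0` (`centeredDeriv`). It is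
tangent to every face, so that integrations by parts have no boundary terms, even against Lipschitz
functions (`integral_lineDeriv_mul_eq_neg`). For `L p = div (∇ p) - dψ (∇ p)`, the Bochner identity
(`integral_exp_mul_weightedDiv_sq`) expresses `∫ exp (-ψ) (L p)²` through the derivative of the
gradient field and the second derivative of `ψ`. A pointwise algebraic computation splits off
`¼ ∑ bₖ²`, a nonnegative square, and the quadratic form `Hess ψ + n / 2`; if the latter is
nonnegative (`HessianBound`), then
`¼ ∫ exp (-ψ) ∑ bₖ² ≤ ∫ exp (-ψ) (L p)²` (`integral_exp_mul_sum_centeredDeriv_sq_le`).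

The Hessian bound comes from the homogeneity of `φ`: along the curves `xₖ (1 + t bₖ / 2)²`, which are
straight lines in the coordinates `√xₖ`, the second derivative of `φ` at `t = 0` is the Hessian form
of `ψ` plus `q φ / 2` times the squared length. The `(1/2)`-convexity makes this second derivative
nonnegative, so that `q φ ≤ n` suffices (`hessianBound_of_convex`); the curvature condition is the
bound itself, since the velocities of these curves lift to the vectors of `E_p`
(`hessianBound_of_curvatureCondition`).

The functions `L p` are dense among the square integrable functions of weighted mean zero
(`exists_weightedLaplacian_near`). For `ψ = 0` this holds because `L` does not raise degrees and is
symmetric, so that orthogonal projection to polynomials of bounded degree commutes with it. The drift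
term is of lower order: for large `l` the range of `l - L` is dense, and approximate solutions of
`(l - L) u = h` for `h` orthogonal to the range of `L` show that `h` is also orthogonal to the range
of the unweighted operator, hence constant.

Given a mean-zero Lipschitz function `f`, choose `p` with `L p` close to `f`. Then
`∫ exp (-ψ) f²` is nearly `2 ∫ exp (-ψ) f L p - ∫ exp (-ψ) (L p)²`, at most
`∫ exp (-ψ) (-2 df(∇ p) - ¼ ∑ bₖ²)` (`ofReal_integral_exp_mul_sq_le`). The integrand is a quadratic
expression in the tangent vector `b`, and by completing the square it is at most four times the
energy density of `f` (`neg_two_mul_sum_sub_le`).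
-/

namespace SimplexPoincare

/-! ### The corner simplex in barycentric coordinates -/

theorem simplexLift_zero {n : ℕ} (y : Fin n → ℝ) : simplexLift n y 0 = 1 - ∑ i, y i := rfl

theorem simplexLift_succ {n : ℕ} (y : Fin n → ℝ) (i : Fin n) : simplexLift n y i.succ = y i := rfl

theorem sum_simplexLift {n : ℕ} (y : Fin n → ℝ) : ∑ k, simplexLift n y k = 1 := by
  rw [Fin.sum_univ_succ, simplexLift_zero]
  simp only [simplexLift_succ]
  ring

theorem mem_cornerSimplex_iff {n : ℕ} {y : Fin n → ℝ} :
    y ∈ cornerSimplex n ↔ ∀ k, 0 < simplexLift n y k := by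
  rw [Fin.forall_fin_succ, simplexLift_zero]
  simp only [simplexLift_succ, cornerSimplex, orthant, Set.mem_ofPred_eq, sub_pos]
  exact and_comm

theorem continuous_simplexLift (n : ℕ) : Continuous (simplexLift n) := by
  refine continuous_pi fun k => ?_
  refine Fin.cases ?_ (fun i => ?_) k
  · simp only [simplexLift_zero]; fun_prop
  · simp only [simplexLift_succ]; fun_prop

theorem continuous_simplexLift_apply {n : ℕ} (k : Fin (n + 1)) :
    Continuous fun y => simplexLift n y k :=
  (continuous_apply k).comp (continuous_simplexLift n)

theorem isOpen_cornerSimplex (n : ℕ) : IsOpen (cornerSimplex n) := by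
  have : cornerSimplex n = ⋂ k, {y | 0 < simplexLift n y k} := by
    ext y; simp [mem_cornerSimplex_iff]
  rw [this]
  exact isOpen_iInter_of_finite fun k =>
    isOpen_lt continuous_const (continuous_simplexLift_apply k)

theorem measurableSet_cornerSimplex (n : ℕ) : MeasurableSet (cornerSimplex n) :=
  (isOpen_cornerSimplex n).measurableSet

theorem simplexLift_mem_Icc {n : ℕ} {y : Fin n → ℝ} (hy : ∀ k, 0 ≤ simplexLift n y k)
    (k : Fin (n + 1)) : simplexLift n y k ∈ Set.Icc (0 : ℝ) 1 := by
  refine ⟨hy k, ?_⟩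
  rw [← sum_simplexLift y]
  exact Finset.single_le_sum (f := fun k => simplexLift n y k) (fun i _ => hy i)
    (Finset.mem_univ k)

theorem mem_Icc_of_simplexLift_nonneg {n : ℕ} {y : Fin n → ℝ}
    (hy : ∀ k, 0 ≤ simplexLift n y k) : y ∈ Set.Icc (0 : Fin n → ℝ) 1 :=
  ⟨fun i => (simplexLift_mem_Icc hy i.succ).1, fun i => (simplexLift_mem_Icc hy i.succ).2⟩

theorem cornerSimplex_subset_Icc (n : ℕ) : cornerSimplex n ⊆ Set.Icc (0 : Fin n → ℝ) 1 :=
  fun _ hy => mem_Icc_of_simplexLift_nonneg fun k => (mem_cornerSimplex_iff.1 hy k).le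

theorem volume_cornerSimplex_lt_top (n : ℕ) : volume (cornerSimplex n) < ⊤ :=
  (measure_mono (cornerSimplex_subset_Icc n)).trans_lt isCompact_Icc.measure_lt_top

instance isFiniteMeasure_restrict_cornerSimplex (n : ℕ) :
    IsFiniteMeasure ((volume : Measure (Fin n → ℝ)).restrict (cornerSimplex n)) :=
  ⟨by rw [Measure.restrict_apply_univ]; exact volume_cornerSimplex_lt_top n⟩

theorem exists_bound_on_cornerSimplex {n : ℕ} {f : (Fin n → ℝ) → ℝ} (hf : Continuous f) :
    ∃ C : ℝ, 0 ≤ C ∧ ∀ y ∈ cornerSimplex n, |f y| ≤ C := by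
  obtain ⟨C, hC⟩ := (isCompact_Icc (a := (0 : Fin n → ℝ)) (b := 1)).exists_bound_of_continuousOn
    hf.continuousOn
  refine ⟨max C 0, le_max_right _ _, fun y hy => (hC y (cornerSimplex_subset_Icc n hy)).trans
    (le_max_left _ _)⟩

theorem integrableOn_cornerSimplex {n : ℕ} {f : (Fin n → ℝ) → ℝ} (hf : Continuous f) :
    IntegrableOn f (cornerSimplex n) :=
  (hf.continuousOn.integrableOn_compact isCompact_Icc).mono_set (cornerSimplex_subset_Icc n)

theorem convex_cornerSimplex (n : ℕ) : Convex ℝ (cornerSimplex n) := by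
  intro y hy z hz a b ha hb hab
  rw [mem_cornerSimplex_iff] at *
  have key : ∀ k, simplexLift n (a • y + b • z) k
      = a * simplexLift n y k + b * simplexLift n z k := by
    refine Fin.cases ?_ (fun i => ?_)
    · simp only [simplexLift_zero, Pi.add_apply, Pi.smul_apply, smul_eq_mul,
        Finset.sum_add_distrib, ← Finset.mul_sum]
      linear_combination -hab
    · simp [simplexLift_succ]
  intro k
  rw [key]
  rcases ha.eq_or_lt with rfl | ha'
  · have : b = 1 := by linarith
    simpa [this] using hz k
  · exact add_pos_of_pos_of_nonneg (mul_pos ha' (hy k)) (mul_nonneg hb (hz k).le)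

/-- The linear part of the `k`-th barycentric coordinate `y ↦ simplexLift n y k`. -/
noncomputable def simplexLiftLinear (n : ℕ) (k : Fin (n + 1)) : (Fin n → ℝ) →L[ℝ] ℝ :=
  (Fin.cons (-∑ i, ContinuousLinearMap.proj i) (fun i => ContinuousLinearMap.proj i) :
    Fin (n + 1) → ((Fin n → ℝ) →L[ℝ] ℝ)) k

theorem simplexLiftLinear_zero {n : ℕ} (v : Fin n → ℝ) :
    simplexLiftLinear n 0 v = -∑ i, v i := by
  simp [simplexLiftLinear]

theorem simplexLiftLinear_succ {n : ℕ} (i : Fin n) (v : Fin n → ℝ) :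
    simplexLiftLinear n i.succ v = v i := by
  simp [simplexLiftLinear]

theorem hasFDerivAt_simplexLift {n : ℕ} (k : Fin (n + 1)) (y : Fin n → ℝ) :
    HasFDerivAt (fun y => simplexLift n y k) (simplexLiftLinear n k) y := by
  refine Fin.cases ?_ (fun i => ?_) k
  · have h : (fun y => simplexLift n y 0) = fun y => 1 + simplexLiftLinear n 0 y := by
      ext y; rw [simplexLift_zero, simplexLiftLinear_zero]; ring
    rw [h]
    exact ((simplexLiftLinear n 0).hasFDerivAt).const_add 1
  · have h : (fun y => simplexLift n y i.succ) = fun y => simplexLiftLinear n i.succ y := by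
      ext y; rw [simplexLift_succ, simplexLiftLinear_succ]
    rw [h]
    exact (simplexLiftLinear n i.succ).hasFDerivAt

theorem contDiff_simplexLift {n : ℕ} {m : WithTop ℕ∞} : ContDiff ℝ m (simplexLift n) := by
  refine contDiff_pi.2 fun k => ?_
  refine Fin.cases ?_ (fun i => ?_) k
  · simp only [simplexLift_zero]; fun_prop
  · simp only [simplexLift_succ]; fun_prop

theorem contDiff_simplexLift_apply {n : ℕ} {m : WithTop ℕ∞} (k : Fin (n + 1)) :
    ContDiff ℝ m fun y => simplexLift n y k :=
  (contDiff_pi.1 contDiff_simplexLift) k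

/-! ### Partial derivatives and integration by parts -/

/-- The `i`-th partial derivative of a function on `ℝⁿ`. -/
noncomputable def partialDeriv {n : ℕ} (i : Fin n) (f : (Fin n → ℝ) → ℝ) (y : Fin n → ℝ) : ℝ :=
  fderiv ℝ f y (Pi.single i 1)

theorem fderiv_apply_eq_sum {n : ℕ} (L : (Fin n → ℝ) →L[ℝ] ℝ) (v : Fin n → ℝ) :
    L v = ∑ i, v i * L (Pi.single i 1) := by
  conv_lhs => rw [pi_eq_sum_univ' v]
  simp [map_sum]

theorem partialDeriv_mul {n : ℕ} {i : Fin n} {f g : (Fin n → ℝ) → ℝ} {y : Fin n → ℝ}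
    (hf : DifferentiableAt ℝ f y) (hg : DifferentiableAt ℝ g y) :
    partialDeriv i (fun y => f y * g y) y = f y * partialDeriv i g y + g y * partialDeriv i f y := by
  simp [partialDeriv, fderiv_fun_mul hf hg]

theorem contDiff_partialDeriv {n : ℕ} {i : Fin n} {f : (Fin n → ℝ) → ℝ} (hf : ContDiff ℝ ∞ f) :
    ContDiff ℝ ∞ (partialDeriv i f) :=
  (hf.fderiv_right (m := ∞) (by simp)).clm_apply contDiff_const

theorem continuous_partialDeriv {n : ℕ} {i : Fin n} {f : (Fin n → ℝ) → ℝ} (hf : ContDiff ℝ 1 f) :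
    Continuous (partialDeriv i f) :=
  (hf.continuous_fderiv (by simp)).clm_apply continuous_const

theorem exists_bound_mul_deriv_smoothTransition :
    ∃ K : ℝ, 0 ≤ K ∧ ∀ t, |t * deriv Real.smoothTransition t| ≤ K := by
  have hc : Continuous fun t => t * deriv Real.smoothTransition t :=
    continuous_id.mul ((Real.smoothTransition.contDiff (n := 1)).continuous_deriv (by simp))
  obtain ⟨K, hK⟩ := (isCompact_Icc (a := (0 : ℝ)) (b := 1)).exists_bound_of_continuousOn
    hc.continuousOn
  refine ⟨max K 0, le_max_right _ _, fun t => ?_⟩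
  by_cases ht : t ∈ Set.Icc (0 : ℝ) 1
  · exact (hK t ht).trans (le_max_left _ _)
  · have : deriv Real.smoothTransition t = 0 := by
      rw [Set.mem_Icc, not_and_or, not_le, not_le] at ht
      rcases ht with ht | ht
      · have : Real.smoothTransition =ᶠ[nhds t] fun _ => 0 := by
          filter_upwards [gt_mem_nhds ht] with s hs
          exact Real.smoothTransition.zero_of_nonpos hs.le
        rw [this.deriv_eq, deriv_const]
      · have : Real.smoothTransition =ᶠ[nhds t] fun _ => 1 := by
          filter_upwards [lt_mem_nhds ht] with s hs
          exact Real.smoothTransition.one_of_one_le hs.le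
        rw [this.deriv_eq, deriv_const]
    simp [this]

/-- A smooth cutoff that vanishes off the open corner simplex and is `1` at the points all of
whose barycentric coordinates are at least `1 / (m + 1)`. -/
noncomputable def simplexCutoff (n m : ℕ) (y : Fin n → ℝ) : ℝ :=
  ∏ k, Real.smoothTransition ((m + 1 : ℝ) * simplexLift n y k)

theorem contDiff_simplexCutoff (n m : ℕ) : ContDiff ℝ 1 (simplexCutoff n m) := by
  unfold simplexCutoff
  refine contDiff_prod fun k _ => ?_
  exact Real.smoothTransition.contDiff.comp (contDiff_const.mul (contDiff_simplexLift_apply k))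

theorem simplexCutoff_nonneg {n m : ℕ} (y : Fin n → ℝ) : 0 ≤ simplexCutoff n m y :=
  Finset.prod_nonneg fun _ _ => Real.smoothTransition.nonneg _

theorem simplexCutoff_le_one {n m : ℕ} (y : Fin n → ℝ) : simplexCutoff n m y ≤ 1 :=
  Finset.prod_le_one (fun _ _ => Real.smoothTransition.nonneg _)
    fun _ _ => Real.smoothTransition.le_one _

theorem simplexCutoff_eq_zero {n m : ℕ} {y : Fin n → ℝ} (hy : y ∉ cornerSimplex n) :
    simplexCutoff n m y = 0 := by
  rw [mem_cornerSimplex_iff] at hy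
  push Not at hy
  obtain ⟨k, hk⟩ := hy
  refine Finset.prod_eq_zero (Finset.mem_univ k) (Real.smoothTransition.zero_of_nonpos ?_)
  exact mul_nonpos_of_nonneg_of_nonpos (by positivity) hk

theorem fderiv_simplexCutoff_eq_zero {n m : ℕ} {y : Fin n → ℝ} (hy : y ∉ cornerSimplex n) :
    fderiv ℝ (simplexCutoff n m) y = 0 := by
  refine IsLocalMin.fderiv_eq_zero (Filter.Eventually.of_forall fun z => ?_)
  rw [simplexCutoff_eq_zero hy]
  exact simplexCutoff_nonneg z

theorem eventually_simplexCutoff_eq_one {n : ℕ} {y : Fin n → ℝ} (hy : y ∈ cornerSimplex n) :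
    ∀ᶠ m : ℕ in Filter.atTop, simplexCutoff n m =ᶠ[nhds y] fun _ => 1 := by
  rw [mem_cornerSimplex_iff] at hy
  have h : ∀ k, ∀ᶠ m : ℕ in Filter.atTop, 1 < (m + 1 : ℝ) * simplexLift n y k := by
    intro k
    have : Filter.Tendsto (fun m : ℕ => (m + 1 : ℝ) * simplexLift n y k)
        Filter.atTop Filter.atTop :=
      (Filter.tendsto_atTop_add_const_right _ _ tendsto_natCast_atTop_atTop).atTop_mul_const (hy k)
    exact this.eventually_gt_atTop 1
  filter_upwards [Filter.eventually_all.2 h] with m hm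
  have h2 : ∀ k, ∀ᶠ z in nhds y, 1 < (m + 1 : ℝ) * simplexLift n z k := fun k =>
    (continuous_const.mul (continuous_simplexLift_apply k)).continuousAt.eventually
      (lt_mem_nhds (hm k))
  filter_upwards [Filter.eventually_all.2 h2] with z hz
  exact Finset.prod_eq_one fun k _ => Real.smoothTransition.one_of_one_le (hz k).le

/-- A field whose `k`-th barycentric component is `xₖ βₖ` is tangent to the faces, so that the
derivative of the cutoffs along it stays bounded. -/
theorem abs_fderiv_simplexCutoff_le {n : ℕ} {K : ℝ}
    (hK : ∀ t, |t * deriv Real.smoothTransition t| ≤ K) (m : ℕ)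
    (b : Fin (n + 1) → ℝ) (y : Fin n → ℝ) (hb : ∑ k, simplexLift n y k * b k = 0) :
    |fderiv ℝ (simplexCutoff n m) y (fun i => y i * b i.succ)| ≤ ∑ k, K * |b k| := by
  have hK0 : 0 ≤ K := (abs_nonneg _).trans (hK 0)
  have hV : ∀ k, simplexLiftLinear n k (fun i => y i * b i.succ) = simplexLift n y k * b k := by
    refine Fin.cases ?_ (fun i => ?_)
    · rw [Fin.sum_univ_succ] at hb
      simp only [simplexLift_succ] at hb
      rw [simplexLiftLinear_zero]
      linarith
    · rw [simplexLiftLinear_succ, simplexLift_succ]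
  have hd : HasFDerivAt (simplexCutoff n m) (∑ k, (∏ j ∈ Finset.univ.erase k,
      Real.smoothTransition ((m + 1 : ℝ) * simplexLift n y j)) •
      (deriv Real.smoothTransition ((m + 1 : ℝ) * simplexLift n y k) •
        ((m + 1 : ℝ) • simplexLiftLinear n k))) y := by
    refine HasFDerivAt.finsetProd fun k _ => ?_
    have h1 : HasDerivAt Real.smoothTransition
        (deriv Real.smoothTransition ((m + 1 : ℝ) * simplexLift n y k))
        ((m + 1 : ℝ) * simplexLift n y k) :=
      ((Real.smoothTransition.contDiff (n := 1)).differentiable (by simp) _).hasDerivAt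
    exact h1.comp_hasFDerivAt y ((hasFDerivAt_simplexLift k y).const_mul _)
  rw [hd.fderiv, _root_.sum_apply]
  refine (Finset.abs_sum_le_sum_abs _ _).trans (Finset.sum_le_sum fun k _ => ?_)
  simp only [_root_.smul_apply, smul_eq_mul, hV]
  rw [show ∀ p d c x b : ℝ, p * (d * (c * (x * b))) = p * (((c * x) * d) * b) by intros; ring,
    abs_mul, abs_mul]
  have hp : |∏ j ∈ Finset.univ.erase k,
      Real.smoothTransition ((m + 1 : ℝ) * simplexLift n y j)| ≤ 1 := by
    rw [abs_of_nonneg (Finset.prod_nonneg fun _ _ => Real.smoothTransition.nonneg _)]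
    exact Finset.prod_le_one (fun _ _ => Real.smoothTransition.nonneg _)
      fun _ _ => Real.smoothTransition.le_one _
  calc _ ≤ 1 * (K * |b k|) := by gcongr; exact hK _
    _ = _ := one_mul _

theorem hasCompactSupport_simplexCutoff_mul {n : ℕ} (m : ℕ) (g : (Fin n → ℝ) → ℝ) :
    HasCompactSupport fun y => simplexCutoff n m y * g y :=
  HasCompactSupport.intro isCompact_Icc fun y hy => by
    rw [simplexCutoff_eq_zero fun h => hy (cornerSimplex_subset_Icc n h), zero_mul]

/-- Integration by parts on the simplex against a Lipschitz function `F`, for a field with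
components `yᵢ βᵢ` that is tangent to all faces: there is no boundary term. -/
theorem integral_lineDeriv_mul_eq_neg {n : ℕ} {F : (Fin n → ℝ) → ℝ} {C : NNReal}
    (hF : LipschitzWith C F) {b : Fin (n + 1) → (Fin n → ℝ) → ℝ} (hb : ∀ k, ContDiff ℝ 1 (b k))
    (hsum : ∀ y, ∑ k, simplexLift n y k * b k y = 0) :
    ∫ y in cornerSimplex n, ∑ i, lineDeriv ℝ F y (Pi.single i 1) * (y i * b i.succ y) =
      -∫ y in cornerSimplex n, F y * ∑ i, partialDeriv i (fun y => y i * b i.succ y) y := by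
  have hV : ∀ i : Fin n, ContDiff ℝ 1 fun y : Fin n → ℝ => y i * b i.succ y := fun i =>
    (contDiff_apply ℝ ℝ i).mul (hb _)
  have hFd : ∀ v y, |lineDeriv ℝ F y v| ≤ C * ‖v‖ := fun v y => by
    simpa using norm_lineDeriv_le_of_lipschitz ℝ hF (x₀ := y) (v := v)
  have hFm : ∀ v, Measurable fun y => lineDeriv ℝ F y v := fun v =>
    measurable_lineDeriv hF.continuous
  obtain ⟨CF, hCF0, hCF⟩ := exists_bound_on_cornerSimplex hF.continuous
  choose CV hCV0 hCV using fun i => exists_bound_on_cornerSimplex (hV i).continuous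
  choose Cb hCb0 hCb using fun k => exists_bound_on_cornerSimplex (hb k).continuous
  have hdivc : Continuous fun y => ∑ i, partialDeriv i (fun y => y i * b i.succ y) y :=
    continuous_finsetSum _ fun i _ => continuous_partialDeriv (hV i)
  obtain ⟨CD, hCD0, hCD⟩ := exists_bound_on_cornerSimplex hdivc
  obtain ⟨K, hK0, hK⟩ := exists_bound_mul_deriv_smoothTransition
  -- the identity for the compactly supported truncated field
  have step : ∀ m, ∫ y in cornerSimplex n, simplexCutoff n m y *
        ∑ i, lineDeriv ℝ F y (Pi.single i 1) * (y i * b i.succ y) =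
      -∫ y in cornerSimplex n, (simplexCutoff n m y *
        (F y * ∑ i, partialDeriv i (fun y => y i * b i.succ y) y) +
        F y * fderiv ℝ (simplexCutoff n m) y (fun i => y i * b i.succ y)) := by
    intro m
    have hχV : ∀ i : Fin n, ContDiff ℝ 1 fun y => simplexCutoff n m y * (y i * b i.succ y) :=
      fun i => (contDiff_simplexCutoff n m).mul (hV i)
    rw [setIntegral_eq_integral_of_forall_compl_eq_zero
      (fun y hy => by rw [simplexCutoff_eq_zero hy, zero_mul]),
      setIntegral_eq_integral_of_forall_compl_eq_zero
      (fun y hy => by simp [simplexCutoff_eq_zero hy, fderiv_simplexCutoff_eq_zero hy])]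
    have each : ∀ i : Fin n,
        ∫ y, lineDeriv ℝ F y (Pi.single i 1) * (simplexCutoff n m y * (y i * b i.succ y)) =
        -∫ y, partialDeriv i (fun y => simplexCutoff n m y * (y i * b i.succ y)) y * F y := by
      intro i
      obtain ⟨D, hD⟩ := ContDiff.lipschitzWith_of_hasCompactSupport
        (hasCompactSupport_simplexCutoff_mul m _) (hχV i) (by simp)
      rw [LipschitzWith.integral_lineDeriv_mul_eq hF hD
        (hasCompactSupport_simplexCutoff_mul m _), ← integral_neg]
      refine integral_congr_ae (Filter.Eventually.of_forall fun y => ?_)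
      simp only [((hχV i).differentiable (by simp) y).lineDeriv_eq_fderiv, partialDeriv, map_neg,
        neg_mul]
    have int1 : ∀ i : Fin n, Integrable fun y =>
        lineDeriv ℝ F y (Pi.single i 1) * (simplexCutoff n m y * (y i * b i.succ y)) := fun i =>
      ((hχV i).continuous.integrable_of_hasCompactSupport
        (hasCompactSupport_simplexCutoff_mul m _)).bdd_mul (c := C * ‖(Pi.single i 1 : Fin n → ℝ)‖)
        (hFm _).aestronglyMeasurable (Filter.Eventually.of_forall fun y => hFd _ y)
    have int2 : ∀ i : Fin n, Integrable fun y =>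
        partialDeriv i (fun y => simplexCutoff n m y * (y i * b i.succ y)) y * F y := fun i => by
      refine Continuous.integrable_of_hasCompactSupport
        ((continuous_partialDeriv (hχV i)).mul hF.continuous) ?_
      refine HasCompactSupport.mul_right ?_
      exact ((hasCompactSupport_simplexCutoff_mul m _).fderiv ℝ).comp_left
        (g := fun L : (Fin n → ℝ) →L[ℝ] ℝ => L (Pi.single i 1)) rfl
    calc _ = ∫ y, ∑ i, lineDeriv ℝ F y (Pi.single i 1) *
          (simplexCutoff n m y * (y i * b i.succ y)) := by
          refine integral_congr_ae (Filter.Eventually.of_forall fun y => ?_)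
          simp only [Finset.mul_sum]
          exact Finset.sum_congr rfl fun i _ => by ring
      _ = -∫ y, ∑ i, partialDeriv i (fun y => simplexCutoff n m y * (y i * b i.succ y)) y * F y := by
          rw [integral_finsetSum _ fun i _ => int1 i, integral_finsetSum _ fun i _ => int2 i,
            ← Finset.sum_neg_distrib]
          exact Finset.sum_congr rfl fun i _ => each i
      _ = _ := by
          congr 1
          refine integral_congr_ae (Filter.Eventually.of_forall fun y => ?_)
          simp only
          rw [fderiv_apply_eq_sum (fderiv ℝ (simplexCutoff n m) y), Finset.mul_sum,
            Finset.mul_sum, Finset.mul_sum, ← Finset.sum_add_distrib]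
          refine Finset.sum_congr rfl fun i _ => ?_
          rw [partialDeriv_mul ((contDiff_simplexCutoff n m).differentiable (by simp) y)
            ((hV i).differentiable (by simp) y)]
          simp only [partialDeriv]
          ring
  have hdf : Measurable fun y : Fin n → ℝ =>
      ∑ i, lineDeriv ℝ F y (Pi.single i 1) * (y i * b i.succ y) :=
    Finset.measurable_fun_sum _ fun i _ => (hFm _).mul (hV i).continuous.measurable
  have limL : Filter.Tendsto (fun m : ℕ => ∫ y in cornerSimplex n, simplexCutoff n m y *
      ∑ i, lineDeriv ℝ F y (Pi.single i 1) * (y i * b i.succ y)) Filter.atTop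
      (nhds (∫ y in cornerSimplex n,
        ∑ i, lineDeriv ℝ F y (Pi.single i 1) * (y i * b i.succ y))) := by
    refine tendsto_integral_of_dominated_convergence
      (fun _ => ∑ i : Fin n, C * ‖(Pi.single i 1 : Fin n → ℝ)‖ * CV i) (fun m => ?_)
      (integrable_const _) (fun m => ?_) ?_
    · exact ((contDiff_simplexCutoff n m).continuous.measurable.mul
        hdf).aestronglyMeasurable
    · refine (ae_restrict_iff' (measurableSet_cornerSimplex n)).2
        (Filter.Eventually.of_forall fun y hy => ?_)
      rw [Real.norm_eq_abs, abs_mul, abs_of_nonneg (simplexCutoff_nonneg y)]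
      refine (mul_le_of_le_one_left (abs_nonneg _) (simplexCutoff_le_one y)).trans ?_
      refine (Finset.abs_sum_le_sum_abs _ _).trans (Finset.sum_le_sum fun i _ => ?_)
      rw [abs_mul]
      exact mul_le_mul (hFd _ y) (hCV i y hy) (abs_nonneg _) (by positivity)
    · refine (ae_restrict_iff' (measurableSet_cornerSimplex n)).2
        (Filter.Eventually.of_forall fun y hy => ?_)
      refine tendsto_const_nhds.congr' ?_
      filter_upwards [eventually_simplexCutoff_eq_one hy] with m hm
      rw [hm.eq_of_nhds, one_mul]
  have limR : Filter.Tendsto (fun m : ℕ => ∫ y in cornerSimplex n, (simplexCutoff n m y *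
      (F y * ∑ i, partialDeriv i (fun y => y i * b i.succ y) y) +
      F y * fderiv ℝ (simplexCutoff n m) y (fun i => y i * b i.succ y))) Filter.atTop
      (nhds (∫ y in cornerSimplex n,
        F y * ∑ i, partialDeriv i (fun y => y i * b i.succ y) y)) := by
    refine tendsto_integral_of_dominated_convergence
      (fun _ => CF * CD + CF * ∑ k, K * Cb k) (fun m => ?_)
      (integrable_const _) (fun m => ?_) ?_
    · refine Continuous.aestronglyMeasurable ?_
      refine ((contDiff_simplexCutoff n m).continuous.mul (hF.continuous.mul hdivc)).add
        (hF.continuous.mul ?_)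
      exact ((contDiff_simplexCutoff n m).continuous_fderiv (by simp)).clm_apply
        (continuous_pi fun i => (hV i).continuous)
    · refine (ae_restrict_iff' (measurableSet_cornerSimplex n)).2
        (Filter.Eventually.of_forall fun y hy => ?_)
      rw [Real.norm_eq_abs]
      refine (abs_add_le _ _).trans (add_le_add ?_ ?_)
      · rw [abs_mul, abs_of_nonneg (simplexCutoff_nonneg y), abs_mul]
        refine (mul_le_of_le_one_left (by positivity) (simplexCutoff_le_one y)).trans ?_
        exact mul_le_mul (hCF y hy) (hCD y hy) (abs_nonneg _) hCF0
      · rw [abs_mul]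
        refine mul_le_mul (hCF y hy) ?_ (abs_nonneg _) hCF0
        refine (abs_fderiv_simplexCutoff_le hK m (fun k => b k y) y (hsum y)).trans ?_
        exact Finset.sum_le_sum fun k _ => mul_le_mul_of_nonneg_left (hCb k y hy) hK0
    · refine (ae_restrict_iff' (measurableSet_cornerSimplex n)).2
        (Filter.Eventually.of_forall fun y hy => ?_)
      refine tendsto_const_nhds.congr' ?_
      filter_upwards [eventually_simplexCutoff_eq_one hy] with m hm
      rw [hm.eq_of_nhds, hm.fderiv_eq]
      simp
  exact tendsto_nhds_unique limL ((limR.neg).congr fun m => (step m).symm)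

/-- The divergence theorem on the simplex for a field with components `yᵢ βᵢ` that is tangent to
all faces. -/
theorem integral_divergence_eq_zero {n : ℕ}
    {b : Fin (n + 1) → (Fin n → ℝ) → ℝ} (hb : ∀ k, ContDiff ℝ 1 (b k))
    (hsum : ∀ y, ∑ k, simplexLift n y k * b k y = 0) :
    ∫ y in cornerSimplex n, ∑ i, partialDeriv i (fun y => y i * b i.succ y) y = 0 := by
  have h := integral_lineDeriv_mul_eq_neg (F := fun _ => 1) (LipschitzWith.const (1 : ℝ)) hb hsum
  have h0 : ∀ (y : Fin n → ℝ) v, lineDeriv ℝ (fun _ : Fin n → ℝ => (1 : ℝ)) y v = 0 := by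
    intro y v; simp [lineDeriv]
  simp only [h0, zero_mul, Finset.sum_const_zero, integral_zero, one_mul] at h
  linarith

/-! ### Polynomials on the simplex -/

theorem partialDeriv_sub {n : ℕ} {i : Fin n} {f g : (Fin n → ℝ) → ℝ} {y : Fin n → ℝ}
    (hf : DifferentiableAt ℝ f y) (hg : DifferentiableAt ℝ g y) :
    partialDeriv i (fun y => f y - g y) y = partialDeriv i f y - partialDeriv i g y := by
  simp [partialDeriv, fderiv_fun_sub hf hg]

theorem partialDeriv_sum {n : ℕ} {ι : Type*} [Fintype ι] {i : Fin n}
    {f : ι → (Fin n → ℝ) → ℝ} {y : Fin n → ℝ} (hf : ∀ k, DifferentiableAt ℝ (f k) y) :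
    partialDeriv i (fun y => ∑ k, f k y) y = ∑ k, partialDeriv i (f k) y := by
  simp [partialDeriv, fderiv_fun_sum fun k _ => hf k]

open MvPolynomial in
theorem contDiff_eval {n : ℕ} {m : WithTop ℕ∞} (p : MvPolynomial (Fin n) ℝ) :
    ContDiff ℝ m fun y : Fin n → ℝ => eval y p :=
  (AnalyticOnNhd.eval_mvPolynomial p).contDiff

open MvPolynomial in
theorem partialDeriv_eval {n : ℕ} (i : Fin n) (p : MvPolynomial (Fin n) ℝ) (y : Fin n → ℝ) :
    partialDeriv i (fun y => eval y p) y = eval y (pderiv i p) := by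
  have hd : ∀ p : MvPolynomial (Fin n) ℝ, DifferentiableAt ℝ (fun y : Fin n → ℝ => eval y p) y :=
    fun p => (contDiff_eval (m := 1) p).differentiable (by simp) y
  induction p using MvPolynomial.induction_on with
  | C a => simp [partialDeriv]
  | add p q hp hq =>
    simp only [map_add] at *
    rw [← hp, ← hq]
    simp [partialDeriv, fderiv_fun_add (hd p) (hd q)]
  | mul_X p j hp =>
    simp only [map_mul, eval_X, pderiv_mul, map_add]
    rw [partialDeriv_mul (hd p) (by fun_prop), hp]
    have : partialDeriv i (fun y : Fin n → ℝ => y j) y = eval y (pderiv i (X j)) := by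
      rw [pderiv_X]
      simp [partialDeriv, (hasFDerivAt_apply (𝕜 := ℝ) j y).fderiv, Pi.single_apply, eq_comm]
    rw [this]
    ring

theorem pderiv_comm {n : ℕ} (i j : Fin n) (p : MvPolynomial (Fin n) ℝ) :
    MvPolynomial.pderiv i (MvPolynomial.pderiv j p) =
      MvPolynomial.pderiv j (MvPolynomial.pderiv i p) := by
  classical
  induction p using MvPolynomial.induction_on with
  | C a => simp
  | add p q hp hq => simp [hp, hq]
  | mul_X p k hp =>
    simp only [MvPolynomial.pderiv_mul, map_add, MvPolynomial.pderiv_X, hp]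
    have h : ∀ i j : Fin n, MvPolynomial.pderiv i ((Pi.single j 1 : Fin n → _) k) =
        (0 : MvPolynomial (Fin n) ℝ) := by
      intro i j
      rw [Pi.single_apply]
      split_ifs <;> simp
    rw [h, h]
    ring

/-- The barycentric coordinates as polynomials on `ℝⁿ`. -/
noncomputable def baryPoly (n : ℕ) : Fin (n + 1) → MvPolynomial (Fin n) ℝ :=
  Fin.cons (1 - ∑ i, MvPolynomial.X i) MvPolynomial.X

theorem eval_baryPoly {n : ℕ} (y : Fin n → ℝ) (k : Fin (n + 1)) :
    MvPolynomial.eval y (baryPoly n k) = simplexLift n y k := by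
  refine Fin.cases ?_ (fun i => ?_) k
  · simp [baryPoly, simplexLift_zero]
  · simp [baryPoly, simplexLift_succ]

theorem baryPoly_succ {n : ℕ} (i : Fin n) : baryPoly n i.succ = MvPolynomial.X i := rfl

theorem pderiv_baryPoly_succ {n : ℕ} (i j : Fin n) :
    MvPolynomial.pderiv i (baryPoly n j.succ) = if i = j then 1 else 0 := by
  rw [baryPoly_succ, MvPolynomial.pderiv_X, Pi.single_apply]
  simp only [eq_comm]

theorem pderiv_baryPoly_zero {n : ℕ} (i : Fin n) :
    MvPolynomial.pderiv i (baryPoly n 0) = -1 := by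
  simp [baryPoly, MvPolynomial.pderiv_X, Pi.single_apply]

/-- The Euler derivative `∑ᵢ yᵢ ∂ᵢ p`. -/
noncomputable def eulerDeriv {n : ℕ} (p : MvPolynomial (Fin n) ℝ) : MvPolynomial (Fin n) ℝ :=
  ∑ i, MvPolynomial.X i * MvPolynomial.pderiv i p

/-- The centred derivatives `bₖ = ∂ₖ p - ∑ᵢ yᵢ ∂ᵢ p` of `p`, where `∂₀ p = 0` because `p` is
regarded as a function of `x₁, …, xₙ` only. The vector field with barycentric components `xₖ bₖ`
is the gradient of `p` for the metric in which `2 √xₖ` are the coordinates of the sphere of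
radius `2`. -/
noncomputable def centeredDeriv {n : ℕ} (p : MvPolynomial (Fin n) ℝ) :
    Fin (n + 1) → MvPolynomial (Fin n) ℝ :=
  Fin.cons (-eulerDeriv p) fun i => MvPolynomial.pderiv i p - eulerDeriv p

theorem centeredDeriv_zero {n : ℕ} (p : MvPolynomial (Fin n) ℝ) :
    centeredDeriv p 0 = -eulerDeriv p := rfl

theorem centeredDeriv_succ {n : ℕ} (p : MvPolynomial (Fin n) ℝ) (i : Fin n) :
    centeredDeriv p i.succ = MvPolynomial.pderiv i p - eulerDeriv p := rfl

/-- The tuple `b` describes a field `xₖ bₖ` tangent to the hyperplane `∑ₖ xₖ = 1`. -/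
def IsTangent {n : ℕ} (b : Fin (n + 1) → MvPolynomial (Fin n) ℝ) : Prop :=
  ∑ k, baryPoly n k * b k = 0

theorem isTangent_centeredDeriv {n : ℕ} (p : MvPolynomial (Fin n) ℝ) :
    IsTangent (centeredDeriv p) := by
  rw [IsTangent, Fin.sum_univ_succ]
  simp only [centeredDeriv_zero, centeredDeriv_succ, baryPoly_succ, mul_sub,
    Finset.sum_sub_distrib, ← Finset.sum_mul]
  rw [show baryPoly n 0 = 1 - ∑ i, MvPolynomial.X i from rfl]
  rw [show ∑ i, MvPolynomial.X i * MvPolynomial.pderiv i p = eulerDeriv p from rfl]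
  ring

theorem IsTangent.eval {n : ℕ} {b : Fin (n + 1) → MvPolynomial (Fin n) ℝ} (hb : IsTangent b)
    (y : Fin n → ℝ) : ∑ k, simplexLift n y k * MvPolynomial.eval y (b k) = 0 := by
  simpa [eval_baryPoly] using congrArg (MvPolynomial.eval y) hb

/-- The components `yᵢ bᵢ` in `ℝⁿ` of the field on the simplex described by `b`. -/
noncomputable def fieldComp {n : ℕ} (b : Fin (n + 1) → MvPolynomial (Fin n) ℝ) (i : Fin n) :
    MvPolynomial (Fin n) ℝ := MvPolynomial.X i * b i.succ

theorem eval_fieldComp {n : ℕ} (b : Fin (n + 1) → MvPolynomial (Fin n) ℝ) (i : Fin n)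
    (y : Fin n → ℝ) :
    MvPolynomial.eval y (fieldComp b i) = y i * MvPolynomial.eval y (b i.succ) := by
  simp [fieldComp]

/-- The Euclidean divergence of the field described by `b`. -/
noncomputable def fieldDiv {n : ℕ} (b : Fin (n + 1) → MvPolynomial (Fin n) ℝ) :
    MvPolynomial (Fin n) ℝ := ∑ i, MvPolynomial.pderiv i (fieldComp b i)

/-- The divergence of the field described by `b` relative to the density `exp (-ψ)`. -/
noncomputable def weightedDiv {n : ℕ} (ψ : (Fin n → ℝ) → ℝ)
    (b : Fin (n + 1) → MvPolynomial (Fin n) ℝ) (y : Fin n → ℝ) : ℝ :=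
  MvPolynomial.eval y (fieldDiv b) -
    ∑ i, partialDeriv i ψ y * MvPolynomial.eval y (fieldComp b i)

theorem contDiff_weightedDiv {n : ℕ} {ψ : (Fin n → ℝ) → ℝ} (hψ : ContDiff ℝ ∞ ψ)
    (b : Fin (n + 1) → MvPolynomial (Fin n) ℝ) : ContDiff ℝ ∞ (weightedDiv ψ b) :=
  (contDiff_eval _).sub
    (ContDiff.sum fun _ _ => (contDiff_partialDeriv hψ).mul (contDiff_eval _))

/-! ### The Bochner identity -/

theorem sum_partialDeriv_exp_mul {n : ℕ} {ψ : (Fin n → ℝ) → ℝ} (hψ : ContDiff ℝ ∞ ψ)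
    {b : Fin (n + 1) → (Fin n → ℝ) → ℝ} (hb : ∀ k, ContDiff ℝ ∞ (b k)) (y : Fin n → ℝ) :
    ∑ i, partialDeriv i (fun y => y i * (Real.exp (-ψ y) * b i.succ y)) y =
      Real.exp (-ψ y) * (∑ i, partialDeriv i (fun y => y i * b i.succ y) y -
        ∑ i, partialDeriv i ψ y * (y i * b i.succ y)) := by
  rw [← Finset.sum_sub_distrib, Finset.mul_sum]
  refine Finset.sum_congr rfl fun i _ => ?_
  have hE : ContDiff ℝ ∞ fun y => Real.exp (-ψ y) := hψ.neg.exp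
  have e : (fun y : Fin n → ℝ => y i * (Real.exp (-ψ y) * b i.succ y)) =
      fun y => Real.exp (-ψ y) * (y i * b i.succ y) := by
    ext y; ring
  have hEd : partialDeriv i (fun y => Real.exp (-ψ y)) y
      = -(Real.exp (-ψ y) * partialDeriv i ψ y) := by
    have h1 := ((hψ.differentiable (by simp) y).hasFDerivAt.neg).exp
    have h2 : HasFDerivAt (fun y => Real.exp (-ψ y)) _ y := h1
    simp [partialDeriv, h2.fderiv]
  rw [e, partialDeriv_mul (hE.differentiable (by simp) y)
    (((contDiff_apply ℝ ℝ i).mul ((hb i.succ).of_le (m := 1) (by simp))).differentiable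
      (by simp) y), hEd]
  ring

theorem sum_simplexLift_mul_mul_eq_zero {n : ℕ} {b : Fin (n + 1) → ℝ} {y : Fin n → ℝ}
    (hsum : ∑ k, simplexLift n y k * b k = 0) (a : ℝ) :
    ∑ k, simplexLift n y k * (a * b k) = 0 := by
  rw [← mul_zero a, ← hsum, Finset.mul_sum]
  exact Finset.sum_congr rfl fun k _ => by ring

theorem integral_exp_mul_divergence_eq_zero {n : ℕ} {ψ : (Fin n → ℝ) → ℝ}
    (hψ : ContDiff ℝ ∞ ψ) {b : Fin (n + 1) → (Fin n → ℝ) → ℝ} (hb : ∀ k, ContDiff ℝ ∞ (b k))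
    (hsum : ∀ y, ∑ k, simplexLift n y k * b k y = 0) :
    ∫ y in cornerSimplex n, Real.exp (-ψ y) *
      (∑ i, partialDeriv i (fun y => y i * b i.succ y) y -
        ∑ i, partialDeriv i ψ y * (y i * b i.succ y)) = 0 := by
  simp only [← sum_partialDeriv_exp_mul hψ hb]
  exact integral_divergence_eq_zero (b := fun k y => Real.exp (-ψ y) * b k y)
    (fun k => (hψ.neg.exp.mul (hb k)).of_le (by simp))
    fun y => sum_simplexLift_mul_mul_eq_zero (hsum y) _

theorem integral_exp_mul_weightedDiv_eq_zero {n : ℕ} {ψ : (Fin n → ℝ) → ℝ}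
    (hψ : ContDiff ℝ ∞ ψ) {b : Fin (n + 1) → MvPolynomial (Fin n) ℝ} (hb : IsTangent b) :
    ∫ y in cornerSimplex n, Real.exp (-ψ y) * weightedDiv ψ b y = 0 := by
  rw [← integral_exp_mul_divergence_eq_zero hψ (b := fun k y => MvPolynomial.eval y (b k))
    (fun k => contDiff_eval _) hb.eval]
  refine integral_congr_ae (Filter.Eventually.of_forall fun y => ?_)
  simp only [weightedDiv, fieldDiv, map_sum, ← eval_fieldComp, partialDeriv_eval]

/-- The trace of the square of the Euclidean derivative of the field described by `b`. -/
noncomputable def fieldTraceSq {n : ℕ} (b : Fin (n + 1) → MvPolynomial (Fin n) ℝ) :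
    MvPolynomial (Fin n) ℝ :=
  ∑ i, ∑ j, MvPolynomial.pderiv j (fieldComp b i) * MvPolynomial.pderiv i (fieldComp b j)

theorem partialDeriv_weightedDiv {n : ℕ} {ψ : (Fin n → ℝ) → ℝ} (hψ : ContDiff ℝ ∞ ψ)
    (b : Fin (n + 1) → MvPolynomial (Fin n) ℝ) (j : Fin n) (y : Fin n → ℝ) :
    partialDeriv j (weightedDiv ψ b) y =
      MvPolynomial.eval y (MvPolynomial.pderiv j (fieldDiv b)) -
        ∑ i, (partialDeriv i ψ y * MvPolynomial.eval y (MvPolynomial.pderiv j (fieldComp b i)) +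
          MvPolynomial.eval y (fieldComp b i) * partialDeriv j (partialDeriv i ψ) y) := by
  have hψd : ∀ i, DifferentiableAt ℝ (partialDeriv i ψ) y := fun i =>
    (contDiff_partialDeriv hψ).differentiable (by simp) y
  have hev : ∀ p : MvPolynomial (Fin n) ℝ,
      DifferentiableAt ℝ (fun y : Fin n → ℝ => MvPolynomial.eval y p) y := fun p =>
    (contDiff_eval (m := 1) p).differentiable (by simp) y
  have h2 : weightedDiv ψ b = fun y => MvPolynomial.eval y (fieldDiv b) -
      ∑ i, partialDeriv i ψ y * MvPolynomial.eval y (fieldComp b i) := rfl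
  rw [h2, partialDeriv_sub (hev _) (DifferentiableAt.fun_sum fun i _ => (hψd i).fun_mul (hev _)),
    partialDeriv_sum fun i => (hψd i).fun_mul (hev _), partialDeriv_eval]
  congr 1
  refine Finset.sum_congr rfl fun i _ => ?_
  rw [partialDeriv_mul (hψd i) (hev _), partialDeriv_eval]

/-- Bochner's identity in affine coordinates, for an arbitrary tangent field: it is the
divergence theorem for `(div w) w - D_w w`. -/
theorem integral_exp_mul_weightedDiv_sq {n : ℕ} {ψ : (Fin n → ℝ) → ℝ}
    (hψ : ContDiff ℝ ∞ ψ) {b : Fin (n + 1) → MvPolynomial (Fin n) ℝ} (hb : IsTangent b) :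
    ∫ y in cornerSimplex n, Real.exp (-ψ y) * (weightedDiv ψ b y ^ 2 -
      ∑ i, ∑ j, partialDeriv j (partialDeriv i ψ) y * MvPolynomial.eval y (fieldComp b i) *
        MvPolynomial.eval y (fieldComp b j) - MvPolynomial.eval y (fieldTraceSq b)) = 0 := by
  classical
  let r : Fin (n + 1) → MvPolynomial (Fin n) ℝ := fun k =>
    b k * b k + ∑ i, fieldComp b i * MvPolynomial.pderiv i (b k)
  -- differentiate the tangency relation along the field itself
  have hr : ∀ k, baryPoly n k * (∑ i, fieldComp b i * MvPolynomial.pderiv i (b k)) +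
      (∑ i, fieldComp b i * MvPolynomial.pderiv i (baryPoly n k)) * b k =
      ∑ i, fieldComp b i * MvPolynomial.pderiv i (baryPoly n k * b k) := by
    intro k
    rw [Finset.mul_sum, Finset.sum_mul, ← Finset.sum_add_distrib]
    refine Finset.sum_congr rfl fun i _ => ?_
    rw [MvPolynomial.pderiv_mul]; ring
  have hw : ∀ k, ∑ i, fieldComp b i * MvPolynomial.pderiv i (baryPoly n k) =
      baryPoly n k * b k := by
    refine Fin.cases ?_ (fun j => ?_)
    · simp only [pderiv_baryPoly_zero, ← Finset.sum_mul]
      have := hb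
      rw [IsTangent, Fin.sum_univ_succ] at this
      simp only [fieldComp]
      simp only [baryPoly_succ] at this
      linear_combination -this
    · simp only [pderiv_baryPoly_succ, mul_ite, mul_one, mul_zero, Finset.sum_ite_eq',
        Finset.mem_univ, if_true]
      rfl
  have hrt : IsTangent r := by
    have h1 : ∀ k, baryPoly n k * r k =
        ∑ i, fieldComp b i * MvPolynomial.pderiv i (baryPoly n k * b k) := by
      intro k
      rw [← hr, hw]
      simp only [r]
      ring
    rw [IsTangent]
    simp only [h1]
    rw [Finset.sum_comm]
    refine Finset.sum_eq_zero fun i _ => ?_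
    rw [← Finset.mul_sum, ← map_sum, show ∑ k, baryPoly n k * b k = 0 from hb, map_zero, mul_zero]
  have hrj : ∀ j, fieldComp r j = ∑ i, fieldComp b i * MvPolynomial.pderiv i (fieldComp b j) := by
    intro j
    have := hr j.succ
    rw [hw] at this
    rw [show fieldComp b j = baryPoly n j.succ * b j.succ from rfl, ← this]
    simp only [r, fieldComp, baryPoly_succ]
    ring
  have hD := contDiff_weightedDiv hψ b
  have hDd : ∀ y, DifferentiableAt ℝ (weightedDiv ψ b) y := hD.differentiable (by simp)
  have hev : ∀ (p : MvPolynomial (Fin n) ℝ) (y : Fin n → ℝ),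
      DifferentiableAt ℝ (fun y : Fin n → ℝ => MvPolynomial.eval y p) y := fun p =>
    (contDiff_eval (m := 1) p).differentiable (by simp)
  rw [← integral_exp_mul_divergence_eq_zero hψ
    (b := fun k y => weightedDiv ψ b y * MvPolynomial.eval y (b k) - MvPolynomial.eval y (r k))
    (fun k => (hD.mul (contDiff_eval _)).sub (contDiff_eval _)) (fun y => by
      have h1 := hb.eval y
      have h2 := hrt.eval y
      simp only [mul_sub, Finset.sum_sub_distrib, h2, sub_zero, mul_left_comm _ (weightedDiv ψ b y),
        ← Finset.mul_sum, h1, mul_zero])]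
  refine integral_congr_ae (Filter.Eventually.of_forall fun y => ?_)
  simp only
  congr 1
  have hfun : ∀ j : Fin n, (fun y : Fin n → ℝ => y j * (weightedDiv ψ b y *
      MvPolynomial.eval y (b j.succ) - MvPolynomial.eval y (r j.succ))) =
      fun y => weightedDiv ψ b y * MvPolynomial.eval y (fieldComp b j) -
        MvPolynomial.eval y (fieldComp r j) := by
    intro j; ext y; rw [eval_fieldComp, eval_fieldComp]; ring
  have hpart : ∀ j : Fin n, partialDeriv j (fun y : Fin n → ℝ => y j * (weightedDiv ψ b y *
      MvPolynomial.eval y (b j.succ) - MvPolynomial.eval y (r j.succ))) y =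
      weightedDiv ψ b y * MvPolynomial.eval y (MvPolynomial.pderiv j (fieldComp b j)) +
        MvPolynomial.eval y (fieldComp b j) * partialDeriv j (weightedDiv ψ b) y -
        MvPolynomial.eval y (MvPolynomial.pderiv j (fieldComp r j)) := by
    intro j
    rw [hfun, ← partialDeriv_eval, ← partialDeriv_eval, ← partialDeriv_mul (hDd y) (hev _ y)]
    exact partialDeriv_sub ((hDd y).fun_mul (hev _ y)) (hev _ y)
  have hpD := fun j => partialDeriv_weightedDiv hψ b j y
  have hR : ∑ j, MvPolynomial.pderiv j (fieldComp r j) = fieldTraceSq b +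
      ∑ j, fieldComp b j * MvPolynomial.pderiv j (fieldDiv b) := by
    have h1 : ∀ j, MvPolynomial.pderiv j (fieldComp r j) =
        ∑ i, MvPolynomial.pderiv j (fieldComp b i) * MvPolynomial.pderiv i (fieldComp b j) +
        ∑ i, fieldComp b i * MvPolynomial.pderiv i (MvPolynomial.pderiv j (fieldComp b j)) := by
      intro j
      rw [hrj, map_sum, ← Finset.sum_add_distrib]
      exact Finset.sum_congr rfl fun i _ => by rw [MvPolynomial.pderiv_mul, pderiv_comm j i]
    have h2 : ∀ i, fieldComp b i * MvPolynomial.pderiv i (fieldDiv b) =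
        ∑ j, fieldComp b i * MvPolynomial.pderiv i (MvPolynomial.pderiv j (fieldComp b j)) := by
      intro i
      rw [fieldDiv, map_sum, Finset.mul_sum]
    have h3 : ∑ i, fieldComp b i * MvPolynomial.pderiv i (fieldDiv b) = ∑ j, ∑ i,
        fieldComp b i * MvPolynomial.pderiv i (MvPolynomial.pderiv j (fieldComp b j)) := by
      rw [Finset.sum_comm]
      exact Finset.sum_congr rfl fun i _ => h2 i
    have h4 : fieldTraceSq b = ∑ j, ∑ i,
        MvPolynomial.pderiv j (fieldComp b i) * MvPolynomial.pderiv i (fieldComp b j) :=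
      Finset.sum_comm
    rw [h3, h4, ← Finset.sum_add_distrib]
    exact Finset.sum_congr rfl fun j _ => h1 j
  have hR' := congrArg (MvPolynomial.eval y) hR
  have hrj' : ∀ j, MvPolynomial.eval y (fieldComp r j) = ∑ i, MvPolynomial.eval y (fieldComp b i) *
      MvPolynomial.eval y (MvPolynomial.pderiv i (fieldComp b j)) := by
    intro j; rw [hrj]; simp
  rw [map_sum, map_add, map_sum] at hR'
  simp only [map_mul] at hR'
  have e1 : ∑ j, weightedDiv ψ b y * MvPolynomial.eval y (MvPolynomial.pderiv j (fieldComp b j)) =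
      weightedDiv ψ b y * MvPolynomial.eval y (fieldDiv b) := by
    rw [← Finset.mul_sum, fieldDiv, map_sum]
  have e2 : ∑ j, partialDeriv j ψ y *
      (weightedDiv ψ b y * MvPolynomial.eval y (fieldComp b j)) =
      weightedDiv ψ b y * (MvPolynomial.eval y (fieldDiv b) - weightedDiv ψ b y) := by
    rw [show MvPolynomial.eval y (fieldDiv b) - weightedDiv ψ b y =
      ∑ i, partialDeriv i ψ y * MvPolynomial.eval y (fieldComp b i) by rw [weightedDiv]; ring,
      Finset.mul_sum]
    exact Finset.sum_congr rfl fun i _ => by ring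
  have e3 : ∑ j, ∑ i, partialDeriv j ψ y * (MvPolynomial.eval y (fieldComp b i) *
        MvPolynomial.eval y (MvPolynomial.pderiv i (fieldComp b j))) =
      ∑ j, ∑ i, MvPolynomial.eval y (fieldComp b j) * (partialDeriv i ψ y *
        MvPolynomial.eval y (MvPolynomial.pderiv j (fieldComp b i))) := by
    rw [Finset.sum_comm]
    exact Finset.sum_congr rfl fun i _ => Finset.sum_congr rfl fun j _ => by ring
  have e4 : ∑ j, ∑ i, MvPolynomial.eval y (fieldComp b j) * (MvPolynomial.eval y (fieldComp b i) *
        partialDeriv j (partialDeriv i ψ) y) =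
      ∑ i, ∑ j, partialDeriv j (partialDeriv i ψ) y * MvPolynomial.eval y (fieldComp b i) *
        MvPolynomial.eval y (fieldComp b j) := by
    rw [Finset.sum_comm]
    exact Finset.sum_congr rfl fun i _ => Finset.sum_congr rfl fun j _ => by ring
  have e5 : ∑ j, MvPolynomial.eval y (fieldComp b j) * partialDeriv j (weightedDiv ψ b) y =
      ∑ j, MvPolynomial.eval y (fieldComp b j) *
        MvPolynomial.eval y (MvPolynomial.pderiv j (fieldDiv b)) -
      (∑ j, ∑ i, MvPolynomial.eval y (fieldComp b j) * (partialDeriv i ψ y *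
        MvPolynomial.eval y (MvPolynomial.pderiv j (fieldComp b i))) +
      ∑ j, ∑ i, MvPolynomial.eval y (fieldComp b j) * (MvPolynomial.eval y (fieldComp b i) *
        partialDeriv j (partialDeriv i ψ) y)) := by
    rw [← Finset.sum_add_distrib, ← Finset.sum_sub_distrib]
    refine Finset.sum_congr rfl fun j _ => ?_
    rw [hpD, mul_sub, Finset.mul_sum, ← Finset.sum_add_distrib]
    congr 1
    exact Finset.sum_congr rfl fun i _ => by ring
  have e6 : ∑ j, partialDeriv j ψ y * (y j * (weightedDiv ψ b y *
      MvPolynomial.eval y (b j.succ) - MvPolynomial.eval y (r j.succ))) =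
      ∑ j, partialDeriv j ψ y * (weightedDiv ψ b y * MvPolynomial.eval y (fieldComp b j)) -
      ∑ j, ∑ i, partialDeriv j ψ y * (MvPolynomial.eval y (fieldComp b i) *
        MvPolynomial.eval y (MvPolynomial.pderiv i (fieldComp b j))) := by
    rw [← Finset.sum_sub_distrib]
    refine Finset.sum_congr rfl fun j _ => ?_
    rw [congrFun (hfun j) y, mul_sub, hrj', Finset.mul_sum (f := fun i =>
      MvPolynomial.eval y (fieldComp b i) *
        MvPolynomial.eval y (MvPolynomial.pderiv i (fieldComp b j)))]
  rw [Finset.sum_congr rfl fun j _ => hpart j, Finset.sum_sub_distrib, Finset.sum_add_distrib,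
    e6, e5, hR', e1, e2, e3, e4]
  ring

/-! ### The pointwise curvature computation -/

/-- The squared Hilbert–Schmidt norm of a symmetric matrix compressed to the orthogonal complement
of the unit vector `(√xₖ)`, written without square roots, is nonnegative. -/
theorem compressed_sum_sq_nonneg {ι : Type*} [Fintype ι] {x : ι → ℝ} {B : ι → ι → ℝ}
    (hx : ∀ k, 0 < x k) (hx1 : ∑ k, x k = 1) (hB : ∀ k l, B k l = B l k) :
    0 ≤ ∑ k, ∑ l, x k * x l * B k l ^ 2 - 2 * ∑ k, x k * (∑ l, x l * B k l) ^ 2 +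
      (∑ k, x k * ∑ l, x l * B k l) ^ 2 := by
  set m : ι → ℝ := fun k => ∑ l, x l * B k l with hm
  set V := ∑ k, x k * m k with hV
  have h : ∑ k, ∑ l, x k * x l * (B k l - m k - m l + V) ^ 2 =
      ∑ k, ∑ l, x k * x l * B k l ^ 2 - 2 * ∑ k, x k * m k ^ 2 + V ^ 2 := by
    have e1 : ∀ k, ∑ l, x k * x l * (B k l - m k - m l + V) ^ 2 =
        ∑ l, x k * x l * B k l ^ 2 + x k * (m k) ^ 2 + x k * ∑ l, x l * m l ^ 2 + x k * V ^ 2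
        - 2 * x k * m k * m k - 2 * x k * ∑ l, x l * (B k l * m l) + 2 * V * (x k * m k)
        + 2 * (x k * m k) * V - 2 * (x k * m k) * V - 2 * V * (x k * V) := by
      intro k
      have : ∀ l, x k * x l * (B k l - m k - m l + V) ^ 2 =
          x k * x l * B k l ^ 2 + x k * (m k) ^ 2 * x l + x k * (x l * m l ^ 2) +
          x k * V ^ 2 * x l - 2 * x k * m k * (x l * B k l) - 2 * x k * (x l * (B k l * m l)) +
          2 * V * x k * (x l * B k l) + 2 * x k * m k * (x l * m l) - 2 * x k * m k * V * x l
          - 2 * V * x k * (x l * m l) := by intro l; ring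
      simp only [this, Finset.sum_add_distrib, Finset.sum_sub_distrib, ← Finset.mul_sum, hx1]
      rw [show ∑ l, x l * B k l = m k from rfl, ← hV]
      ring
    have e2 : ∑ k, x k * ∑ l, x l * (B k l * m l) = ∑ l, x l * m l ^ 2 := by
      simp only [Finset.mul_sum]
      rw [Finset.sum_comm]
      refine Finset.sum_congr rfl fun l _ => ?_
      have : x l * m l ^ 2 = ∑ k, x l * m l * (x k * B l k) := by
        rw [← Finset.mul_sum]; simp only [hm]; ring
      rw [this]
      exact Finset.sum_congr rfl fun k _ => by rw [hB l k]; ring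
    have e3 : ∑ k, 2 * x k * m k * m k = 2 * ∑ k, x k * m k ^ 2 := by
      rw [Finset.mul_sum]; exact Finset.sum_congr rfl fun k _ => by ring
    have e4 : ∑ k, 2 * x k * ∑ l, x l * (B k l * m l) = 2 * ∑ l, x l * m l ^ 2 := by
      rw [← e2, Finset.mul_sum]; exact Finset.sum_congr rfl fun k _ => by ring
    have e5 : ∑ k, 2 * (x k * m k) * V = 2 * V * V := by
      rw [← Finset.sum_mul, ← Finset.mul_sum, ← hV]
    simp only [e1, Finset.sum_add_distrib, Finset.sum_sub_distrib, e3, e4, e5]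
    simp only [← Finset.mul_sum, ← Finset.sum_mul, hx1, ← hV]
    ring
  rw [← h]
  exact Finset.sum_nonneg fun k _ => Finset.sum_nonneg fun l _ =>
    mul_nonneg (mul_nonneg (hx k).le (hx l).le) (sq_nonneg _)

/-- Expansion of the previous inequality for the Hessian of a function in the coordinates `2 √xₖ`:
its diagonal contains the first derivatives `bₖ / 2` of the function. -/
theorem hessian_sum_sq_nonneg {ι : Type*} [Fintype ι] [DecidableEq ι] {x b : ι → ℝ}
    {H : ι → ι → ℝ} (hx : ∀ k, 0 < x k) (hx1 : ∑ k, x k = 1) (hb : ∑ k, x k * b k = 0)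
    (hH : ∀ k l, H k l = H l k) :
    0 ≤ (∑ k, b k ^ 2) / 4 + ∑ k, x k * b k * H k k + ∑ k, ∑ l, x k * x l * H k l ^ 2 -
      2 * ∑ k, x k * (b k / 2 + ∑ l, x l * H k l) ^ 2 + (∑ k, x k * ∑ l, x l * H k l) ^ 2 := by
  have h := compressed_sum_sq_nonneg (B := fun k l => H k l + if k = l then b k / (2 * x k) else 0)
    hx hx1 (fun k l => by
      rw [hH k l]
      by_cases hkl : k = l
      · subst hkl; rfl
      · rw [if_neg hkl, if_neg (Ne.symm hkl)])
  have e1 : ∀ k, ∑ l, x l * (H k l + if k = l then b k / (2 * x k) else 0) =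
      b k / 2 + ∑ l, x l * H k l := by
    intro k
    simp only [mul_add, Finset.sum_add_distrib, mul_ite, mul_zero, Finset.sum_ite_eq,
      Finset.mem_univ, if_true]
    have := (hx k).ne'
    field_simp
    ring
  have e2 : ∀ k, ∑ l, x k * x l * (H k l + if k = l then b k / (2 * x k) else 0) ^ 2 =
      ∑ l, x k * x l * H k l ^ 2 + x k * b k * H k k + b k ^ 2 / 4 := by
    intro k
    have : ∀ l, x k * x l * (H k l + if k = l then b k / (2 * x k) else 0) ^ 2 =
        x k * x l * H k l ^ 2 + if k = l then x k * b k * H k k + b k ^ 2 / 4 else 0 := by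
      intro l
      split_ifs with hkl
      · subst hkl
        have := (hx k).ne'
        field_simp
        ring
      · simp
    simp only [this, Finset.sum_add_distrib, Finset.sum_ite_eq, Finset.mem_univ, if_true]
    ring
  have e3 : ∑ k, x k * (b k / 2 + ∑ l, x l * H k l) = ∑ k, x k * ∑ l, x l * H k l := by
    have : ∑ k, x k * (b k / 2) = 0 := by
      rw [← zero_div (2 : ℝ), ← hb, Finset.sum_div]
      exact Finset.sum_congr rfl fun k _ => by ring
    simp only [mul_add, Finset.sum_add_distrib, this, zero_add]
  simp only [e1, e2, e3, Finset.sum_add_distrib] at h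
  rw [← Finset.sum_div] at h
  linarith

/-- The pointwise inequality behind the Bochner estimate, for the values `u i` and `H i j` of the
first and second derivatives of a function at a point. Here `(u i - ub) δᵢⱼ + xᵢ (Hᵢⱼ - uⱼ - vⱼ)` is
the derivative of the gradient field. -/
theorem trace_sub_divergence_ge {n : ℕ} {x u v : Fin n → ℝ} {H : Fin n → Fin n → ℝ} {ub N : ℝ}
    (hx : ∀ i, 0 < x i) (hx0 : ∑ i, x i < 1) (hH : ∀ i j, H i j = H j i)
    (hub : ub = ∑ i, x i * u i) (hv : ∀ j, v j = ∑ k, x k * H j k)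
    (hN : N = ∑ i, x i * u i ^ 2 - ub ^ 2) :
    (ub ^ 2 + ∑ i, (u i - ub) ^ 2) / 4 ≤
      ∑ i, ∑ j, ((if i = j then u i - ub else 0) + x i * (H i j - u j - v j)) *
        ((if j = i then u j - ub else 0) + x j * (H j i - u i - v i)) -
      (∑ i, ((u i - ub) ^ 2 - N + x i * (2 * (u i - ub) * (H i i - u i - v i) -
        (u i ^ 2 + 2 * ∑ k, x k * u k * H k i - 2 * ub * (u i + v i))))) / 2 - n / 2 * N := by
  set V := ∑ j, x j * v j with hV
  set Suu := ∑ i, x i * u i ^ 2 with hSuu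
  set Suv := ∑ i, x i * u i * v i with hSuv
  set Svv := ∑ i, x i * v i ^ 2 with hSvv
  set SH := ∑ i, x i * (u i - ub) * H i i with hSH
  set SHH := ∑ i, ∑ j, x i * x j * H i j ^ 2 with hSHH
  set A := ∑ i, (u i - ub) ^ 2 with hA
  have hv' : ∀ j, ∑ k, x k * H k j = v j := fun j => by
    rw [hv]; exact Finset.sum_congr rfl fun k _ => by rw [hH]
  -- the Hessian term
  have key : 0 ≤ (ub ^ 2 + A) / 4 + SH + SHH - 2 * (N / 4 + (Suv - ub * V) + Svv) + V ^ 2 := by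
    have h := hessian_sum_sq_nonneg (ι := Fin (n + 1)) (x := Fin.cons (1 - ∑ i, x i) x)
      (b := Fin.cons (-ub) fun i => u i - ub)
      (H := Fin.cons (fun _ => 0) fun i => Fin.cons 0 (H i))
      (Fin.cases (by simpa using hx0) (by simpa using hx))
      (by simp [Fin.sum_univ_succ])
      (by simp [Fin.sum_univ_succ, mul_sub, Finset.sum_sub_distrib, ← Finset.sum_mul, ← hub]; ring)
      (by
        refine Fin.cases (Fin.cases ?_ ?_) (fun i => Fin.cases ?_ ?_)
        · simp
        · simp
        · simp
        · intro j; simpa using hH i j)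
    simp only [Fin.sum_univ_succ, Fin.cons_zero, Fin.cons_succ, mul_zero, Finset.sum_const_zero,
      add_zero, zero_add, ne_eq, OfNat.ofNat_ne_zero, not_false_eq_true, zero_pow, ← hv, neg_sq,
      ← hA, ← hSH, ← hSHH, ← hV] at h
    have e : ∑ i, x i * ((u i - ub) / 2 + v i) ^ 2 =
        (Suu - 2 * ub * ∑ i, x i * u i + ub ^ 2 * ∑ i, x i) / 4 + (Suv - ub * V) + Svv := by
      rw [hSuu, hSuv, hSvv, hV]
      simp only [Finset.mul_sum, Finset.sum_div, ← Finset.sum_add_distrib,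
        ← Finset.sum_sub_distrib]
      exact Finset.sum_congr rfl fun i _ => by ring
    rw [← hub] at e
    rw [e] at h
    rw [hN]
    linarith
  -- the trace term
  have e1 : ∑ i, ∑ j, ((if i = j then u i - ub else 0) + x i * (H i j - u j - v j)) *
        ((if j = i then u j - ub else 0) + x j * (H j i - u i - v i)) =
      A + 2 * ∑ i, x i * (u i - ub) * (H i i - u i - v i) +
      ∑ i, ∑ j, x i * x j * ((H i j - u j - v j) * (H i j - u i - v i)) := by
    have : ∀ i j, ((if i = j then u i - ub else 0) + x i * (H i j - u j - v j)) *
        ((if j = i then u j - ub else 0) + x j * (H j i - u i - v i)) =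
        (if i = j then (u i - ub) ^ 2 + 2 * (x i * (u i - ub) * (H i i - u i - v i)) else 0) +
        x i * x j * ((H i j - u j - v j) * (H i j - u i - v i)) := by
      intro i j
      by_cases hij : i = j
      · subst hij; simp only [if_true]; ring
      · rw [if_neg hij, if_neg (Ne.symm hij), if_neg hij, hH j i]; ring
    simp only [this, Finset.sum_add_distrib, Finset.sum_ite_eq, Finset.mem_univ, if_true,
      ← Finset.mul_sum, ← hA]
  have e2 : ∑ i, x i * (u i - ub) * (H i i - u i - v i) =
      SH - (Suu - ub ^ 2) - (Suv - ub * V) := by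
    have : ub ^ 2 = ub * ∑ i, x i * u i := by rw [← hub]; ring
    rw [this, hSH, hSuu, hSuv, hV]
    simp only [Finset.mul_sum, ← Finset.sum_sub_distrib]
    exact Finset.sum_congr rfl fun i _ => by ring
  have e3 : ∑ i, ∑ j, x i * x j * ((H i j - u j - v j) * (H i j - u i - v i)) =
      SHH - 2 * Suv - 2 * Svv + (ub + V) ^ 2 := by
    have hrow : ∀ i, ∑ j, x i * x j * ((H i j - u j - v j) * (H i j - u i - v i)) =
        ∑ j, x i * x j * H i j ^ 2 - x i * (u i + v i) * v i
        - x i * ∑ j, x j * (H i j * (u j + v j)) + x i * (u i + v i) * (ub + V) := by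
      intro i
      have h1 : ub + V = ∑ j, x j * (u j + v j) := by
        rw [hub, hV]; simp only [mul_add, Finset.sum_add_distrib]
      rw [h1, hv i]
      simp only [Finset.mul_sum, ← Finset.sum_sub_distrib, ← Finset.sum_add_distrib]
      rw [← hv i]
      exact Finset.sum_congr rfl fun j _ => by ring
    have hcross : ∑ i, x i * ∑ j, x j * (H i j * (u j + v j)) = Suv + Svv := by
      have : ∀ j, x j * u j * v j + x j * v j ^ 2 = ∑ i, x i * (x j * (H i j * (u j + v j))) := by
        intro j
        have : x j * u j * v j + x j * v j ^ 2 = x j * (u j + v j) * ∑ i, x i * H i j := by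
          rw [hv']; ring
        rw [this, Finset.mul_sum]
        exact Finset.sum_congr rfl fun i _ => by ring
      simp only [Finset.mul_sum]
      rw [Finset.sum_comm, hSuv, hSvv, ← Finset.sum_add_distrib]
      exact Finset.sum_congr rfl fun j _ => (this j).symm
    have hfirst : ∑ i, x i * (u i + v i) * v i = Suv + Svv := by
      rw [hSuv, hSvv, ← Finset.sum_add_distrib]
      exact Finset.sum_congr rfl fun j _ => by ring
    have hlast : ∑ i, x i * (u i + v i) = ub + V := by
      rw [hub, hV]; simp only [mul_add, Finset.sum_add_distrib]
    simp only [hrow, Finset.sum_add_distrib, Finset.sum_sub_distrib, hcross, hfirst,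
      ← Finset.sum_mul, hlast]
    ring
  -- the divergence term
  have e4 : ∑ i, ((u i - ub) ^ 2 - N + x i * (2 * (u i - ub) * (H i i - u i - v i) -
        (u i ^ 2 + 2 * ∑ k, x k * u k * H k i - 2 * ub * (u i + v i)))) =
      A - n * N + 2 * ∑ i, x i * (u i - ub) * (H i i - u i - v i) -
        (Suu + 2 * Suv - 2 * ub * (ub + V)) := by
    have hc : ∑ i, x i * ∑ k, x k * u k * H k i = Suv := by
      simp only [Finset.mul_sum]
      rw [Finset.sum_comm, hSuv]
      refine Finset.sum_congr rfl fun k _ => ?_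
      rw [hv, Finset.mul_sum]
      exact Finset.sum_congr rfl fun i _ => by ring
    have hn : ∑ _i : Fin n, N = n * N := by simp
    rw [← hc, ← hn, hA, hSuu]
    have h1 : ub + V = ∑ j, x j * (u j + v j) := by
      rw [hub, hV]; simp only [mul_add, Finset.sum_add_distrib]
    rw [h1]
    simp only [Finset.mul_sum (a := 2 * ub), Finset.mul_sum (a := (2 : ℝ)),
      ← Finset.sum_sub_distrib, ← Finset.sum_add_distrib]
    refine Finset.sum_congr rfl fun i _ => ?_
    have : ∑ k, 2 * (x k * u k * H k i) = 2 * ∑ k, x k * u k * H k i := by rw [Finset.mul_sum]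
    rw [this]
    ring
  rw [e1, e4, e3, e2]
  rw [hN] at key ⊢
  linarith

/-- The pairing `Γ(p, r)`, the derivative of `p` along the gradient field of `r`. -/
noncomputable def gammaPoly {n : ℕ} (p r : MvPolynomial (Fin n) ℝ) : MvPolynomial (Fin n) ℝ :=
  ∑ i, MvPolynomial.pderiv i p * fieldComp (centeredDeriv r) i

theorem gammaPoly_eq {n : ℕ} (p r : MvPolynomial (Fin n) ℝ) :
    gammaPoly p r = ∑ i, MvPolynomial.X i * (MvPolynomial.pderiv i p * MvPolynomial.pderiv i r) -
      eulerDeriv p * eulerDeriv r := by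
  rw [gammaPoly, eulerDeriv, Finset.sum_mul, ← Finset.sum_sub_distrib]
  refine Finset.sum_congr rfl fun i _ => ?_
  rw [fieldComp, centeredDeriv_succ]
  ring

theorem gammaPoly_comm {n : ℕ} (p r : MvPolynomial (Fin n) ℝ) : gammaPoly p r = gammaPoly r p := by
  rw [gammaPoly_eq, gammaPoly_eq, mul_comm (eulerDeriv p)]
  congr 1
  exact Finset.sum_congr rfl fun i _ => by ring

theorem gammaPoly_self_eq {n : ℕ} (p : MvPolynomial (Fin n) ℝ) :
    gammaPoly p p = ∑ k, baryPoly n k * centeredDeriv p k ^ 2 := by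
  have h : ∑ k, baryPoly n k * centeredDeriv p k ^ 2 =
      ∑ i, MvPolynomial.pderiv i p * fieldComp (centeredDeriv p) i -
      eulerDeriv p * ∑ k, baryPoly n k * centeredDeriv p k := by
    rw [Fin.sum_univ_succ, Fin.sum_univ_succ, mul_add, Finset.mul_sum, add_comm (eulerDeriv p * _),
      ← sub_sub, ← Finset.sum_sub_distrib, add_comm, sub_eq_add_neg]
    congr 1
    · refine Finset.sum_congr rfl fun i _ => ?_
      rw [fieldComp, baryPoly_succ, centeredDeriv_succ]
      ring
    · rw [centeredDeriv_zero]; ring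
  rw [h, show ∑ k, baryPoly n k * centeredDeriv p k = 0 from isTangent_centeredDeriv p, mul_zero,
    sub_zero, gammaPoly]

theorem eval_gammaPoly_self {n : ℕ} (p : MvPolynomial (Fin n) ℝ) (y : Fin n → ℝ) :
    MvPolynomial.eval y (gammaPoly p p) =
      ∑ k, simplexLift n y k * MvPolynomial.eval y (centeredDeriv p k) ^ 2 := by
  rw [gammaPoly_self_eq]; simp [eval_baryPoly]

/-- The tuple `bₖ² - ∑ₗ xₗ bₗ²`, for `b` the centred derivatives of `p`. Half of its field is the
difference between the Riemannian and the Euclidean derivative of the gradient of `p` along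
itself. -/
noncomputable def christoffelTuple {n : ℕ} (p : MvPolynomial (Fin n) ℝ) (k : Fin (n + 1)) :
    MvPolynomial (Fin n) ℝ := centeredDeriv p k ^ 2 - gammaPoly p p

theorem isTangent_christoffelTuple {n : ℕ} (p : MvPolynomial (Fin n) ℝ) :
    IsTangent (christoffelTuple p) := by
  have h1 : ∑ k, baryPoly n k = 1 := by
    rw [Fin.sum_univ_succ]
    simp [baryPoly]
  simp only [IsTangent, christoffelTuple, mul_sub, Finset.sum_sub_distrib, ← Finset.sum_mul, h1]
  rw [← gammaPoly_self_eq, one_mul, sub_self]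

open MvPolynomial in
theorem sum_centeredDeriv_sq_le {n : ℕ} (p : MvPolynomial (Fin n) ℝ) {y : Fin n → ℝ}
    (hy : y ∈ cornerSimplex n) :
    (∑ k, eval y (centeredDeriv p k) ^ 2) / 4 ≤ eval y (fieldTraceSq (centeredDeriv p)) -
      eval y (fieldDiv (christoffelTuple p)) / 2 - n / 2 * eval y (gammaPoly p p) := by
  have hE : ∀ j, pderiv j (eulerDeriv p) =
      pderiv j p + ∑ k, X k * pderiv j (pderiv k p) := by
    intro j
    simp only [eulerDeriv, map_sum, pderiv_mul, pderiv_X, Pi.single_apply, Finset.sum_add_distrib,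
      ite_mul, one_mul, zero_mul, Finset.sum_ite_eq', Finset.mem_univ, if_true]
  have h := trace_sub_divergence_ge (x := y) (u := fun i => eval y (pderiv i p))
    (v := fun j => ∑ k, y k * eval y (pderiv j (pderiv k p)))
    (H := fun i j => eval y (pderiv i (pderiv j p))) (ub := eval y (eulerDeriv p))
    (N := eval y (gammaPoly p p)) hy.1 hy.2 (fun i j => by rw [pderiv_comm])
    (by simp [eulerDeriv]) (fun j => rfl) (by
      rw [gammaPoly_eq]
      simp [pow_two])
  have hb : ∀ i j, eval y (pderiv j (fieldComp (centeredDeriv p) i)) =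
      (if i = j then eval y (pderiv i p) - eval y (eulerDeriv p) else 0) +
      y i * (eval y (pderiv i (pderiv j p)) - eval y (pderiv j p) -
        ∑ k, y k * eval y (pderiv j (pderiv k p))) := by
    intro i j
    rw [fieldComp, centeredDeriv_succ, pderiv_mul, map_sub, hE, pderiv_X, Pi.single_apply]
    by_cases hij : i = j
    · subst hij; simp [-mul_eq_mul_left_iff]; ring
    · simp [-mul_eq_mul_left_iff, hij, pderiv_comm j i]; ring
  have hG : ∀ i, eval y (pderiv i (gammaPoly p p)) = eval y (pderiv i p) ^ 2 +
      2 * ∑ k, y k * eval y (pderiv k p) * eval y (pderiv k (pderiv i p)) -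
      2 * eval y (eulerDeriv p) * (eval y (pderiv i p) +
        ∑ k, y k * eval y (pderiv i (pderiv k p))) := by
    intro i
    have h1 : pderiv i (gammaPoly p p) = pderiv i p * pderiv i p +
        ∑ k, X k * (2 * pderiv k p * pderiv k (pderiv i p)) -
        2 * eulerDeriv p * (pderiv i p + ∑ k, X k * pderiv i (pderiv k p)) := by
      have h2 : ∀ k, pderiv i (X k * (pderiv k p * pderiv k p)) =
          (if i = k then pderiv k p * pderiv k p else 0) +
          X k * (2 * pderiv k p * pderiv k (pderiv i p)) := by
        intro k
        rw [pderiv_mul, pderiv_mul, pderiv_X, Pi.single_apply, pderiv_comm i k]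
        by_cases hik : i = k
        · subst hik; simp; ring
        · simp [hik, Ne.symm hik]; ring
      rw [gammaPoly_eq, map_sub, pderiv_mul, hE, map_sum, Finset.sum_congr rfl fun k _ => h2 k,
        Finset.sum_add_distrib, Finset.sum_ite_eq, if_pos (Finset.mem_univ _)]
      ring
    rw [h1]
    simp only [map_add, map_sub, map_mul, map_sum, eval_X, map_ofNat, Finset.mul_sum]
    congr 1
    congr 1
    · ring
    · exact Finset.sum_congr rfl fun k _ => by ring
  have hT : eval y (fieldTraceSq (centeredDeriv p)) = ∑ i, ∑ j,
      eval y (pderiv j (fieldComp (centeredDeriv p) i)) *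
        eval y (pderiv i (fieldComp (centeredDeriv p) j)) := by
    simp [fieldTraceSq]
  have hD : eval y (fieldDiv (christoffelTuple p)) = ∑ i,
      ((eval y (pderiv i p) - eval y (eulerDeriv p)) ^ 2 - eval y (gammaPoly p p) +
        y i * (2 * (eval y (pderiv i p) - eval y (eulerDeriv p)) *
          (eval y (pderiv i (pderiv i p)) - eval y (pderiv i p) -
            ∑ k, y k * eval y (pderiv i (pderiv k p))) - eval y (pderiv i (gammaPoly p p)))) := by
    rw [fieldDiv, map_sum]
    refine Finset.sum_congr rfl fun i _ => ?_
    rw [fieldComp, christoffelTuple, centeredDeriv_succ, pderiv_mul, map_sub, pderiv_X_self,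
      pderiv_pow, map_sub, hE]
    simp [-mul_eq_mul_left_iff, -mul_eq_mul_right_iff]
    ring
  rw [hT, hD]
  simp only [hb, hG]
  rw [Fin.sum_univ_succ]
  simpa [centeredDeriv_zero, centeredDeriv_succ] using h

/-! ### The Bochner estimate -/

/-- The lower bound `Hess ψ + n / 2 ≥ 0` for the Hessian of `ψ` on the sphere of radius `2` with
coordinates `2 √xₖ`, applied to tangent vectors with components `xₖ bₖ` in the coordinates `xₖ`. -/
def HessianBound (n : ℕ) (ψ : (Fin n → ℝ) → ℝ) : Prop :=
  ∀ y ∈ cornerSimplex n, ∀ b : Fin (n + 1) → ℝ, ∑ k, simplexLift n y k * b k = 0 →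
    0 ≤ ∑ i, ∑ j, partialDeriv j (partialDeriv i ψ) y * (y i * b i.succ) * (y j * b j.succ) +
      (∑ i, partialDeriv i ψ y * (y i * (b i.succ ^ 2 - ∑ k, simplexLift n y k * b k ^ 2))) / 2 +
      n / 2 * ∑ k, simplexLift n y k * b k ^ 2

theorem integral_exp_mul_sum_centeredDeriv_sq_le {n : ℕ} {ψ : (Fin n → ℝ) → ℝ}
    (hψ : ContDiff ℝ ∞ ψ) (hbound : HessianBound n ψ) (p : MvPolynomial (Fin n) ℝ) :
    ∫ y in cornerSimplex n, Real.exp (-ψ y) *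
        ((∑ k, MvPolynomial.eval y (centeredDeriv p k) ^ 2) / 4) ≤
      ∫ y in cornerSimplex n, Real.exp (-ψ y) * weightedDiv ψ (centeredDeriv p) y ^ 2 := by
  have hE : Continuous fun y => Real.exp (-ψ y) := hψ.continuous.neg.rexp
  have hev : ∀ q : MvPolynomial (Fin n) ℝ, Continuous fun y : Fin n → ℝ => MvPolynomial.eval y q :=
    fun q => q.continuous_eval
  have hw : ∀ b : Fin (n + 1) → MvPolynomial (Fin n) ℝ, Continuous (weightedDiv ψ b) :=
    fun b => (contDiff_weightedDiv hψ b).continuous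
  have hψ2 : ∀ i j, Continuous (partialDeriv j (partialDeriv i ψ)) := fun i j =>
    (contDiff_partialDeriv (contDiff_partialDeriv hψ)).continuous
  have hB := integral_exp_mul_weightedDiv_sq hψ (isTangent_centeredDeriv p)
  have hC := integral_exp_mul_weightedDiv_eq_zero hψ (isTangent_christoffelTuple p)
  have i1 : IntegrableOn (fun y => Real.exp (-ψ y) * weightedDiv ψ (centeredDeriv p) y ^ 2)
      (cornerSimplex n) := integrableOn_cornerSimplex (hE.mul ((hw _).pow 2))
  have i2 : IntegrableOn (fun y => Real.exp (-ψ y) * (weightedDiv ψ (centeredDeriv p) y ^ 2 -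
      ∑ i, ∑ j, partialDeriv j (partialDeriv i ψ) y *
        MvPolynomial.eval y (fieldComp (centeredDeriv p) i) *
        MvPolynomial.eval y (fieldComp (centeredDeriv p) j) -
        MvPolynomial.eval y (fieldTraceSq (centeredDeriv p)))) (cornerSimplex n) :=
    integrableOn_cornerSimplex (hE.mul ((((hw _).pow 2).sub (continuous_finsetSum _ fun i _ =>
      continuous_finsetSum _ fun j _ => ((hψ2 i j).mul (hev _)).mul (hev _))).sub (hev _)))
  have i3 : IntegrableOn (fun y => Real.exp (-ψ y) * weightedDiv ψ (christoffelTuple p) y)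
      (cornerSimplex n) := integrableOn_cornerSimplex (hE.mul (hw _))
  have i4 : IntegrableOn (fun y => Real.exp (-ψ y) *
        ((∑ k, MvPolynomial.eval y (centeredDeriv p k) ^ 2) / 4)) (cornerSimplex n) :=
    integrableOn_cornerSimplex (hE.mul ((continuous_finsetSum _ fun k _ => (hev _).pow 2).div_const
      _))
  have hsplit : ∫ y in cornerSimplex n, Real.exp (-ψ y) * weightedDiv ψ (centeredDeriv p) y ^ 2 =
      ∫ y in cornerSimplex n, (Real.exp (-ψ y) * weightedDiv ψ (centeredDeriv p) y ^ 2 -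
      Real.exp (-ψ y) * (weightedDiv ψ (centeredDeriv p) y ^ 2 -
      ∑ i, ∑ j, partialDeriv j (partialDeriv i ψ) y *
        MvPolynomial.eval y (fieldComp (centeredDeriv p) i) *
        MvPolynomial.eval y (fieldComp (centeredDeriv p) j) -
        MvPolynomial.eval y (fieldTraceSq (centeredDeriv p))) -
      2⁻¹ * (Real.exp (-ψ y) * weightedDiv ψ (christoffelTuple p) y)) := by
    have aux : ∀ A B C : (Fin n → ℝ) → ℝ, IntegrableOn A (cornerSimplex n) →
        IntegrableOn B (cornerSimplex n) → IntegrableOn C (cornerSimplex n) →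
        ∫ y in cornerSimplex n, B y = 0 → ∫ y in cornerSimplex n, C y = 0 →
        ∫ y in cornerSimplex n, A y = ∫ y in cornerSimplex n, (A y - B y - 2⁻¹ * C y) := by
      intro A B C hA hB hC hB0 hC0
      have hAB : Integrable (fun y => A y - B y) (volume.restrict (cornerSimplex n)) := hA.sub hB
      rw [integral_sub hAB (hC.const_mul _), integral_sub hA hB, integral_const_mul, hB0, hC0]
      simp
    exact aux _ _ _ i1 i2 i3 hB hC
  rw [hsplit]
  refine setIntegral_mono_on i4 ((i1.sub i2).sub (i3.const_mul _)) (measurableSet_cornerSimplex n)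
    fun y hy => ?_
  have h1 := sum_centeredDeriv_sq_le p hy
  have h2 := hbound y hy (fun k => MvPolynomial.eval y (centeredDeriv p k))
    ((isTangent_centeredDeriv p).eval y)
  rw [← eval_gammaPoly_self] at h2
  have h3 : ∑ i, partialDeriv i ψ y * (y i * (MvPolynomial.eval y (centeredDeriv p i.succ) ^ 2 -
      MvPolynomial.eval y (gammaPoly p p))) =
      ∑ i, partialDeriv i ψ y * MvPolynomial.eval y (fieldComp (christoffelTuple p) i) := by
    refine Finset.sum_congr rfl fun i _ => ?_
    simp [eval_fieldComp, christoffelTuple]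
  rw [h3] at h2
  simp only [← eval_fieldComp] at h2
  have h4 : weightedDiv ψ (christoffelTuple p) y =
    MvPolynomial.eval y (fieldDiv (christoffelTuple p)) -
      ∑ i, partialDeriv i ψ y * MvPolynomial.eval y (fieldComp (christoffelTuple p) i) := rfl
  have h5 := mul_le_mul_of_nonneg_left (le_trans h1 (le_add_of_nonneg_right h2))
    (Real.exp_pos (-ψ y)).le
  refine h5.trans (le_of_eq ?_)
  rw [h4]
  ring

/-! ### The Hessian bound -/

theorem hasDerivAt_comp_eq_sum {n : ℕ} {ψ : (Fin n → ℝ) → ℝ} {z : ℝ → Fin n → ℝ}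
    {z' : Fin n → ℝ} {t : ℝ} (hψ : DifferentiableAt ℝ ψ (z t))
    (hz : ∀ i, HasDerivAt (fun t => z t i) (z' i) t) :
    HasDerivAt (fun t => ψ (z t)) (∑ i, partialDeriv i ψ (z t) * z' i) t := by
  have h := hψ.hasFDerivAt.comp_hasDerivAt t (hasDerivAt_pi.2 hz)
  rw [fderiv_apply_eq_sum] at h
  exact h.congr_deriv (Finset.sum_congr rfl fun i _ => mul_comm (z' i) _)

/-- The second derivative at `0` of a degree `q` homogeneous function that equals `ψ` on the
simplex, along the curve `t ↦ xₖ (1 + t bₖ / 2)²`, a straight line in the coordinates `√xₖ`. The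
coordinate sum along the curve is `1 + N t² / 4`, where `N = ∑ₖ xₖ bₖ²`. -/
theorem deriv_deriv_homogeneous_curve {n : ℕ} {ψ : (Fin n → ℝ) → ℝ} (hψ : ContDiff ℝ ∞ ψ)
    (q : ℝ) {N : ℝ} (hN : 0 ≤ N) (y b : Fin n → ℝ) :
    deriv (deriv fun t => (1 + t ^ 2 * N / 4) ^ q *
      ψ fun i => y i * (1 + t * b i / 2) ^ 2 / (1 + t ^ 2 * N / 4)) 0 =
      q * ψ y * N / 2 +
      ∑ i, ∑ j, partialDeriv j (partialDeriv i ψ) y * (y i * b i) * (y j * b j) +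
      (∑ i, partialDeriv i ψ y * (y i * (b i ^ 2 - N))) / 2 := by
  set σ : ℝ → ℝ := fun t => 1 + t ^ 2 * N / 4 with hσdef
  set z : ℝ → Fin n → ℝ := fun t i => y i * (1 + t * b i / 2) ^ 2 / σ t with hz
  have hσpos : ∀ t, 0 < σ t := fun t => by positivity
  have hσ : ∀ t, HasDerivAt σ (t * N / 2) t := fun t => by
    have := (((hasDerivAt_id t).pow 2).mul_const N).div_const 4 |>.const_add 1
    exact HasDerivAt.congr_deriv this (by simp; ring)
  have hσ0 : σ 0 = 1 := by simp [σ]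
  let z' : ℝ → Fin n → ℝ := fun t i => (y i * (b i * (1 + t * b i / 2)) * σ t -
    y i * (1 + t * b i / 2) ^ 2 * (t * N / 2)) / σ t ^ 2
  have hlin : ∀ t i, HasDerivAt (fun t => 1 + t * b i / 2) (b i / 2) t := fun t i => by
    simpa using (((hasDerivAt_id t).mul_const (b i)).div_const 2).const_add 1
  have hz' : ∀ t i, HasDerivAt (fun t => z t i) (z' t i) t := fun t i => by
    have := ((((hlin t i).pow 2).const_mul (y i)).div (hσ t) (hσpos t).ne')
    exact HasDerivAt.congr_deriv this (by simp only [z']; simp; ring_nf)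
  have hz0 : z 0 = y := by ext i; simp [z, hσ0]
  have hz'0 : z' 0 = fun i => y i * b i := by ext i; simp [z', hσ0]
  have hz'' : ∀ i, HasDerivAt (fun t => z' t i) (y i * (b i ^ 2 - N) / 2) 0 := fun i => by
    have h1 := (((hlin 0 i).const_mul (b i)).const_mul (y i)).mul (hσ 0)
    have h2 := (((hlin 0 i).pow 2).const_mul (y i)).mul (((hasDerivAt_id (0 : ℝ)).mul_const N).div_const 2)
    have := (h1.sub h2).div ((hσ 0).pow 2) (by simp [hσ0])
    exact HasDerivAt.congr_deriv this (by simp [hσ0]; ring)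
  have hψd : Differentiable ℝ ψ := hψ.differentiable (by simp)
  have hk : ∀ t, HasDerivAt (fun t => σ t ^ q * ψ (z t))
      (t * (N / 2 * (q * σ t ^ (q - 1)) * ψ (z t)) +
        σ t ^ q * ∑ i, partialDeriv i ψ (z t) * z' t i) t := fun t => by
    have h1 := (hσ t).rpow_const (p := q) (Or.inl (hσpos t).ne')
    have h2 := hasDerivAt_comp_eq_sum (hψd (z t)) (hz' t)
    exact HasDerivAt.congr_deriv (h1.mul h2) (by ring)
  have hderiv : deriv (fun t => σ t ^ q * ψ (z t)) = fun t =>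
      t * (N / 2 * (q * σ t ^ (q - 1)) * ψ (z t)) +
        σ t ^ q * ∑ i, partialDeriv i ψ (z t) * z' t i := funext fun t => (hk t).deriv
  rw [hderiv]
  have g1 : HasDerivAt (fun t => N / 2 * (q * σ t ^ (q - 1)) * ψ (z t))
      (deriv (fun t => N / 2 * (q * σ t ^ (q - 1)) * ψ (z t)) 0) 0 := by
    have h1 := (((hσ 0).rpow_const (p := q - 1) (Or.inl (hσpos 0).ne')).const_mul q).const_mul
      (N / 2)
    exact (h1.mul (hasDerivAt_comp_eq_sum (hψd (z 0)) (hz' 0))).differentiableAt.hasDerivAt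
  have g2 := (hasDerivAt_id (0 : ℝ)).mul g1
  have g3 : HasDerivAt (fun t => ∑ i, partialDeriv i ψ (z t) * z' t i)
      (∑ i, ((∑ j, partialDeriv j (partialDeriv i ψ) (z 0) * z' 0 j) * z' 0 i +
        partialDeriv i ψ (z 0) * (y i * (b i ^ 2 - N) / 2))) 0 := by
    refine HasDerivAt.fun_sum fun i _ => ?_
    exact (hasDerivAt_comp_eq_sum ((contDiff_partialDeriv hψ).differentiable (by simp) (z 0))
      (hz' 0)).mul (hz'' i)
  have g4 := ((hσ 0).rpow_const (p := q) (Or.inl (hσpos 0).ne')).mul g3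
  have g5 := (g2.add g4).deriv
  refine Eq.trans g5 ?_
  rw [hz0, hz'0, hσ0]
  simp only [id, one_mul, zero_mul, zero_div, Real.one_rpow, add_zero, zero_add, mul_one,
    Finset.sum_add_distrib]
  rw [← add_assoc, Finset.sum_div]
  refine congrArg₂ (· + ·) (congrArg₂ (· + ·) (by ring) ?_) ?_
  · refine Finset.sum_congr rfl fun i _ => ?_
    rw [Finset.sum_mul]
    exact Finset.sum_congr rfl fun j _ => by ring
  · exact Finset.sum_congr rfl fun i _ => by ring

/-- A homogeneous function is determined by its values on the simplex. -/
theorem homogeneous_eq {n : ℕ} {q : ℝ} {φ g : (Fin (n + 1) → ℝ) → ℝ}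
    (hhom : IsHomogeneousOfDegree q φ) (hg : Set.EqOn φ g (simplex n))
    {x : Fin (n + 1) → ℝ} (hx : x ∈ orthant (n + 1)) :
    φ x = (∑ k, x k) ^ q * g (simplexLift n fun i => x i.succ / ∑ k, x k) := by
  have hpos : 0 < ∑ k, x k := Finset.sum_pos (fun k _ => hx k) Finset.univ_nonempty
  have hlift : simplexLift n (fun i => x i.succ / ∑ k, x k) = (∑ k, x k)⁻¹ • x := by
    ext k
    refine Fin.cases ?_ (fun i => ?_) k
    · rw [simplexLift_zero, ← Finset.sum_div, Pi.smul_apply, smul_eq_mul]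
      rw [Fin.sum_univ_succ] at *
      field_simp
      ring
    · rw [simplexLift_succ, Pi.smul_apply, smul_eq_mul]
      ring
  have hmem : (∑ k, x k)⁻¹ • x ∈ simplex n :=
    ⟨fun k => mul_pos (inv_pos.2 hpos) (hx k), by
      simp only [Pi.smul_apply, smul_eq_mul, ← Finset.mul_sum]
      exact inv_mul_cancel₀ hpos.ne'⟩
  rw [hlift, ← hg hmem, ← hhom _ hpos _ hmem.1, smul_inv_smul₀ hpos.ne']

theorem sum_curve {n : ℕ} {x b : Fin (n + 1) → ℝ} (hx : ∑ k, x k = 1)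
    (hb : ∑ k, x k * b k = 0) (t : ℝ) :
    ∑ k, x k * (1 + t * b k / 2) ^ 2 = 1 + t ^ 2 * (∑ k, x k * b k ^ 2) / 4 := by
  have : ∀ k, x k * (1 + t * b k / 2) ^ 2 = x k + t * (x k * b k) + t ^ 2 / 4 * (x k * b k ^ 2) :=
    fun k => by ring
  simp only [this, Finset.sum_add_distrib, ← Finset.mul_sum, hx, hb]
  ring

/-- The second derivative of a function that is midpoint convex along a line is nonnegative. -/
theorem deriv_deriv_nonneg_of_midpoint {k : ℝ → ℝ} (hk : ContDiff ℝ 2 k)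
    (h : ∀ᶠ t in nhds (0 : ℝ), 2 * k 0 ≤ k t + k (-t)) : 0 ≤ deriv (deriv k) 0 := by
  have hk1 : Differentiable ℝ k := hk.differentiable (by simp)
  have hk2 : Differentiable ℝ (deriv k) :=
    ((contDiff_succ_iff_deriv (n := 1)).1 hk).2.2.differentiable (by simp)
  set m : ℝ → ℝ := fun t => k t + k (-t) with hm
  have hm1 : ∀ t, HasDerivAt m (deriv k t - deriv k (-t)) t := fun t => by
    have h1 := (hk1 (-t)).hasDerivAt.comp t (hasDerivAt_neg t)
    exact HasDerivAt.congr_deriv ((hk1 t).hasDerivAt.add h1) (by ring)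
  have hm1' : deriv m = fun t => deriv k t - deriv k (-t) := funext fun t => (hm1 t).deriv
  have hm2 : deriv (deriv m) 0 = 2 * deriv (deriv k) 0 := by
    rw [hm1']
    have h1 := (hk2 (-0)).hasDerivAt.comp (0 : ℝ) (hasDerivAt_neg (0 : ℝ))
    have h2 := (hk2 0).hasDerivAt.sub h1
    refine h2.deriv.trans ?_
    simp
    ring
  by_contra hneg
  rw [not_le] at hneg
  have hmax : IsLocalMax m 0 := isLocalMax_of_deriv_deriv_neg (by rw [hm2]; linarith)
    (by rw [hm1']; simp) (hm1 0).continuousAt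
  have hconst : m =ᶠ[nhds 0] fun _ => m 0 := by
    filter_upwards [h, hmax] with t ht ht'
    refine le_antisymm ht' ?_
    simp only [hm, neg_zero] at ht ⊢
    linarith
  have : deriv (deriv m) 0 = 0 := by
    rw [hconst.deriv.deriv_eq]
    simp
  linarith

theorem deriv_deriv_line {E : Type*} [NormedAddCommGroup E] [NormedSpace ℝ E] {F : E → ℝ} {p : E}
    (hF : ContDiffAt ℝ 2 F p) (U : E) :
    deriv (deriv fun t : ℝ => F (p + t • U)) 0 = fderiv ℝ (fderiv ℝ F) p U U := by
  have hc : ∀ t : ℝ, HasDerivAt (fun t : ℝ => p + t • U) U t := fun t => by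
    simpa using ((hasDerivAt_id t).smul_const U).const_add p
  have hcont : Filter.Tendsto (fun t : ℝ => p + t • U) (nhds 0) (nhds p) := by
    have h := (hc 0).continuousAt.tendsto
    rwa [zero_smul, add_zero] at h
  have hd : ∀ᶠ w in nhds p, DifferentiableAt ℝ F w := by
    filter_upwards [hF.eventually (by simp)] with w hw
    exact hw.differentiableAt (by simp)
  have h1 : deriv (fun t : ℝ => F (p + t • U)) =ᶠ[nhds 0]
      fun t => fderiv ℝ F (p + t • U) U := by
    filter_upwards [hcont.eventually hd] with t ht
    exact (ht.hasFDerivAt.comp_hasDerivAt t (hc t)).deriv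
  rw [h1.deriv_eq]
  have h2 : HasFDerivAt (fderiv ℝ F) (fderiv ℝ (fderiv ℝ F) p) (p + (0 : ℝ) • U) := by
    rw [zero_smul, add_zero]
    exact ((hF.fderiv_right (m := 1) (by norm_num)).differentiableAt (by simp)).hasFDerivAt
  have h3 : HasDerivAt (fun t : ℝ => fderiv ℝ F (p + t • U)) (fderiv ℝ (fderiv ℝ F) p U) 0 :=
    h2.comp_hasDerivAt (0 : ℝ) (hc 0)
  have h4 := h3.clm_apply (hasDerivAt_const (0 : ℝ) U)
  rw [h4.deriv]
  simp

section
variable {n : ℕ} {q : ℝ} {φ g : (Fin (n + 1) → ℝ) → ℝ}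

theorem curve_eventually_mem_orthant (b : Fin (n + 1) → ℝ) : ∀ᶠ t : ℝ in nhds 0, ∀ k, 0 < 1 + t * b k / 2 := by
  refine Filter.eventually_all.2 fun k => ?_
  have : ContinuousAt (fun t : ℝ => 1 + t * b k / 2) 0 := by fun_prop
  exact this.eventually (lt_mem_nhds (by simp))

theorem curve_eq (hhom : IsHomogeneousOfDegree q φ) (hg : Set.EqOn φ g (simplex n))
    {y : Fin n → ℝ} (hy : y ∈ cornerSimplex n) {b : Fin (n + 1) → ℝ}
    (hb : ∑ k, simplexLift n y k * b k = 0) :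
    (fun t : ℝ => φ fun k => simplexLift n y k * (1 + t * b k / 2) ^ 2) =ᶠ[nhds 0]
      fun t => (1 + t ^ 2 * (∑ k, simplexLift n y k * b k ^ 2) / 4) ^ q *
        (g ∘ simplexLift n) fun i => y i * (1 + t * b i.succ / 2) ^ 2 /
          (1 + t ^ 2 * (∑ k, simplexLift n y k * b k ^ 2) / 4) := by
  have hx := mem_cornerSimplex_iff.1 hy
  filter_upwards [curve_eventually_mem_orthant b] with t ht
  rw [homogeneous_eq hhom hg fun k => mul_pos (hx k) (pow_pos (ht k) 2),
    sum_curve (sum_simplexLift y) hb]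
  simp only [simplexLift_succ, Function.comp]

theorem hessianBound_of_deriv_deriv (hg : Set.EqOn φ g (simplex n)) (hgs : ContDiff ℝ ∞ g)
    (hhom : IsHomogeneousOfDegree q φ)
    (h : ∀ y ∈ cornerSimplex n, ∀ b : Fin (n + 1) → ℝ, ∑ k, simplexLift n y k * b k = 0 →
      0 ≤ deriv (deriv fun t : ℝ => φ fun k => simplexLift n y k * (1 + t * b k / 2) ^ 2) 0 +
        (n - q * φ (simplexLift n y)) / 2 * ∑ k, simplexLift n y k * b k ^ 2) :
    HessianBound n (g ∘ simplexLift n) := by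
  intro y hy b hb
  have hψ : ContDiff ℝ ∞ (g ∘ simplexLift n) := hgs.comp contDiff_simplexLift
  have hx := mem_cornerSimplex_iff.1 hy
  have hN : 0 ≤ ∑ k, simplexLift n y k * b k ^ 2 :=
    Finset.sum_nonneg fun k _ => mul_nonneg (hx k).le (sq_nonneg _)
  have h1 := h y hy b hb
  rw [(curve_eq hhom hg hy hb).deriv.deriv_eq,
    deriv_deriv_homogeneous_curve hψ q hN y fun i => b i.succ] at h1
  have h2 : φ (simplexLift n y) = (g ∘ simplexLift n) y := hg ⟨hx, sum_simplexLift y⟩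
  rw [h2] at h1
  linarith

theorem hessianBound_of_convex (hφ_convex : IsPConvex (1 / 2) φ) (hg : Set.EqOn φ g (simplex n))
    (hgs : ContDiff ℝ ∞ g) (hhom : IsHomogeneousOfDegree q φ) (hq : 0 ≤ q)
    (hM : sSup (φ '' simplex n) * q ≤ n) : HessianBound n (g ∘ simplexLift n) := by
  refine hessianBound_of_deriv_deriv hg hgs hhom fun y hy b hb => ?_
  have hx := mem_cornerSimplex_iff.1 hy
  have hψ : ContDiff ℝ ∞ (g ∘ simplexLift n) := hgs.comp contDiff_simplexLift
  have hN : 0 ≤ ∑ k, simplexLift n y k * b k ^ 2 :=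
    Finset.sum_nonneg fun k _ => mul_nonneg (hx k).le (sq_nonneg _)
  have hmem : simplexLift n y ∈ simplex n := ⟨hx, sum_simplexLift y⟩
  -- the supremum is finite because `g` is bounded on the closed simplex
  have hbdd : BddAbove (φ '' simplex n) := by
    obtain ⟨C, hC⟩ := (isCompact_Icc (a := (0 : Fin (n + 1) → ℝ)) (b := 1)).bddAbove_image
      hgs.continuous.continuousOn
    refine ⟨C, ?_⟩
    rintro _ ⟨x, hx, rfl⟩
    rw [hg hx]
    refine hC ⟨x, ⟨fun k => (hx.1 k).le, fun k => ?_⟩, rfl⟩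
    rw [Pi.one_apply, ← hx.2]
    exact Finset.single_le_sum (fun i _ => (hx.1 i).le) (Finset.mem_univ k)
  have hle : q * φ (simplexLift n y) ≤ n := by
    refine le_trans ?_ hM
    rw [mul_comm]
    exact mul_le_mul_of_nonneg_right (le_csSup hbdd ⟨_, hmem, rfl⟩) hq
  refine add_nonneg ?_ (mul_nonneg (by linarith) hN)
  have hcurve := curve_eq hhom hg hy hb
  rw [hcurve.deriv.deriv_eq]
  refine deriv_deriv_nonneg_of_midpoint ?_ ?_
  · have hσ : ContDiff ℝ 2 fun t : ℝ =>
        1 + t ^ 2 * (∑ k, simplexLift n y k * b k ^ 2) / 4 := by fun_prop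
    have hσ0 : ∀ t : ℝ, 1 + t ^ 2 * (∑ k, simplexLift n y k * b k ^ 2) / 4 ≠ 0 := fun t => by
      positivity
    refine (hσ.rpow_const_of_ne hσ0).mul ((contDiff_infty.1 hψ 2).comp (contDiff_pi.2 fun i => ?_))
    exact ContDiff.div (by fun_prop) hσ hσ0
  · have hneg : Filter.Tendsto (fun t : ℝ => -t) (nhds 0) (nhds 0) := by
      have h := (continuous_neg (G := ℝ)).tendsto 0
      rwa [neg_zero] at h
    have hor := curve_eventually_mem_orthant b
    filter_upwards [hcurve, hneg.eventually hcurve, hor, hneg.eventually hor] with t h1 h2 h3 h4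
    have h0 := hcurve.eq_of_nhds
    beta_reduce at h0 h1 h2
    rw [← h0, ← h1, ← h2]
    have hline : ∀ t : ℝ, (∀ k, 0 < 1 + t * b k / 2) →
        (fun k => √(simplexLift n y k) * (1 + t * b k / 2)) ∈ orthant (n + 1) :=
      fun t ht k => mul_pos (Real.sqrt_pos.2 (hx k)) (ht k)
    have hconv : ConvexOn ℝ (orthant (n + 1)) _ := hφ_convex
    have hc := hconv.2 (hline t h3) (hline (-t) h4) (show (0 : ℝ) ≤ 1 / 2 by norm_num)
      (show (0 : ℝ) ≤ 1 / 2 by norm_num) (by norm_num)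
    have hval : ∀ t : ℝ, (fun k : Fin (n + 1) => (√(simplexLift n y k) * (1 + t * b k / 2)) ^
        (1 / (1 / 2) : ℝ)) = fun k => simplexLift n y k * (1 + t * b k / 2) ^ 2 := by
      intro t
      ext k
      rw [show (1 / (1 / 2) : ℝ) = ((2 : ℕ) : ℝ) by norm_num, Real.rpow_natCast, mul_pow,
        Real.sq_sqrt (hx k).le]
    have hmid : ((1 / 2 : ℝ) • (fun k => √(simplexLift n y k) * (1 + t * b k / 2)) +
        (1 / 2 : ℝ) • fun k => √(simplexLift n y k) * (1 + -t * b k / 2)) =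
        fun k => √(simplexLift n y k) * (1 + 0 * b k / 2) := by
      ext k
      simp only [Pi.add_apply, Pi.smul_apply, smul_eq_mul]
      ring
    rw [hmid] at hc
    simp only [hval, smul_eq_mul] at hc
    linarith

theorem contDiffAt_complexLift (hhom : IsHomogeneousOfDegree q φ) (hg : Set.EqOn φ g (simplex n))
    (hgs : ContDiff ℝ ∞ g) {p : EuclideanSpace ℂ (Fin (n + 1))} (hp : ∀ k, p k ≠ 0) :
    ContDiffAt ℝ 2 (complexLift φ) p := by
  have hcoord : ∀ k, ContDiff ℝ 2 fun z : EuclideanSpace ℂ (Fin (n + 1)) => ‖z k‖ ^ 2 / 4 :=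
    fun k => ((PiLp.proj (𝕜 := ℝ) 2 (fun _ : Fin (n + 1) => ℂ) k).contDiff.norm_sq
      ℝ).div_const 4
  have hσ : ContDiff ℝ 2 fun z : EuclideanSpace ℂ (Fin (n + 1)) => ∑ k, ‖z k‖ ^ 2 / 4 :=
    ContDiff.sum fun k _ => hcoord k
  have hσ0 : ∑ k, ‖p k‖ ^ 2 / 4 ≠ 0 :=
    (Finset.sum_pos (fun k _ => by have := norm_pos_iff.2 (hp k); positivity)
      Finset.univ_nonempty).ne'
  have hev : ∀ᶠ z : EuclideanSpace ℂ (Fin (n + 1)) in nhds p, ∀ k, z k ≠ 0 := by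
    refine Filter.eventually_all.2 fun k => ?_
    exact (PiLp.proj (𝕜 := ℝ) 2 (fun _ : Fin (n + 1) => ℂ) k).continuous.continuousAt
      |>.eventually_ne (hp k)
  have heq : complexLift φ =ᶠ[nhds p] fun z => (∑ k, ‖z k‖ ^ 2 / 4) ^ q *
      (g ∘ simplexLift n) fun i => ‖z i.succ‖ ^ 2 / 4 / ∑ k, ‖z k‖ ^ 2 / 4 := by
    filter_upwards [hev] with z hz
    exact homogeneous_eq hhom hg fun k => by have := norm_pos_iff.2 (hz k); positivity
  refine ContDiffAt.congr_of_eventuallyEq ?_ heq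
  refine (hσ.contDiffAt.rpow_const_of_ne hσ0).mul ?_
  have hψ : ContDiff ℝ 2 (g ∘ simplexLift n) := contDiff_infty.1 (hgs.comp contDiff_simplexLift) 2
  exact hψ.contDiffAt.comp p (contDiffAt_pi.2 fun i => (hcoord _).contDiffAt.div hσ.contDiffAt hσ0)

theorem inner_gradient_norm_sq (p : EuclideanSpace ℂ (Fin (n + 1))) (k : Fin (n + 1))
    (v : EuclideanSpace ℂ (Fin (n + 1))) :
    inner ℝ (gradient (fun w : EuclideanSpace ℂ (Fin (n + 1)) => ‖w k‖ ^ 2) p) v =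
      2 * inner ℝ (p k) (v k) := by
  have h : HasFDerivAt (fun w : EuclideanSpace ℂ (Fin (n + 1)) => ‖w k‖ ^ 2) _ p :=
    (PiLp.proj (𝕜 := ℝ) 2 (fun _ : Fin (n + 1) => ℂ) k).hasFDerivAt.norm_sq
  rw [gradient, InnerProductSpace.toDual_symm_apply, h.fderiv]
  simp
  ring

theorem mem_radialSubspace {p U : EuclideanSpace ℂ (Fin (n + 1))} {b : Fin (n + 1) → ℝ}
    (hU : ∀ k, U k = (b k / 2 : ℝ) • p k) (hpU : inner ℝ p U = 0) : U ∈ radialSubspace p := by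
  have hsum : ∑ k, (b k / 4) • gradient (fun w : EuclideanSpace ℂ (Fin (n + 1)) => ‖w k‖ ^ 2) p
      = U := by
    refine ext_inner_right ℝ fun v => ?_
    rw [sum_inner, PiLp.inner_apply]
    refine Finset.sum_congr rfl fun k _ => ?_
    rw [real_inner_smul_left, inner_gradient_norm_sq, hU, real_inner_smul_left]
    ring
  have hmem : U ∈ (Submodule.span ℝ {p})ᗮ := by
    rw [Submodule.mem_orthogonal_singleton_iff_inner_right]
    exact hpU
  rw [← Submodule.starProjection_eq_self_iff.2 hmem, ← hsum, map_sum]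
  refine Submodule.sum_mem _ fun k _ => ?_
  rw [map_smul]
  exact Submodule.smul_mem _ _ (Submodule.subset_span ⟨k, rfl⟩)

theorem hessianBound_of_curvatureCondition (hcurv : CurvatureCondition n q φ)
    (hg : Set.EqOn φ g (simplex n)) (hgs : ContDiff ℝ ∞ g) (hhom : IsHomogeneousOfDegree q φ) :
    HessianBound n (g ∘ simplexLift n) := by
  refine hessianBound_of_deriv_deriv hg hgs hhom fun y hy b hb => ?_
  have hx := mem_cornerSimplex_iff.1 hy
  have hs : ∀ k, √(simplexLift n y k) ^ 2 = simplexLift n y k := fun k => Real.sq_sqrt (hx k).le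
  let p : EuclideanSpace ℂ (Fin (n + 1)) :=
    WithLp.toLp 2 fun k => ((2 * √(simplexLift n y k) : ℝ) : ℂ)
  let U : EuclideanSpace ℂ (Fin (n + 1)) :=
    WithLp.toLp 2 fun k => ((√(simplexLift n y k) * b k : ℝ) : ℂ)
  have hp : ∀ k, p k = ((2 * √(simplexLift n y k) : ℝ) : ℂ) := fun k => rfl
  have hU : ∀ k, U k = ((√(simplexLift n y k) * b k : ℝ) : ℂ) := fun k => rfl
  have hline : ∀ t : ℝ, complexLift φ (p + t • U) =
      φ fun k => simplexLift n y k * (1 + t * b k / 2) ^ 2 := by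
    intro t
    rw [complexLift]
    congr 1
    ext k
    rw [PiLp.add_apply, PiLp.smul_apply, hp, hU, Complex.real_smul, ← Complex.ofReal_mul,
      ← Complex.ofReal_add, Complex.norm_real, Real.norm_eq_abs, sq_abs]
    linear_combination (1 + t * b k / 2) ^ 2 * hs k
  have hp0 : ∀ k, p k ≠ 0 := fun k => by
    rw [hp, Complex.ofReal_ne_zero]
    exact (mul_pos two_pos (Real.sqrt_pos.2 (hx k))).ne'
  have hpU : inner ℝ p U = 0 := by
    rw [PiLp.inner_apply, ← mul_zero (2 : ℝ), ← hb, Finset.mul_sum]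
    refine Finset.sum_congr rfl fun k _ => ?_
    rw [hp, hU]
    simp
    linear_combination 2 * b k * hs k
  have hpn : p ∈ Metric.sphere (0 : EuclideanSpace ℂ (Fin (n + 1))) 2 := by
    rw [mem_sphere_zero_iff_norm, EuclideanSpace.norm_eq, Real.sqrt_eq_iff_mul_self_eq_of_pos two_pos]
    simp only [hp, Complex.norm_real, Real.norm_eq_abs, sq_abs, mul_pow, hs, ← Finset.mul_sum,
      sum_simplexLift]
    norm_num
  have hUn : ‖U‖ ^ 2 = ∑ k, simplexLift n y k * b k ^ 2 := by
    rw [EuclideanSpace.norm_sq_eq]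
    simp only [hU, Complex.norm_real, Real.norm_eq_abs, sq_abs, mul_pow, hs]
  have h := hcurv p hpn hp0 U (mem_radialSubspace (b := b) (fun k => by
    rw [hp, hU, Complex.real_smul, ← Complex.ofReal_mul]
    congr 1
    ring) hpU)
  rw [← deriv_deriv_line (contDiffAt_complexLift hhom hg hgs hp0) U, hUn] at h
  have h0 : complexLift φ p = φ (simplexLift n y) := by
    have := hline 0
    simpa using this
  simpa only [hline, h0] using h

end

/-! ### Square-integrable functions and approximation -/

theorem inner_toLp_eq_integral {α : Type*} [MeasurableSpace α] {m : Measure α} {f g : α → ℝ}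
    (hf : MemLp f 2 m) (hg : MemLp g 2 m) :
    inner ℝ (hf.toLp f) (hg.toLp g) = ∫ x, f x * g x ∂m := by
  rw [L2.inner_def]
  refine integral_congr_ae ?_
  filter_upwards [hf.coeFn_toLp, hg.coeFn_toLp] with x h1 h2
  rw [h1, h2]
  simp [mul_comm]

theorem norm_toLp_sq_eq_integral {α : Type*} [MeasurableSpace α] {m : Measure α} {f : α → ℝ}
    (hf : MemLp f 2 m) : ‖hf.toLp f‖ ^ 2 = ∫ x, f x ^ 2 ∂m := by
  rw [← real_inner_self_eq_norm_sq, inner_toLp_eq_integral]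
  simp only [pow_two]

theorem integral_mul_sq_le {α : Type*} [MeasurableSpace α] {m : Measure α} {f g : α → ℝ}
    (hf : MemLp f 2 m) (hg : MemLp g 2 m) :
    (∫ x, f x * g x ∂m) ^ 2 ≤ (∫ x, f x ^ 2 ∂m) * ∫ x, g x ^ 2 ∂m := by
  rw [← inner_toLp_eq_integral hf hg, ← norm_toLp_sq_eq_integral hf,
    ← norm_toLp_sq_eq_integral hg, ← mul_pow, ← sq_abs]
  exact pow_le_pow_left₀ (abs_nonneg _) (abs_real_inner_le_norm _ _) 2

/-- A function orthogonal to everything that is orthogonal to the range of `A` is approximated in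
mean square by the range of `A`. -/
theorem exists_integral_sub_sq_lt {α P : Type*} [MeasurableSpace α] {m : Measure α}
    [AddCommGroup P] [Module ℝ P] (A : P →ₗ[ℝ] α → ℝ) (hA : ∀ p, MemLp (A p) 2 m) {F : α → ℝ}
    (hF : MemLp F 2 m)
    (h : ∀ g : α → ℝ, MemLp g 2 m → (∀ p, ∫ x, g x * A p x ∂m = 0) → ∫ x, g x * F x ∂m = 0)
    {ε : ℝ} (hε : 0 < ε) : ∃ p, ∫ x, (F x - A p x) ^ 2 ∂m < ε := by
  let T : P →ₗ[ℝ] Lp ℝ 2 m :=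
    { toFun := fun p => (hA p).toLp (A p)
      map_add' := fun p r => by
        rw [← MemLp.toLp_add]
        exact MemLp.toLp_congr _ _ (by rw [map_add])
      map_smul' := fun c p => by
        rw [RingHom.id_apply, ← MemLp.toLp_const_smul]
        exact MemLp.toLp_congr _ _ (by rw [map_smul]) }
  have hT : ∀ p, T p = (hA p).toLp (A p) := fun p => rfl
  have hmem : hF.toLp F ∈ (LinearMap.range T).topologicalClosure := by
    rw [← Submodule.orthogonal_orthogonal_eq_closure, Submodule.mem_orthogonal]
    intro g hg
    have e : g = (Lp.memLp g).toLp g := (Lp.toLp_coeFn g (Lp.memLp g)).symm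
    rw [e, inner_toLp_eq_integral]
    refine h _ (Lp.memLp g) fun p => ?_
    rw [← inner_toLp_eq_integral (Lp.memLp g) (hA p), ← e, real_inner_comm]
    exact (Submodule.mem_orthogonal _ _).1 hg _ ⟨p, rfl⟩
  obtain ⟨_, ⟨p, rfl⟩, hp⟩ := Metric.mem_closure_iff.1 hmem (√ε) (Real.sqrt_pos.2 hε)
  refine ⟨p, ?_⟩
  rw [dist_eq_norm, hT, ← MemLp.toLp_sub, ← sq_lt_sq₀ (norm_nonneg _) (Real.sqrt_nonneg _),
    norm_toLp_sq_eq_integral, Real.sq_sqrt hε.le] at hp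
  simpa using hp

theorem memLp_of_continuous {n : ℕ} {f : (Fin n → ℝ) → ℝ} (hf : Continuous f) :
    MemLp f 2 (volume.restrict (cornerSimplex n)) := by
  obtain ⟨C, -, hC⟩ := exists_bound_on_cornerSimplex hf
  exact MemLp.of_bound hf.aestronglyMeasurable C
    ((ae_restrict_iff' (measurableSet_cornerSimplex n)).2 (Filter.Eventually.of_forall hC))

theorem memLp_mul_continuous {n : ℕ} {f g : (Fin n → ℝ) → ℝ}
    (hf : MemLp f 2 (volume.restrict (cornerSimplex n))) (hg : Continuous g) :
    MemLp (fun y => g y * f y) 2 (volume.restrict (cornerSimplex n)) := by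
  obtain ⟨C, -, hC⟩ := exists_bound_on_cornerSimplex hg
  refine MemLp.of_le_mul hf (hg.aestronglyMeasurable.mul hf.aestronglyMeasurable) (c := C)
    ((ae_restrict_iff' (measurableSet_cornerSimplex n)).2 (Filter.Eventually.of_forall
    fun y hy => ?_))
  rw [norm_mul]
  exact mul_le_mul_of_nonneg_right (hC y hy) (norm_nonneg _)

theorem exists_polynomial_uniform_near {n : ℕ} {f : (Fin n → ℝ) → ℝ} (hf : Continuous f)
    {ε : ℝ} (hε : 0 < ε) :
    ∃ p : MvPolynomial (Fin n) ℝ, ∀ y ∈ cornerSimplex n, |MvPolynomial.eval y p - f y| < ε := by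
  let K : Set (Fin n → ℝ) := Set.Icc 0 1
  have : CompactSpace K := isCompact_iff_compactSpace.1 isCompact_Icc
  obtain ⟨A, hA⟩ : ∃ A : MvPolynomial (Fin n) ℝ →ₐ[ℝ] C(K, ℝ),
      ∀ p (y : K), A p y = MvPolynomial.eval (y : Fin n → ℝ) p := by
    refine ⟨MvPolynomial.aeval fun i => ⟨fun y => (y : Fin n → ℝ) i,
      (continuous_apply i).comp continuous_subtype_val⟩, fun p y => ?_⟩
    induction p using MvPolynomial.induction_on with
    | C a => simp
    | add p q hp hq => rw [map_add, map_add, ContinuousMap.add_apply, hp, hq]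
    | mul_X p i hp =>
      rw [map_mul, map_mul, ContinuousMap.mul_apply, hp]
      simp
  have hsep : A.range.SeparatesPoints := by
    intro x y hxy
    have : ∃ i, (x : Fin n → ℝ) i ≠ (y : Fin n → ℝ) i := by
      by_contra! h
      exact hxy (Subtype.ext (funext h))
    obtain ⟨i, hi⟩ := this
    refine ⟨A (MvPolynomial.X i), ⟨A (MvPolynomial.X i), ⟨_, rfl⟩, rfl⟩, ?_⟩
    rw [hA, hA, MvPolynomial.eval_X, MvPolynomial.eval_X]
    exact hi
  obtain ⟨a, ha⟩ := ContinuousMap.exists_mem_subalgebra_near_continuous_of_separatesPoints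
    A.range hsep (fun y : K => f y) (hf.comp continuous_subtype_val) ε hε
  obtain ⟨p, hp⟩ := (AlgHom.mem_range A).1 a.2
  refine ⟨p, fun y hy => ?_⟩
  have h := ha ⟨y, cornerSimplex_subset_Icc n hy⟩
  rw [← hp, hA] at h
  exact h

/-- Evaluation of polynomials, as a linear map into functions. -/
noncomputable def evalLinear (n : ℕ) : MvPolynomial (Fin n) ℝ →ₗ[ℝ] (Fin n → ℝ) → ℝ where
  toFun p y := MvPolynomial.eval y p
  map_add' p q := by ext y; simp
  map_smul' c p := by ext y; simp

theorem integral_mul_eq_zero_of_orthogonal_polynomials {n : ℕ} {g F : (Fin n → ℝ) → ℝ}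
    (hg : MemLp g 2 (volume.restrict (cornerSimplex n)))
    (hF : MemLp F 2 (volume.restrict (cornerSimplex n)))
    (h : ∀ p : MvPolynomial (Fin n) ℝ, ∫ y in cornerSimplex n, g y * MvPolynomial.eval y p = 0) :
    ∫ y in cornerSimplex n, g y * F y = 0 := by
  -- it suffices to treat bounded continuous `F`, which are uniformly near polynomials
  set m := (volume : Measure (Fin n → ℝ)).restrict (cornerSimplex n) with hm
  have hcont : ∀ f : (Fin n → ℝ) → ℝ, Continuous f → ∫ y, g y * f y ∂m = 0 := by
    intro f hf
    have hgi : Integrable g m := hg.integrable (by norm_num)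
    by_contra hne
    have hpos : 0 < |∫ y, g y * f y ∂m| := abs_pos.2 hne
    set I := ∫ y, |g y| ∂m with hI
    have hI0 : 0 ≤ I := integral_nonneg fun y => abs_nonneg _
    obtain ⟨p, hp⟩ := exists_polynomial_uniform_near hf
      (ε := |∫ y, g y * f y ∂m| / (2 * (I + 1))) (by positivity)
    have h1 : ∫ y, g y * f y ∂m = ∫ y, g y * (f y - MvPolynomial.eval y p) ∂m := by
      simp only [mul_sub]
      have i1 : Integrable (fun y => g y * f y) m := hg.integrable_mul (memLp_of_continuous hf)
      have i2 : Integrable (fun y => g y * MvPolynomial.eval y p) m :=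
        hg.integrable_mul (memLp_of_continuous p.continuous_eval)
      rw [integral_sub i1 i2, h p, sub_zero]
    have h2 : |∫ y, g y * (f y - MvPolynomial.eval y p) ∂m| ≤
        ∫ y, |g y| * (|∫ y, g y * f y ∂m| / (2 * (I + 1))) ∂m := by
      rw [← Real.norm_eq_abs]
      refine norm_integral_le_of_norm_le (hgi.abs.mul_const _) ?_
      refine (ae_restrict_iff' (measurableSet_cornerSimplex n)).2 (Filter.Eventually.of_forall
        fun y hy => ?_)
      rw [norm_mul, Real.norm_eq_abs, Real.norm_eq_abs]
      refine mul_le_mul_of_nonneg_left ?_ (abs_nonneg _)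
      rw [abs_sub_comm]
      exact (hp y hy).le
    rw [← h1, integral_mul_const, ← hI, mul_div_assoc', le_div_iff₀ (by positivity)] at h2
    nlinarith
  have hg0 : hg.toLp g = 0 := by
    have hdense := BoundedContinuousFunction.toLp_denseRange (α := Fin n → ℝ) ℝ m ℝ
      (p := 2) (by norm_num)
    refine Dense.eq_zero_of_inner_left ℝ hdense ?_
    rintro _ ⟨f, rfl⟩
    rw [← hcont f f.continuous, L2.inner_def]
    refine integral_congr_ae ?_
    filter_upwards [hg.coeFn_toLp, BoundedContinuousFunction.coeFn_toLp 2 m ℝ f] with y h1 h2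
    rw [h1, h2]
    simp [mul_comm]
  have : ∫ y, g y * F y ∂m = inner ℝ (hg.toLp g) (hF.toLp F) :=
    (inner_toLp_eq_integral hg hF).symm
  rw [this, hg0, inner_zero_left]

theorem exists_polynomial_integral_sub_sq_lt {n : ℕ} {F : (Fin n → ℝ) → ℝ}
    (hF : MemLp F 2 (volume.restrict (cornerSimplex n))) {ε : ℝ} (hε : 0 < ε) :
    ∃ p : MvPolynomial (Fin n) ℝ,
      ∫ y in cornerSimplex n, (F y - MvPolynomial.eval y p) ^ 2 < ε :=
  exists_integral_sub_sq_lt (evalLinear n) (fun p => memLp_of_continuous p.continuous_eval) hF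
    (fun _ hg h => integral_mul_eq_zero_of_orthogonal_polynomials hg hF h) hε

/-- The orthogonal projections to the polynomials of degree at most `N` approximate a square
integrable function. -/
theorem exists_polynomial_projection {n : ℕ} {F : (Fin n → ℝ) → ℝ}
    (hF : MemLp F 2 (volume.restrict (cornerSimplex n))) {ε : ℝ} (hε : 0 < ε) :
    ∃ (N : ℕ) (p : MvPolynomial (Fin n) ℝ), p.totalDegree ≤ N ∧
      (∀ r : MvPolynomial (Fin n) ℝ, r.totalDegree ≤ N →
        ∫ y in cornerSimplex n, F y * MvPolynomial.eval y r =
          ∫ y in cornerSimplex n, MvPolynomial.eval y p * MvPolynomial.eval y r) ∧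
      ∫ y in cornerSimplex n, (F y - MvPolynomial.eval y p) ^ 2 < ε := by
  obtain ⟨s, hs⟩ := exists_polynomial_integral_sub_sq_lt hF hε
  set m := (volume : Measure (Fin n → ℝ)).restrict (cornerSimplex n) with hm
  have hev : ∀ p : MvPolynomial (Fin n) ℝ, MemLp (fun y => MvPolynomial.eval y p) 2 m :=
    fun p => memLp_of_continuous p.continuous_eval
  let T : MvPolynomial (Fin n) ℝ →ₗ[ℝ] Lp ℝ 2 m :=
    { toFun := fun p => (hev p).toLp _
      map_add' := fun p r => by
        rw [← MemLp.toLp_add]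
        exact MemLp.toLp_congr _ _ (by filter_upwards with y; simp)
      map_smul' := fun c p => by
        rw [RingHom.id_apply, ← MemLp.toLp_const_smul]
        exact MemLp.toLp_congr _ _ (by filter_upwards with y; simp) }
  have hT : ∀ p, T p = (hev p).toLp _ := fun p => rfl
  let V : Submodule ℝ (Lp ℝ 2 m) :=
    (MvPolynomial.restrictTotalDegree (Fin n) ℝ s.totalDegree).map T
  obtain ⟨p, hpdeg, hp⟩ : ∃ p ∈ MvPolynomial.restrictTotalDegree (Fin n) ℝ s.totalDegree,
      T p = V.starProjection (hF.toLp F) := Submodule.starProjection_apply_mem V (hF.toLp F)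
  refine ⟨s.totalDegree, p, (MvPolynomial.mem_restrictTotalDegree _ _ _).1 hpdeg,
    fun r hr => ?_, ?_⟩
  · have h1 : inner ℝ (hF.toLp F - V.starProjection (hF.toLp F)) (T r) = 0 :=
      V.starProjection_inner_eq_zero _ _
        ⟨r, (MvPolynomial.mem_restrictTotalDegree _ _ _).2 hr, rfl⟩
    rw [← hp, inner_sub_left, sub_eq_zero, hT, hT, inner_toLp_eq_integral,
      inner_toLp_eq_integral] at h1
    exact h1
  · refine lt_of_le_of_lt ?_ hs
    have h1 : ‖hF.toLp F - T p‖ ≤ ‖hF.toLp F - T s‖ := by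
      rw [hp, Submodule.starProjection_minimal]
      exact ciInf_le ⟨0, by rintro _ ⟨x, rfl⟩; exact norm_nonneg _⟩
        (⟨T s, s, (MvPolynomial.mem_restrictTotalDegree _ _ _).2 le_rfl, rfl⟩ : V)
    have h2 := pow_le_pow_left₀ (norm_nonneg _) h1 2
    rw [hT, hT, ← MemLp.toLp_sub, ← MemLp.toLp_sub, norm_toLp_sq_eq_integral,
      norm_toLp_sq_eq_integral] at h2
    simpa using h2

/-! ### The weighted Laplacian on polynomials -/

theorem centeredDeriv_add {n : ℕ} (p r : MvPolynomial (Fin n) ℝ) (k : Fin (n + 1)) :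
    centeredDeriv (p + r) k = centeredDeriv p k + centeredDeriv r k := by
  have hE : eulerDeriv (p + r) = eulerDeriv p + eulerDeriv r := by
    simp [eulerDeriv, mul_add, Finset.sum_add_distrib]
  refine Fin.cases ?_ (fun i => ?_) k
  · simp only [centeredDeriv_zero, hE]; ring
  · simp only [centeredDeriv_succ, hE, map_add]; ring

theorem centeredDeriv_smul {n : ℕ} (c : ℝ) (p : MvPolynomial (Fin n) ℝ) (k : Fin (n + 1)) :
    centeredDeriv (c • p) k = c • centeredDeriv p k := by
  have hE : eulerDeriv (c • p) = c • eulerDeriv p := by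
    simp only [eulerDeriv, Derivation.map_smul, mul_smul_comm, Finset.smul_sum]
  refine Fin.cases ?_ (fun i => ?_) k
  · simp only [centeredDeriv_zero, hE, smul_neg]
  · simp only [centeredDeriv_succ, hE, Derivation.map_smul, smul_sub]

/-- The operator `L p = div (∇ p) - dψ (∇ p)`, symmetric with respect to the density `exp (-ψ)`,
on polynomials. -/
noncomputable def weightedLaplacian {n : ℕ} (ψ : (Fin n → ℝ) → ℝ) :
    MvPolynomial (Fin n) ℝ →ₗ[ℝ] (Fin n → ℝ) → ℝ where
  toFun p := weightedDiv ψ (centeredDeriv p)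
  map_add' p r := by
    ext y
    simp only [weightedDiv, fieldDiv, fieldComp, centeredDeriv_add, mul_add, map_add,
      Finset.sum_add_distrib, Pi.add_apply]
    ring
  map_smul' c p := by
    ext y
    simp only [weightedDiv, fieldDiv, fieldComp, centeredDeriv_smul, mul_smul_comm, Derivation.map_smul,
      ← Finset.smul_sum, MvPolynomial.smul_eval, RingHom.id_apply, Pi.smul_apply, smul_eq_mul,
      mul_left_comm _ c, ← Finset.mul_sum]
    ring

theorem weightedLaplacian_apply {n : ℕ} (ψ : (Fin n → ℝ) → ℝ) (p : MvPolynomial (Fin n) ℝ)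
    (y : Fin n → ℝ) : weightedLaplacian ψ p y = MvPolynomial.eval y (fieldDiv (centeredDeriv p)) -
      ∑ i, partialDeriv i ψ y * MvPolynomial.eval y (fieldComp (centeredDeriv p) i) := rfl

theorem continuous_weightedLaplacian {n : ℕ} {ψ : (Fin n → ℝ) → ℝ} (hψ : ContDiff ℝ ∞ ψ)
    (p : MvPolynomial (Fin n) ℝ) : Continuous (weightedLaplacian ψ p) :=
  (contDiff_weightedDiv hψ _).continuous

theorem integral_exp_mul_eval_mul_weightedLaplacian {n : ℕ} {ψ : (Fin n → ℝ) → ℝ}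
    (hψ : ContDiff ℝ ∞ ψ) (r p : MvPolynomial (Fin n) ℝ) :
    ∫ y in cornerSimplex n, Real.exp (-ψ y) * (MvPolynomial.eval y r * weightedLaplacian ψ p y) =
      -∫ y in cornerSimplex n, Real.exp (-ψ y) * MvPolynomial.eval y (gammaPoly r p) := by
  have hE : Continuous fun y => Real.exp (-ψ y) := hψ.continuous.neg.rexp
  have ht : IsTangent fun k => r * centeredDeriv p k := by
    simp only [IsTangent, mul_left_comm _ r, ← Finset.mul_sum]
    rw [show ∑ k, baryPoly n k * centeredDeriv p k = 0 from isTangent_centeredDeriv p, mul_zero]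
  have h := integral_exp_mul_weightedDiv_eq_zero hψ ht
  have hf : ∀ i, fieldComp (fun k => r * centeredDeriv p k) i =
      r * fieldComp (centeredDeriv p) i := fun i => by simp only [fieldComp]; ring
  have hw : ∀ y, weightedDiv ψ (fun k => r * centeredDeriv p k) y =
      MvPolynomial.eval y r * weightedLaplacian ψ p y + MvPolynomial.eval y (gammaPoly r p) := by
    intro y
    rw [weightedLaplacian_apply]
    simp only [weightedDiv, fieldDiv, hf, MvPolynomial.pderiv_mul, Finset.sum_add_distrib, map_add,
      map_sum, map_mul, gammaPoly, mul_sub, Finset.mul_sum]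
    rw [Finset.sum_congr rfl fun i _ => mul_left_comm (MvPolynomial.eval y r)
      (partialDeriv i ψ y) (MvPolynomial.eval y (fieldComp (centeredDeriv p) i))]
    ring
  have i1 : IntegrableOn (fun y => Real.exp (-ψ y) *
      (MvPolynomial.eval y r * weightedLaplacian ψ p y)) (cornerSimplex n) :=
    integrableOn_cornerSimplex
      (hE.mul (r.continuous_eval.mul (continuous_weightedLaplacian hψ p)))
  have i2 : IntegrableOn (fun y => Real.exp (-ψ y) * MvPolynomial.eval y (gammaPoly r p))
      (cornerSimplex n) := integrableOn_cornerSimplex (hE.mul (gammaPoly r p).continuous_eval)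
  simp only [hw, mul_add] at h
  rw [integral_add i1 i2] at h
  linarith

theorem integral_eval_mul_fieldDiv {n : ℕ} (r p : MvPolynomial (Fin n) ℝ) :
    ∫ y in cornerSimplex n, MvPolynomial.eval y r *
        MvPolynomial.eval y (fieldDiv (centeredDeriv p)) =
      -∫ y in cornerSimplex n, MvPolynomial.eval y (gammaPoly r p) := by
  have h := integral_exp_mul_eval_mul_weightedLaplacian (ψ := fun _ => 0) contDiff_const r p
  simpa [weightedLaplacian_apply, partialDeriv] using h

theorem pderiv_eq_zero_or_totalDegree_lt {n : ℕ} (i : Fin n) (p : MvPolynomial (Fin n) ℝ) :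
    MvPolynomial.pderiv i p = 0 ∨ (MvPolynomial.pderiv i p).totalDegree + 1 ≤ p.totalDegree := by
  by_cases h : MvPolynomial.pderiv i p = 0
  · exact Or.inl h
  refine Or.inr ?_
  obtain ⟨s, hs, hdeg⟩ := (MvPolynomial.pderiv i p).support.exists_mem_eq_sup
    (MvPolynomial.support_nonempty.2 h) fun s => s.sum fun _ e => e
  rw [MvPolynomial.mem_support_iff, MvPolynomial.coeff_pderiv] at hs
  have hs' : s + Finsupp.single i 1 ∈ p.support :=
    MvPolynomial.mem_support_iff.2 (left_ne_zero_of_mul hs)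
  have := MvPolynomial.le_totalDegree hs'
  rw [Finsupp.sum_add_index' (fun _ => rfl) fun _ _ _ => rfl, Finsupp.sum_single_index rfl] at this
  rw [MvPolynomial.totalDegree, hdeg]
  exact this

/-- The unweighted Laplacian does not raise degrees. -/
theorem totalDegree_fieldDiv_centeredDeriv_le {n : ℕ} (p : MvPolynomial (Fin n) ℝ) :
    (fieldDiv (centeredDeriv p)).totalDegree ≤ p.totalDegree := by
  have h1 : ∀ i, (MvPolynomial.X i * MvPolynomial.pderiv i p).totalDegree ≤ p.totalDegree := by
    intro i
    rcases pderiv_eq_zero_or_totalDegree_lt i p with h | h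
    · simp [h]
    · refine (MvPolynomial.totalDegree_mul _ _).trans ?_
      rw [MvPolynomial.totalDegree_X]
      omega
  have h2 : (eulerDeriv p).totalDegree ≤ p.totalDegree :=
    MvPolynomial.totalDegree_finsetSum_le fun i _ => h1 i
  refine MvPolynomial.totalDegree_finsetSum_le fun i _ => ?_
  have h3 : (fieldComp (centeredDeriv p) i).totalDegree ≤ p.totalDegree + 1 := by
    rw [fieldComp, centeredDeriv_succ, mul_sub]
    refine (MvPolynomial.totalDegree_sub _ _).trans (max_le ((h1 i).trans (Nat.le_succ _)) ?_)
    refine (MvPolynomial.totalDegree_mul _ _).trans ?_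
    rw [MvPolynomial.totalDegree_X]
    omega
  rcases pderiv_eq_zero_or_totalDegree_lt i (fieldComp (centeredDeriv p) i) with h | h
  · simp [h]
  · omega

theorem eval_gammaPoly_self_nonneg {n : ℕ} (p : MvPolynomial (Fin n) ℝ) {y : Fin n → ℝ}
    (hy : y ∈ cornerSimplex n) : 0 ≤ MvPolynomial.eval y (gammaPoly p p) := by
  rw [eval_gammaPoly_self]
  exact Finset.sum_nonneg fun k _ => mul_nonneg (mem_cornerSimplex_iff.1 hy k).le (sq_nonneg _)

theorem sum_mul_fieldComp_sq_le {n : ℕ} (v : Fin n → ℝ) (p : MvPolynomial (Fin n) ℝ)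
    {y : Fin n → ℝ} (hy : y ∈ cornerSimplex n) :
    (∑ i, v i * MvPolynomial.eval y (fieldComp (centeredDeriv p) i)) ^ 2 ≤
      (∑ i, y i * v i ^ 2) * MvPolynomial.eval y (gammaPoly p p) := by
  have hx := mem_cornerSimplex_iff.1 hy
  have hy0 : ∀ i, 0 ≤ y i := fun i => (hx i.succ).le
  have h := Finset.sum_mul_sq_le_sq_mul_sq Finset.univ (fun i => √(y i) * v i)
    fun i => √(y i) * MvPolynomial.eval y (centeredDeriv p i.succ)
  have e1 : ∀ i, √(y i) * v i * (√(y i) * MvPolynomial.eval y (centeredDeriv p i.succ)) =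
      v i * MvPolynomial.eval y (fieldComp (centeredDeriv p) i) := fun i => by
    rw [eval_fieldComp]
    linear_combination v i * MvPolynomial.eval y (centeredDeriv p i.succ) * Real.mul_self_sqrt (hy0 i)
  simp only [e1, mul_pow, Real.sq_sqrt (hy0 _)] at h
  refine h.trans (mul_le_mul_of_nonneg_left ?_
    (Finset.sum_nonneg fun i _ => mul_nonneg (hy0 i) (sq_nonneg _)))
  rw [eval_gammaPoly_self, Fin.sum_univ_succ]
  simp only [simplexLift_succ]
  exact le_add_of_nonneg_left (mul_nonneg (hx 0).le (sq_nonneg _))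

/-! ### Density of the range of the weighted Laplacian -/

theorem nonpos_of_forall_le_mul {a K : ℝ} (h : ∀ ε > 0, a ≤ K * ε) : a ≤ 0 := by
  by_contra! ha
  have h1 := h (a / (2 * (|K| + 1))) (by positivity)
  have h2 : K * (a / (2 * (|K| + 1))) ≤ |K| * (a / (2 * (|K| + 1))) :=
    mul_le_mul_of_nonneg_right (le_abs_self K) (by positivity)
  have h3 : |K| * (a / (2 * (|K| + 1))) = a / 2 * (|K| / (|K| + 1)) := by field_simp
  have h4 : |K| / (|K| + 1) ≤ 1 := (div_le_one (by positivity)).2 (by linarith)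
  nlinarith

/-- For large `l` no square integrable function is orthogonal to the range of `l - L`: its
projections `p` to polynomials of bounded degree satisfy an energy estimate, because the unweighted
Laplacian preserves those polynomials and the first-order term is controlled by the energy. -/
theorem ae_eq_zero_of_orthogonal_resolvent {n : ℕ} {ψ : (Fin n → ℝ) → ℝ} (hψ : ContDiff ℝ ∞ ψ)
    {C l : ℝ} (hC0 : 0 ≤ C) (hl : C ^ 2 / 4 < l)
    (hC : ∀ y ∈ cornerSimplex n, ∑ i, y i * partialDeriv i ψ y ^ 2 ≤ C ^ 2)
    {g : (Fin n → ℝ) → ℝ} (hg : MemLp g 2 (volume.restrict (cornerSimplex n)))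
    (horth : ∀ p : MvPolynomial (Fin n) ℝ, ∫ y in cornerSimplex n,
      g y * (l * MvPolynomial.eval y p - weightedLaplacian ψ p y) = 0) :
    g =ᵐ[volume.restrict (cornerSimplex n)] 0 := by
  have hl0 : 0 < l := lt_of_le_of_lt (by positivity) hl
  have hint : ∀ f : (Fin n → ℝ) → ℝ, Continuous f →
      Integrable (fun y => g y * f y) (volume.restrict (cornerSimplex n)) := fun f hf =>
    hg.integrable_mul (memLp_of_continuous hf)
  have hg2 : Integrable (fun y => g y ^ 2) (volume.restrict (cornerSimplex n)) := hg.integrable_sq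
  have key : ∀ ε > 0, (l - C ^ 2 / 4) * ∫ y in cornerSimplex n, g y ^ 2 ≤ l * ε := by
    intro ε hε
    obtain ⟨N, p, hpN, hproj, hpε⟩ := exists_polynomial_projection hg hε
    have hpc : Continuous fun y : Fin n → ℝ => MvPolynomial.eval y p := p.continuous_eval
    have hp2 : Integrable (fun y => MvPolynomial.eval y p ^ 2)
        (volume.restrict (cornerSimplex n)) := integrableOn_cornerSimplex (hpc.pow 2)
    have h1 : ∫ y in cornerSimplex n, g y * MvPolynomial.eval y p =
        ∫ y in cornerSimplex n, MvPolynomial.eval y p ^ 2 := by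
      rw [hproj p hpN]; simp only [pow_two]
    have h2 : ∫ y in cornerSimplex n, g y * MvPolynomial.eval y (fieldDiv (centeredDeriv p)) =
        -∫ y in cornerSimplex n, MvPolynomial.eval y (gammaPoly p p) := by
      rw [hproj _ ((totalDegree_fieldDiv_centeredDeriv_le p).trans hpN),
        integral_eval_mul_fieldDiv]
    set S : (Fin n → ℝ) → ℝ := fun y =>
      ∑ i, partialDeriv i ψ y * MvPolynomial.eval y (fieldComp (centeredDeriv p) i) with hS
    have hSc : Continuous S := continuous_finsetSum _ fun i _ =>
      (contDiff_partialDeriv hψ).continuous.mul (MvPolynomial.continuous_eval _)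
    have h3 := horth p
    have h3' : ∫ y in cornerSimplex n, (l * (g y * MvPolynomial.eval y p) -
        g y * MvPolynomial.eval y (fieldDiv (centeredDeriv p)) + g y * S y) = 0 := by
      rw [← h3]
      refine integral_congr_ae (Filter.Eventually.of_forall fun y => ?_)
      simp only [weightedLaplacian_apply, hS]
      ring
    have j1 := (hint _ hpc).const_mul l
    have j2 := hint _ (MvPolynomial.continuous_eval (fieldDiv (centeredDeriv p)))
    have j3 := hint _ hSc
    have j12 : Integrable (fun y => l * (g y * MvPolynomial.eval y p) -
        g y * MvPolynomial.eval y (fieldDiv (centeredDeriv p)))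
        (volume.restrict (cornerSimplex n)) := j1.sub j2
    rw [integral_add j12 j3, integral_sub j1 j2, integral_const_mul, h1, h2] at h3'
    have jG : Integrable (fun y => MvPolynomial.eval y (gammaPoly p p))
        (volume.restrict (cornerSimplex n)) :=
      integrableOn_cornerSimplex (MvPolynomial.continuous_eval _)
    have h4 : -(C ^ 2 / 4 * ∫ y in cornerSimplex n, g y ^ 2) -
        ∫ y in cornerSimplex n, MvPolynomial.eval y (gammaPoly p p) ≤
        ∫ y in cornerSimplex n, g y * S y := by
      have jC : Integrable (fun y => -(C ^ 2 / 4 * g y ^ 2)) (volume.restrict (cornerSimplex n)) :=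
        (hg2.const_mul _).neg
      rw [← integral_const_mul, ← integral_neg, ← integral_sub jC jG]
      refine setIntegral_mono_on (jC.sub jG) j3 (measurableSet_cornerSimplex n) fun y hy => ?_
      set G := MvPolynomial.eval y (gammaPoly p p) with hG
      have hG0 : 0 ≤ G := eval_gammaPoly_self_nonneg p hy
      have hSy : S y ^ 2 ≤ C ^ 2 * G := (sum_mul_fieldComp_sq_le _ p hy).trans
        (mul_le_mul_of_nonneg_right (hC y hy) hG0)
      have hsq : √G ^ 2 = G := Real.sq_sqrt hG0
      have hSabs : |S y| ≤ C * √G := by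
        refine abs_le_of_sq_le_sq ?_ (by positivity)
        rw [mul_pow, hsq]
        exact hSy
      have hgs : |g y * S y| ≤ |g y| * (C * √G) := by
        rw [abs_mul]; exact mul_le_mul_of_nonneg_left hSabs (abs_nonneg _)
      have hneg := neg_abs_le (g y * S y)
      nlinarith [sq_nonneg (C * |g y| / 2 - √G), sq_abs (g y)]
    have h5 : ∫ y in cornerSimplex n, (g y - MvPolynomial.eval y p) ^ 2 =
        (∫ y in cornerSimplex n, g y ^ 2) -
          ∫ y in cornerSimplex n, MvPolynomial.eval y p ^ 2 := by
      have e : ∀ y, (g y - MvPolynomial.eval y p) ^ 2 =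
          g y ^ 2 - 2 * (g y * MvPolynomial.eval y p) + MvPolynomial.eval y p ^ 2 :=
        fun y => by ring
      have j4 := (hint _ hpc).const_mul 2
      have j5 : Integrable (fun y => g y ^ 2 - 2 * (g y * MvPolynomial.eval y p))
        (volume.restrict (cornerSimplex n)) := hg2.sub j4
      simp only [e]
      rw [integral_add j5 hp2, integral_sub hg2 j4, integral_const_mul, h1]
      ring
    rw [h5] at hpε
    have h6 : l * ((∫ y in cornerSimplex n, g y ^ 2) -
        ∫ y in cornerSimplex n, MvPolynomial.eval y p ^ 2) ≤ l * ε :=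
      mul_le_mul_of_nonneg_left hpε.le hl0.le
    linarith
  have h0 := nonpos_of_forall_le_mul key
  have h1 : ∫ y in cornerSimplex n, g y ^ 2 = 0 := by
    refine le_antisymm ?_ (integral_nonneg fun y => sq_nonneg _)
    exact nonpos_of_mul_nonpos_right h0 (by linarith)
  have h2 := (integral_eq_zero_iff_of_nonneg (fun y => sq_nonneg (g y)) hg2).1 h1
  filter_upwards [h2] with y hy
  simpa using hy

theorem exists_eq_const_of_integral_gammaPoly_eq_zero {n : ℕ} {p : MvPolynomial (Fin n) ℝ}
    (h : ∫ y in cornerSimplex n, MvPolynomial.eval y (gammaPoly p p) = 0) :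
    ∃ c : ℝ, ∀ y ∈ cornerSimplex n, MvPolynomial.eval y p = c := by
  have hc : Continuous fun y : Fin n → ℝ => MvPolynomial.eval y (gammaPoly p p) :=
    MvPolynomial.continuous_eval _
  have h1 : (fun y => MvPolynomial.eval y (gammaPoly p p))
      =ᵐ[volume.restrict (cornerSimplex n)] 0 := by
    refine (setIntegral_eq_zero_iff_of_nonneg_ae ?_ (integrableOn_cornerSimplex hc)).1 h
    exact (ae_restrict_iff' (measurableSet_cornerSimplex n)).2
      (Filter.Eventually.of_forall fun y hy => eval_gammaPoly_self_nonneg p hy)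
  have h2 : Set.EqOn (fun y => MvPolynomial.eval y (gammaPoly p p)) 0 (cornerSimplex n) :=
    Measure.eqOn_open_of_ae_eq h1 (isOpen_cornerSimplex n) hc.continuousOn continuousOn_const
  have h3 : ∀ y ∈ cornerSimplex n, ∀ k, MvPolynomial.eval y (centeredDeriv p k) = 0 := by
    intro y hy k
    have hx := mem_cornerSimplex_iff.1 hy
    have h4 := h2 hy
    simp only [eval_gammaPoly_self, Pi.zero_apply] at h4
    have h5 := (Finset.sum_eq_zero_iff_of_nonneg fun k _ =>
      mul_nonneg (hx k).le (sq_nonneg _)).1 h4 k (Finset.mem_univ k)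
    rcases mul_eq_zero.1 h5 with h6 | h6
    · exact absurd h6 (hx k).ne'
    · exact pow_eq_zero_iff two_ne_zero |>.1 h6
  have h4 : ∀ y ∈ cornerSimplex n, ∀ i, MvPolynomial.eval y (MvPolynomial.pderiv i p) = 0 := by
    intro y hy i
    have e0 := h3 y hy 0
    have e1 := h3 y hy i.succ
    rw [centeredDeriv_zero, map_neg] at e0
    rw [centeredDeriv_succ, map_sub] at e1
    linarith
  refine (isOpen_cornerSimplex n).exists_is_const_of_fderiv_eq_zero
    (convex_cornerSimplex n).isPreconnected
    (f := fun y : Fin n → ℝ => MvPolynomial.eval y p)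
    ((contDiff_eval (m := 1) p).differentiable (by simp)).differentiableOn fun y hy => ?_
  ext v
  rw [fderiv_apply_eq_sum]
  refine Finset.sum_eq_zero fun i _ => ?_
  have := partialDeriv_eval i p y
  rw [partialDeriv, h4 y hy i] at this
  rw [this, mul_zero]

/-- A square integrable function orthogonal to the range of the unweighted Laplacian is
constant, that is, orthogonal to all functions of mean zero. -/
theorem integral_mul_eq_zero_of_orthogonal_laplacian {n : ℕ} {h F : (Fin n → ℝ) → ℝ}
    (hh : MemLp h 2 (volume.restrict (cornerSimplex n)))
    (hF : MemLp F 2 (volume.restrict (cornerSimplex n)))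
    (hF0 : ∫ y in cornerSimplex n, F y = 0)
    (horth : ∀ p : MvPolynomial (Fin n) ℝ, ∫ y in cornerSimplex n,
      h y * MvPolynomial.eval y (fieldDiv (centeredDeriv p)) = 0) :
    ∫ y in cornerSimplex n, F y * h y = 0 := by
  have key : ∀ ε > 0, (∫ y in cornerSimplex n, F y * h y) ^ 2 ≤
      (∫ y in cornerSimplex n, F y ^ 2) * ε := by
    intro ε hε
    obtain ⟨N, p, hpN, hproj, hpε⟩ := exists_polynomial_projection hh hε
    have hpm := memLp_of_continuous (n := n) (MvPolynomial.continuous_eval p)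
    have hG : ∫ y in cornerSimplex n, MvPolynomial.eval y (gammaPoly p p) = 0 := by
      have h1 := horth p
      rw [hproj _ ((totalDegree_fieldDiv_centeredDeriv_le p).trans hpN),
        integral_eval_mul_fieldDiv] at h1
      linarith
    obtain ⟨c, hc⟩ := exists_eq_const_of_integral_gammaPoly_eq_zero hG
    have h2 : ∫ y in cornerSimplex n, F y * MvPolynomial.eval y p = 0 := by
      rw [setIntegral_congr_fun (measurableSet_cornerSimplex n)
        (g := fun y => F y * c) (fun y hy => by simp only [hc y hy]), integral_mul_const, hF0,
        zero_mul]
    have j1 : Integrable (fun y => F y * h y) (volume.restrict (cornerSimplex n)) :=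
      hF.integrable_mul hh
    have j2 : Integrable (fun y => F y * MvPolynomial.eval y p)
      (volume.restrict (cornerSimplex n)) := hF.integrable_mul hpm
    have h3 : ∫ y in cornerSimplex n, F y * h y =
        ∫ y in cornerSimplex n, F y * (h y - MvPolynomial.eval y p) := by
      simp only [mul_sub]
      rw [integral_sub j1 j2, h2, sub_zero]
    rw [h3]
    refine (integral_mul_sq_le hF (hh.sub hpm)).trans ?_
    exact mul_le_mul_of_nonneg_left hpε.le (integral_nonneg fun y => sq_nonneg _)
  exact pow_eq_zero_iff two_ne_zero |>.1
    (le_antisymm (nonpos_of_forall_le_mul key) (sq_nonneg _))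

theorem exists_resolvent_integral_sub_sq_lt {n : ℕ} {ψ : (Fin n → ℝ) → ℝ} (hψ : ContDiff ℝ ∞ ψ) :
    ∃ l > 0, ∀ h : (Fin n → ℝ) → ℝ, MemLp h 2 (volume.restrict (cornerSimplex n)) → ∀ ε > 0,
      ∃ u : MvPolynomial (Fin n) ℝ, ∫ y in cornerSimplex n,
        (h y - (l * MvPolynomial.eval y u - weightedLaplacian ψ u y)) ^ 2 < ε := by
  have hc : Continuous fun y : Fin n → ℝ => ∑ i, y i * partialDeriv i ψ y ^ 2 :=
    continuous_finsetSum _ fun i _ => (continuous_apply i).mul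
      ((contDiff_partialDeriv hψ).continuous.pow 2)
  obtain ⟨B, hB0, hB⟩ := exists_bound_on_cornerSimplex hc
  refine ⟨B / 4 + 1, by positivity, fun h hh ε hε => ?_⟩
  refine exists_integral_sub_sq_lt ((B / 4 + 1) • evalLinear n - weightedLaplacian ψ) (fun p =>
    memLp_of_continuous ?_) hh (fun g hg horth => ?_) hε
  · exact (continuous_const.mul p.continuous_eval).sub (continuous_weightedLaplacian hψ p)
  · have h0 := ae_eq_zero_of_orthogonal_resolvent hψ (Real.sqrt_nonneg B) (l := B / 4 + 1)
      (by rw [Real.sq_sqrt hB0]; linarith)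
      (fun y hy => by rw [Real.sq_sqrt hB0]; exact (le_abs_self _).trans (hB y hy)) hg horth
    rw [integral_congr_ae (g := fun _ => (0 : ℝ)), integral_zero]
    filter_upwards [h0] with y hy
    rw [hy, Pi.zero_apply, zero_mul]

/-- A square integrable function orthogonal to the range of the weighted Laplacian is constant,
that is, orthogonal to all functions of weighted mean zero. It is the limit of functions `l u`, `u` a
polynomial, for which `(l - L) u` converges to it too; the energy of these functions then tends to
zero, so that the limit is orthogonal to the range of the unweighted Laplacian as well. -/
theorem integral_exp_mul_mul_eq_zero_of_orthogonal {n : ℕ} {ψ : (Fin n → ℝ) → ℝ}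
    (hψ : ContDiff ℝ ∞ ψ) {h F : (Fin n → ℝ) → ℝ}
    (hh : MemLp h 2 (volume.restrict (cornerSimplex n)))
    (hF : MemLp F 2 (volume.restrict (cornerSimplex n)))
    (hF0 : ∫ y in cornerSimplex n, Real.exp (-ψ y) * F y = 0)
    (horth : ∀ p : MvPolynomial (Fin n) ℝ,
      ∫ y in cornerSimplex n, Real.exp (-ψ y) * (h y * weightedLaplacian ψ p y) = 0) :
    ∫ y in cornerSimplex n, Real.exp (-ψ y) * F y * h y = 0 := by
  set m := (volume : Measure (Fin n → ℝ)).restrict (cornerSimplex n) with hm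
  have hEc : Continuous fun y => Real.exp (-ψ y) := hψ.continuous.neg.rexp
  refine integral_mul_eq_zero_of_orthogonal_laplacian hh (memLp_mul_continuous hF hEc) hF0
    fun p => ?_
  obtain ⟨l, hl, hres⟩ := exists_resolvent_integral_sub_sq_lt hψ
  obtain ⟨M, hM0, hM⟩ := exists_bound_on_cornerSimplex hEc
  obtain ⟨M', hM'0, hM'⟩ := exists_bound_on_cornerSimplex (hψ.continuous.rexp)
  obtain ⟨B, hB0, hB⟩ := exists_bound_on_cornerSimplex
    (f := fun y : Fin n → ℝ => ∑ i, y i * MvPolynomial.eval y (MvPolynomial.pderiv i p) ^ 2)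
    (continuous_finsetSum _ fun i _ => (continuous_apply i).mul
      ((MvPolynomial.continuous_eval _).pow 2))
  have hone : ∀ y ∈ cornerSimplex n, ∀ a : ℝ, 0 ≤ a → a ≤ M' * (Real.exp (-ψ y) * a) := by
    intro y hy a ha
    have h1 : Real.exp (ψ y) * Real.exp (-ψ y) = 1 := by rw [← Real.exp_add]; simp
    have h2 : Real.exp (ψ y) ≤ M' := (le_abs_self _).trans (hM' y hy)
    calc a = Real.exp (ψ y) * (Real.exp (-ψ y) * a) := by rw [← mul_assoc, h1, one_mul]
      _ ≤ _ := mul_le_mul_of_nonneg_right h2 (mul_nonneg (Real.exp_pos _).le ha)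
  set L0p : (Fin n → ℝ) → ℝ := fun y => MvPolynomial.eval y (fieldDiv (centeredDeriv p)) with hL0p
  have hL0m : MemLp L0p 2 m := memLp_of_continuous (MvPolynomial.continuous_eval _)
  set V := ∫ _y, (1 : ℝ) ^ 2 ∂m with hV
  have hV0 : 0 ≤ V := integral_nonneg fun _ => by norm_num
  set A := ∫ y, L0p y ^ 2 ∂m with hA
  have hA0 : 0 ≤ A := integral_nonneg fun _ => sq_nonneg _
  have key : ∀ ε > 0, (∫ y, h y * L0p y ∂m) ^ 2 ≤
      (2 * l ^ 2 * (V * (B * (M' * (M / (2 * l))))) + 2 * (M' * M * A)) * ε := by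
    intro ε hε
    obtain ⟨u, hu⟩ := hres h hh ε hε
    have huc : Continuous fun y : Fin n → ℝ => MvPolynomial.eval y u := u.continuous_eval
    have hLc := continuous_weightedLaplacian hψ u
    set r : (Fin n → ℝ) → ℝ := fun y =>
      l * MvPolynomial.eval y u - weightedLaplacian ψ u y - h y with hr
    set s : (Fin n → ℝ) → ℝ := fun y => l * MvPolynomial.eval y u - h y with hs
    have hrm : MemLp r 2 m := (memLp_of_continuous ((continuous_const.mul huc).sub hLc)).sub hh
    have hsm : MemLp s 2 m := (memLp_of_continuous (continuous_const.mul huc)).sub hh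
    have hLm : MemLp (weightedLaplacian ψ u) 2 m := memLp_of_continuous hLc
    have hum : MemLp (fun y => MvPolynomial.eval y u) 2 m := memLp_of_continuous huc
    have hEint : ∀ a b : (Fin n → ℝ) → ℝ, MemLp a 2 m → MemLp b 2 m →
        Integrable (fun y => Real.exp (-ψ y) * (a y * b y)) m := fun a b ha hb => by
      have := (memLp_mul_continuous ha hEc).integrable_mul hb
      refine this.congr (Filter.Eventually.of_forall fun y => ?_)
      simp only [Pi.mul_apply]
      ring
    have hr2 : ∫ y, r y ^ 2 ∂m < ε := by
      refine lt_of_eq_of_lt (integral_congr_ae (Filter.Eventually.of_forall fun y => ?_)) hu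
      simp only [hr]
      ring
    have hEr2 : ∫ y, Real.exp (-ψ y) * (r y * r y) ∂m ≤ M * ε := by
      refine le_trans ?_ (mul_le_mul_of_nonneg_left hr2.le hM0)
      rw [← integral_const_mul]
      refine setIntegral_mono_on (hEint _ _ hrm hrm) (hrm.integrable_sq.const_mul M)
        (measurableSet_cornerSimplex n) fun y hy => ?_
      rw [pow_two]
      exact mul_le_mul_of_nonneg_right ((le_abs_self _).trans (hM y hy)) (mul_self_nonneg _)
    set G : (Fin n → ℝ) → ℝ := fun y => MvPolynomial.eval y (gammaPoly u u) with hG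
    have hGc : Continuous G := MvPolynomial.continuous_eval _
    have hEG : Integrable (fun y => Real.exp (-ψ y) * G y) m :=
      integrableOn_cornerSimplex (hEc.mul hGc)
    have hEG0 : 0 ≤ ∫ y, Real.exp (-ψ y) * G y ∂m :=
      setIntegral_nonneg (measurableSet_cornerSimplex n) fun y hy =>
        mul_nonneg (Real.exp_pos _).le (eval_gammaPoly_self_nonneg u hy)
    -- the energy identity
    have hen : ∫ y, Real.exp (-ψ y) * (s y * s y) ∂m + l * ∫ y, Real.exp (-ψ y) * G y ∂m =
        ∫ y, Real.exp (-ψ y) * (s y * r y) ∂m := by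
      have h1 : ∫ y, Real.exp (-ψ y) * (s y * s y) ∂m =
          ∫ y, (Real.exp (-ψ y) * (s y * r y) +
            l * (Real.exp (-ψ y) * (MvPolynomial.eval y u * weightedLaplacian ψ u y)) -
            Real.exp (-ψ y) * (h y * weightedLaplacian ψ u y)) ∂m := by
        refine integral_congr_ae (Filter.Eventually.of_forall fun y => ?_)
        simp only [hr, hs]
        ring
      have j1 := hEint _ _ hsm hrm
      have j2 := (hEint _ _ hum hLm).const_mul l
      have j12 : Integrable (fun y => Real.exp (-ψ y) * (s y * r y) +
            l * (Real.exp (-ψ y) * (MvPolynomial.eval y u * weightedLaplacian ψ u y))) m :=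
        j1.add j2
      rw [h1, integral_sub j12 (hEint _ _ hh hLm), integral_add j1 j2, integral_const_mul,
        horth u, integral_exp_mul_eval_mul_weightedLaplacian hψ]
      ring
    have hsr : ∫ y, Real.exp (-ψ y) * (s y * r y) ∂m ≤
        (∫ y, Real.exp (-ψ y) * (s y * s y) ∂m + ∫ y, Real.exp (-ψ y) * (r y * r y) ∂m) / 2 := by
      rw [← integral_add (hEint _ _ hsm hsm) (hEint _ _ hrm hrm), ← integral_div]
      refine integral_mono (hEint _ _ hsm hrm)
        (((hEint _ _ hsm hsm).add (hEint _ _ hrm hrm)).div_const 2) fun y => ?_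
      have := (Real.exp_pos (-ψ y)).le
      simp only
      nlinarith [mul_nonneg this (sq_nonneg (s y - r y))]
    have hEs0 : 0 ≤ ∫ y, Real.exp (-ψ y) * (s y * s y) ∂m :=
      integral_nonneg fun y => mul_nonneg (Real.exp_pos _).le (mul_self_nonneg _)
    have hEs : ∫ y, Real.exp (-ψ y) * (s y * s y) ∂m ≤ M * ε := by
      have := mul_nonneg hl.le hEG0
      linarith
    have hEGle : ∫ y, Real.exp (-ψ y) * G y ∂m ≤ M / (2 * l) * ε := by
      rw [div_mul_eq_mul_div, le_div_iff₀ (by positivity)]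
      linarith
    have hs2 : ∫ y, s y ^ 2 ∂m ≤ M' * (M * ε) := by
      refine le_trans ?_ (mul_le_mul_of_nonneg_left hEs hM'0)
      rw [← integral_const_mul]
      refine setIntegral_mono_on hsm.integrable_sq ((hEint _ _ hsm hsm).const_mul M')
        (measurableSet_cornerSimplex n) fun y hy => ?_
      rw [← pow_two]
      exact hone y hy _ (sq_nonneg _)
    have hG2 : ∫ y, G y ∂m ≤ M' * (M / (2 * l) * ε) := by
      refine le_trans ?_ (mul_le_mul_of_nonneg_left hEGle hM'0)
      rw [← integral_const_mul]
      exact setIntegral_mono_on (integrableOn_cornerSimplex hGc) (hEG.const_mul M')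
        (measurableSet_cornerSimplex n) fun y hy =>
          hone y hy _ (eval_gammaPoly_self_nonneg u hy)
    have hΓc : Continuous fun y : Fin n → ℝ => MvPolynomial.eval y (gammaPoly u p) :=
      MvPolynomial.continuous_eval _
    have hΓ : (∫ y, MvPolynomial.eval y (gammaPoly u p) ∂m) ^ 2 ≤
        V * (B * (M' * (M / (2 * l) * ε))) := by
      have h1 := integral_mul_sq_le (memLp_of_continuous (n := n) (f := fun _ => 1)
        continuous_const) (memLp_of_continuous hΓc)
      simp only [one_mul] at h1
      refine h1.trans (mul_le_mul_of_nonneg_left ?_ hV0)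
      refine le_trans ?_ (mul_le_mul_of_nonneg_left hG2 hB0)
      rw [← integral_const_mul]
      refine setIntegral_mono_on (integrableOn_cornerSimplex (hΓc.pow 2))
        ((integrableOn_cornerSimplex hGc).const_mul B) (measurableSet_cornerSimplex n)
        fun y hy => ?_
      have h2 := sum_mul_fieldComp_sq_le
        (fun i => MvPolynomial.eval y (MvPolynomial.pderiv i p)) u hy
      have h3 : MvPolynomial.eval y (gammaPoly u p) =
          ∑ i, MvPolynomial.eval y (MvPolynomial.pderiv i p) *
            MvPolynomial.eval y (fieldComp (centeredDeriv u) i) := by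
        rw [gammaPoly_comm, gammaPoly]; simp
      rw [h3]
      exact h2.trans (mul_le_mul_of_nonneg_right ((le_abs_self _).trans (hB y hy))
        (eval_gammaPoly_self_nonneg u hy))
    have hsplit : ∫ y, h y * L0p y ∂m =
        -(l * ∫ y, MvPolynomial.eval y (gammaPoly u p) ∂m) - ∫ y, s y * L0p y ∂m := by
      have h1 : ∫ y, h y * L0p y ∂m =
          ∫ y, (l * (MvPolynomial.eval y u * L0p y) - s y * L0p y) ∂m := by
        refine integral_congr_ae (Filter.Eventually.of_forall fun y => ?_)
        simp only [hs]
        ring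
      have j1 : Integrable (fun y => MvPolynomial.eval y u * L0p y) m := hum.integrable_mul hL0m
      have j2 : Integrable (fun y => s y * L0p y) m := hsm.integrable_mul hL0m
      rw [h1, integral_sub (j1.const_mul l) j2, integral_const_mul, integral_eval_mul_fieldDiv]
      ring
    have hsL := (integral_mul_sq_le hsm hL0m).trans (mul_le_mul_of_nonneg_right hs2 hA0)
    set X := ∫ y, MvPolynomial.eval y (gammaPoly u p) ∂m with hX
    set Y := ∫ y, s y * L0p y ∂m with hY
    rw [hsplit]
    have h1 : (-(l * X) - Y) ^ 2 ≤ 2 * l ^ 2 * X ^ 2 + 2 * Y ^ 2 := by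
      nlinarith [sq_nonneg (l * X - Y)]
    have h2 : 2 * l ^ 2 * X ^ 2 ≤ 2 * l ^ 2 * (V * (B * (M' * (M / (2 * l) * ε)))) :=
      mul_le_mul_of_nonneg_left hΓ (by positivity)
    calc _ ≤ _ := h1
      _ ≤ 2 * l ^ 2 * (V * (B * (M' * (M / (2 * l) * ε)))) + 2 * (M' * (M * ε) * A) :=
        add_le_add h2 (mul_le_mul_of_nonneg_left hsL (by norm_num))
      _ = _ := by ring
  exact pow_eq_zero_iff two_ne_zero |>.1
    (le_antisymm (nonpos_of_forall_le_mul key) (sq_nonneg _))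

/-- Functions of weighted mean zero are approximated by `L p`, `p` a polynomial. -/
theorem exists_weightedLaplacian_near {n : ℕ} {ψ : (Fin n → ℝ) → ℝ}
    (hψ : ContDiff ℝ ∞ ψ) {F : (Fin n → ℝ) → ℝ}
    (hF : MemLp F 2 (volume.restrict (cornerSimplex n)))
    (hF0 : ∫ y in cornerSimplex n, Real.exp (-ψ y) * F y = 0) {ε : ℝ} (hε : 0 < ε) :
    ∃ p : MvPolynomial (Fin n) ℝ,
      ∫ y in cornerSimplex n, Real.exp (-ψ y) * (F y - weightedLaplacian ψ p y) ^ 2 < ε := by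
  have hwc : Continuous fun y => Real.exp (-ψ y / 2) := (hψ.continuous.neg.div_const 2).rexp
  have hvc : Continuous fun y => Real.exp (ψ y / 2) := (hψ.continuous.div_const 2).rexp
  have hww : ∀ y, Real.exp (-ψ y / 2) * Real.exp (-ψ y / 2) = Real.exp (-ψ y) := fun y => by
    rw [← Real.exp_add]; ring_nf
  have hwv : ∀ y, Real.exp (-ψ y / 2) * Real.exp (ψ y / 2) = 1 := fun y => by
    rw [← Real.exp_add]; ring_nf; simp
  obtain ⟨p, hp⟩ := exists_integral_sub_sq_lt
    ((LinearMap.mulLeft ℝ fun y => Real.exp (-ψ y / 2)) ∘ₗ weightedLaplacian ψ)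
    (fun p => memLp_of_continuous (hwc.mul (continuous_weightedLaplacian hψ p)))
    (memLp_mul_continuous hF hwc) (fun g hg horth => by
      have h := integral_exp_mul_mul_eq_zero_of_orthogonal hψ (memLp_mul_continuous hg hvc) hF hF0
        fun p => by
          rw [← horth p]
          refine integral_congr_ae (Filter.Eventually.of_forall fun y => ?_)
          simp only [LinearMap.comp_apply, LinearMap.mulLeft_apply, Pi.mul_apply]
          rw [← hww]
          linear_combination Real.exp (-ψ y / 2) * g y * weightedLaplacian ψ p y * hwv y
      rw [← h]
      refine integral_congr_ae (Filter.Eventually.of_forall fun y => ?_)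
      simp only
      rw [← hww]
      linear_combination -(Real.exp (-ψ y / 2) * g y * F y * hwv y)) hε
  refine ⟨p, lt_of_eq_of_lt (integral_congr_ae (Filter.Eventually.of_forall fun y => ?_)) hp⟩
  simp only [LinearMap.comp_apply, LinearMap.mulLeft_apply, Pi.mul_apply]
  rw [← hww]
  ring

/-! ### The dual quadratic form and the energy density -/

/-- Lagrange's identity. -/
theorem sum_sum_Ioi_mul_sub_sq {ι : Type*} [Fintype ι] [LinearOrder ι] [LocallyFiniteOrderTop ι]
    [LocallyFiniteOrderBot ι] (a d : ι → ℝ) :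
    ∑ i, ∑ j ∈ Finset.Ioi i, a i * a j * (d i - d j) ^ 2 =
      (∑ k, a k) * ∑ k, a k * d k ^ 2 - (∑ k, a k * d k) ^ 2 := by
  have h := Finset.sum_sum_Ioi_add_eq_sum_sum_off_diag
    fun i j => a i * a j * (d i - d j) ^ 2 / 2
  have h1 : ∀ i j, a j * a i * (d j - d i) ^ 2 / 2 + a i * a j * (d i - d j) ^ 2 / 2 =
      a i * a j * (d i - d j) ^ 2 := fun i j => by ring
  have h2 : ∀ i, ∑ j ∈ {i}ᶜ, a j * a i * (d j - d i) ^ 2 / 2 =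
      ∑ j, a j * a i * (d j - d i) ^ 2 / 2 := fun i => by
    refine Finset.sum_subset (Finset.subset_univ _) fun j _ hj => ?_
    rw [Finset.mem_compl, Finset.mem_singleton, not_not] at hj
    simp [hj]
  simp only [h1, h2] at h
  rw [h]
  have h3 : ∀ i, ∑ j, a j * a i * (d j - d i) ^ 2 / 2 =
      a i / 2 * ∑ j, a j * d j ^ 2 + a i * d i ^ 2 / 2 * ∑ j, a j -
        a i * d i * ∑ j, a j * d j := fun i => by
    simp only [Finset.mul_sum, ← Finset.sum_add_distrib, ← Finset.sum_sub_distrib]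
    exact Finset.sum_congr rfl fun j _ => by ring
  simp only [h3, Finset.sum_sub_distrib, Finset.sum_add_distrib, ← Finset.sum_mul,
    ← Finset.sum_div]
  ring

/-- If some `xₘ` exceeds `1/2`, then the sum `∑ₖ xₖ² / (1 - 2xₖ)` is negative. -/
theorem sum_sq_div_one_sub_neg {ι : Type*} [Fintype ι] [DecidableEq ι] {x : ι → ℝ}
    (hx : ∀ k, 0 < x k) (hsum : ∑ k, x k = 1) {m : ι} (hm : 1 / 2 < x m) :
    ∑ k, x k ^ 2 / (1 - 2 * x k) < 0 := by
  have hs : x m + ∑ k ∈ Finset.univ.erase m, x k = 1 := by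
    rw [Finset.add_sum_erase _ _ (Finset.mem_univ m), hsum]
  have hle : ∀ k ∈ Finset.univ.erase m, x k ≤ 1 - x m := fun k hk => by
    have := Finset.single_le_sum (f := x) (fun i _ => (hx i).le) hk
    linarith
  have hc : 0 < 2 * x m - 1 := by linarith
  have hrest : ∑ k ∈ Finset.univ.erase m, x k ^ 2 / (1 - 2 * x k) ≤
      (1 - x m) ^ 2 / (2 * x m - 1) := by
    calc _ ≤ ∑ k ∈ Finset.univ.erase m, (1 - x m) * x k / (2 * x m - 1) := by
          refine Finset.sum_le_sum fun k hk => ?_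
          have h1 := hle k hk
          have h2 : 0 < 1 - x m := (hx k).trans_le h1
          rw [sq]
          exact div_le_div₀ (mul_nonneg h2.le (hx k).le)
            (mul_le_mul_of_nonneg_right h1 (hx k).le) hc (by linarith)
      _ = _ := by
          rw [← Finset.sum_div, ← Finset.mul_sum]
          congr 1
          rw [show ∑ k ∈ Finset.univ.erase m, x k = 1 - x m by linarith]
          ring
  rw [← Finset.add_sum_erase _ _ (Finset.mem_univ m)]
  have hmm : x m ^ 2 / (1 - 2 * x m) = -(x m ^ 2 / (2 * x m - 1)) := by
    rw [← neg_sub, div_neg]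
  have hlt : (1 - x m) ^ 2 / (2 * x m - 1) < x m ^ 2 / (2 * x m - 1) :=
    div_lt_div_of_pos_right (by nlinarith) hc
  linarith

/-- For fixed `d`, the maximum over tangent `b` of `-2 ∑ dₖ xₖ bₖ - ¼ ∑ bₖ²` is at most four times
the energy density. Neither side sees a change of `d` by a constant, so that `d` may be normalized:
by its mean with weights `xₖ² / (1 - 2xₖ)` if these are all positive, and by its `m`-th component
if the weight of index `m` is negative. -/
theorem neg_two_mul_sum_sub_le {n : ℕ} {x d b : Fin (n + 1) → ℝ} (hx : ∀ k, 0 < x k)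
    (hsum : ∑ k, x k = 1) (hhalf : ∀ k, x k ≠ 1 / 2) (hb : ∑ k, x k * b k = 0) :
    -2 * ∑ k, d k * (x k * b k) - (∑ k, b k ^ 2) / 4 ≤
      4 * ((∑ k, x k ^ 2 / (1 - 2 * x k))⁻¹ * ∑ i, ∑ j ∈ Finset.Ioi i,
        x i ^ 2 * x j ^ 2 / ((1 - 2 * x i) * (1 - 2 * x j)) * |d i - d j| ^ 2) := by
  set a : Fin (n + 1) → ℝ := fun k => x k ^ 2 / (1 - 2 * x k) with ha
  set S := ∑ k, a k with hS
  have hshift : ∀ c, -2 * ∑ k, d k * (x k * b k) - (∑ k, b k ^ 2) / 4 =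
      ∑ k, (-2 * ((d k - c) * (x k * b k)) - b k ^ 2 / 4) := fun c => by
    simp only [Finset.sum_sub_distrib, ← Finset.mul_sum, ← Finset.sum_div, sub_mul, hb]
    ring
  have hE : ∀ c, ∑ i, ∑ j ∈ Finset.Ioi i,
      x i ^ 2 * x j ^ 2 / ((1 - 2 * x i) * (1 - 2 * x j)) * |d i - d j| ^ 2 =
      S * ∑ k, a k * (d k - c) ^ 2 - (∑ k, a k * (d k - c)) ^ 2 := fun c => by
    rw [← sum_sum_Ioi_mul_sub_sq]
    refine Finset.sum_congr rfl fun i _ => Finset.sum_congr rfl fun j _ => ?_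
    rw [sq_abs, mul_div_mul_comm, sub_sub_sub_cancel_right]
  have hterm : ∀ {e y β w : ℝ}, y ^ 2 ≤ w → -2 * (e * (y * β)) - β ^ 2 / 4 ≤ 4 * (w * e ^ 2) := by
    intro e y β w hw
    have := mul_le_mul_of_nonneg_right hw (sq_nonneg e)
    nlinarith [sq_nonneg (4 * (e * y) + β)]
  have hweight : ∀ k, x k < 1 / 2 → x k ^ 2 ≤ a k := fun k hk =>
    (le_div_iff₀ (by linarith)).2
      (mul_le_of_le_one_right (sq_nonneg _) (by linarith [hx k]))
  by_cases hall : ∀ k, x k < 1 / 2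
  · have hSpos : 0 < S := Finset.sum_pos (fun k _ => (pow_pos (hx k) 2).trans_le
      (hweight k (hall k))) Finset.univ_nonempty
    have hc : ∑ k, a k * (d k - (∑ j, a j * d j) / S) = 0 := by
      simp only [mul_sub, Finset.sum_sub_distrib, ← Finset.sum_mul]
      rw [← hS]
      field_simp
      ring
    rw [hshift ((∑ j, a j * d j) / S), hE ((∑ j, a j * d j) / S), hc, zero_pow two_ne_zero,
      sub_zero, inv_mul_cancel_left₀ hSpos.ne', Finset.mul_sum]
    exact Finset.sum_le_sum fun k _ => hterm (hweight k (hall k))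
  · push Not at hall
    obtain ⟨m, hm⟩ := hall
    have hm' : 1 / 2 < x m := lt_of_le_of_ne hm (hhalf m).symm
    have hSneg : S < 0 := sum_sq_div_one_sub_neg hx hsum hm'
    rw [hshift (d m), hE (d m), mul_sub, inv_mul_cancel_left₀ hSneg.ne]
    have h1 : S⁻¹ * (∑ k, a k * (d k - d m)) ^ 2 ≤ 0 :=
      mul_nonpos_of_nonpos_of_nonneg (inv_nonpos.2 hSneg.le) (sq_nonneg _)
    have h2 : ∑ k, (-2 * ((d k - d m) * (x k * b k)) - b k ^ 2 / 4) ≤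
        4 * ∑ k, a k * (d k - d m) ^ 2 := by
      rw [Finset.mul_sum]
      refine Finset.sum_le_sum fun k _ => ?_
      by_cases hk : k = m
      · subst hk
        simp only [sub_self]
        nlinarith [sq_nonneg (b k)]
      · refine hterm (hweight k ?_)
        have := Finset.add_le_sum (f := x) (fun i _ => (hx i).le) (Finset.mem_univ k)
          (Finset.mem_univ m) hk
        linarith
    linarith

/-! ### Lipschitz functions on the simplex -/

theorem simplexLift_add {n : ℕ} (y v : Fin n → ℝ) (k : Fin (n + 1)) :
    simplexLift n (y + v) k = simplexLift n y k + simplexLiftLinear n k v := by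
  refine Fin.cases ?_ (fun i => ?_) k
  · simp only [simplexLift_zero, simplexLiftLinear_zero, Pi.add_apply, Finset.sum_add_distrib]
    ring
  · simp only [simplexLift_succ, simplexLiftLinear_succ, Pi.add_apply]

theorem simplexLift_mem_simplex {n : ℕ} {y : Fin n → ℝ} (hy : y ∈ cornerSimplex n) :
    simplexLift n y ∈ simplex n :=
  ⟨mem_cornerSimplex_iff.1 hy, sum_simplexLift y⟩

theorem ae_simplexLift_ne {n : ℕ} {c : ℝ} (hc0 : c ≠ 0) (hc1 : c ≠ 1) (k : Fin (n + 1)) :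
    ∀ᵐ y : Fin n → ℝ, simplexLift n y k ≠ c := by
  by_cases h : ∃ y0, simplexLift n y0 k = c
  swap
  · exact Filter.Eventually.of_forall fun y hy => h ⟨y, hy⟩
  obtain ⟨y0, hy0⟩ := h
  have hL : simplexLiftLinear n k y0 ≠ 0 := by
    have h := simplexLift_add 0 y0 k
    rw [zero_add, hy0] at h
    intro h0
    rw [h0, add_zero] at h
    revert h
    refine Fin.cases ?_ (fun i => ?_) k
    · simpa [simplexLift_zero] using hc1
    · simpa [simplexLift_succ] using hc0
  have htop : AffineSubspace.mk' y0 (simplexLiftLinear n k).ker ≠ ⊤ := fun h => by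
    have h2 : (y0 + y0) ∈ AffineSubspace.mk' y0 (simplexLiftLinear n k).ker := by
      rw [h]; trivial
    rw [AffineSubspace.mem_mk', vsub_eq_sub, add_sub_cancel_right] at h2
    exact hL h2
  have h0 := Measure.addHaar_affineSubspace (volume : Measure (Fin n → ℝ)) _ htop
  refine measure_mono_null (fun y hy => ?_) h0
  simp only [Set.mem_compl_iff, Set.mem_ofPred_eq, not_not] at hy
  rw [SetLike.mem_coe, AffineSubspace.mem_mk', vsub_eq_sub]
  have h := simplexLift_add y0 (y - y0) k
  rw [add_sub_cancel, hy, hy0] at h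
  change simplexLiftLinear n k (y - y0) = 0
  linarith

theorem exists_lipschitzWith_eq_comp_simplexLift {n : ℕ} {f : (Fin (n + 1) → ℝ) → ℝ} {C : NNReal}
    (hf : LipschitzOnWith C f (simplex n)) :
    ∃ (D : NNReal) (F : (Fin n → ℝ) → ℝ), LipschitzWith D F ∧
      ∀ y ∈ cornerSimplex n, F y = f (simplexLift n y) := by
  have h1 : LipschitzWith ‖ContinuousLinearMap.pi (simplexLiftLinear n)‖₊ (simplexLift n) := by
    refine LipschitzWith.of_dist_le_mul fun y z => ?_
    have : simplexLift n y - simplexLift n z =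
        ContinuousLinearMap.pi (simplexLiftLinear n) (y - z) := by
      ext k
      have := simplexLift_add z (y - z) k
      rw [add_sub_cancel] at this
      simp [this]
    rw [dist_eq_norm, dist_eq_norm, this]
    exact ContinuousLinearMap.le_opNorm _ _
  have h2 := hf.comp (h1.lipschitzOnWith (s := cornerSimplex n))
    fun y hy => simplexLift_mem_simplex hy
  obtain ⟨F, hF, hFf⟩ := h2.extend_real
  exact ⟨_, F, hF, fun y hy => (hFf hy).symm⟩

/-- The tangential derivatives of `f` at a point of the simplex, in terms of the partial
derivatives of `f` in the coordinates `x₁, …, xₙ`. -/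
theorem tangentDeriv_simplexLift {n : ℕ} {f : (Fin (n + 1) → ℝ) → ℝ} {F : (Fin n → ℝ) → ℝ}
    (hFf : ∀ y ∈ cornerSimplex n, F y = f (simplexLift n y)) {y : Fin n → ℝ}
    (hy : y ∈ cornerSimplex n) (hF : DifferentiableAt ℝ F y) (i j : Fin (n + 1)) :
    tangentDeriv i j f (simplexLift n y) =
      (Fin.cons 0 (fun l => lineDeriv ℝ F y (Pi.single l 1)) : Fin (n + 1) → ℝ) i -
      (Fin.cons 0 (fun l => lineDeriv ℝ F y (Pi.single l 1)) : Fin (n + 1) → ℝ) j := by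
  have hval : ∀ i : Fin (n + 1),
      (Fin.cons 0 (fun l => lineDeriv ℝ F y (Pi.single l 1)) : Fin (n + 1) → ℝ) i =
      fderiv ℝ F y (Fin.tail (Pi.single i 1 : Fin (n + 1) → ℝ)) := by
    refine Fin.cases ?_ (fun l => ?_)
    · have : Fin.tail (Pi.single 0 1 : Fin (n + 1) → ℝ) = 0 := by
        ext l; simp [Fin.tail]
      rw [this, map_zero, Fin.cons_zero]
    · have : Fin.tail (Pi.single l.succ 1 : Fin (n + 1) → ℝ) = Pi.single l 1 := by
        ext l'; simp [Fin.tail, Pi.single_apply]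
      rw [this, Fin.cons_succ, hF.lineDeriv_eq_fderiv]
  set v : Fin n → ℝ := Fin.tail (Pi.single i 1 : Fin (n + 1) → ℝ) -
    Fin.tail (Pi.single j 1 : Fin (n + 1) → ℝ) with hv
  have hlift : ∀ t : ℝ, simplexLift n y + t • (Pi.single i 1 - Pi.single j 1) =
      simplexLift n (y + t • v) := fun t => by
    have hs : ∀ i : Fin (n + 1), (Pi.single i 1 : Fin (n + 1) → ℝ) 0 +
        ∑ l : Fin n, (Pi.single i 1 : Fin (n + 1) → ℝ) l.succ = 1 := fun i => by
      rw [← Fin.sum_univ_succ (Pi.single i 1 : Fin (n + 1) → ℝ)]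
      simp
    ext k
    rw [simplexLift_add, map_smul]
    simp only [Pi.add_apply, Pi.smul_apply, Pi.sub_apply, smul_eq_mul]
    congr 2
    refine Fin.cases ?_ (fun l => ?_) k
    · rw [simplexLiftLinear_zero]
      simp only [hv, Pi.sub_apply, Fin.tail, Finset.sum_sub_distrib]
      linarith [hs i, hs j]
    · rw [simplexLiftLinear_succ]
      simp [hv, Fin.tail]
  rw [hval, hval, ← map_sub, ← hv, ← hF.lineDeriv_eq_fderiv, tangentDeriv, lineDeriv, lineDeriv]
  refine Filter.EventuallyEq.deriv_eq ?_
  have hcont : ContinuousAt (fun t : ℝ => y + t • v) 0 := by fun_prop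
  have hmem : cornerSimplex n ∈ nhds (y + (0 : ℝ) • v) := by
    rw [zero_smul, add_zero]
    exact (isOpen_cornerSimplex n).mem_nhds hy
  filter_upwards [hcont.eventually hmem] with t ht
  rw [hlift, hFf _ ht]

/-! ### The duality argument -/

theorem ofReal_integral_le_lintegral_ofReal {α : Type*} [MeasurableSpace α] {μ : Measure α}
    {k : α → ℝ} (hk : Integrable k μ) :
    ENNReal.ofReal (∫ y, k y ∂μ) ≤ ∫⁻ y, ENNReal.ofReal (k y) ∂μ := by
  rw [integral_eq_lintegral_pos_part_sub_lintegral_neg_part hk]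
  exact (ENNReal.ofReal_le_ofReal (sub_le_self _ ENNReal.toReal_nonneg)).trans
    ENNReal.ofReal_toReal_le

theorem integral_exp_mul_lineDeriv_eq_neg {n : ℕ} {ψ : (Fin n → ℝ) → ℝ} (hψ : ContDiff ℝ ∞ ψ)
    {F : (Fin n → ℝ) → ℝ} {D : NNReal} (hF : LipschitzWith D F) (p : MvPolynomial (Fin n) ℝ) :
    ∫ y in cornerSimplex n, Real.exp (-ψ y) * ∑ i, lineDeriv ℝ F y (Pi.single i 1) *
        (y i * MvPolynomial.eval y (centeredDeriv p i.succ)) =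
      -∫ y in cornerSimplex n, Real.exp (-ψ y) * (F y * weightedLaplacian ψ p y) := by
  have h := integral_lineDeriv_mul_eq_neg hF
    (b := fun k y => Real.exp (-ψ y) * MvPolynomial.eval y (centeredDeriv p k))
    (fun k => (hψ.neg.exp.mul (contDiff_eval _)).of_le (by simp))
    fun y => sum_simplexLift_mul_mul_eq_zero ((isTangent_centeredDeriv p).eval y) _
  refine Eq.trans ?_ (h.trans ?_)
  · refine integral_congr_ae (Filter.Eventually.of_forall fun y => ?_)
    simp only [Finset.mul_sum]
    exact Finset.sum_congr rfl fun i _ => by ring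
  · congr 1
    refine integral_congr_ae (Filter.Eventually.of_forall fun y => ?_)
    simp only
    rw [sum_partialDeriv_exp_mul hψ (b := fun k y => MvPolynomial.eval y (centeredDeriv p k))
      (fun k => contDiff_eval _)]
    simp only [weightedLaplacian_apply, fieldDiv, map_sum, ← eval_fieldComp, partialDeriv_eval]
    ring

/-- Duality: the lower bound for `∫ exp (-ψ) (L p)²` turns a pointwise upper bound `K` for the dual
quadratic form of the derivative of a mean-zero Lipschitz function `F` into the bound
`∫ exp (-ψ) F² ≤ ∫ exp (-ψ) K`. -/
theorem ofReal_integral_exp_mul_sq_le {n : ℕ} {ψ : (Fin n → ℝ) → ℝ} (hψ : ContDiff ℝ ∞ ψ)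
    (hbound : HessianBound n ψ) {F : (Fin n → ℝ) → ℝ} {D : NNReal} (hF : LipschitzWith D F)
    (hF0 : ∫ y in cornerSimplex n, Real.exp (-ψ y) * F y = 0) {K : (Fin n → ℝ) → ℝ}
    (hK : ∀ᵐ y ∂volume.restrict (cornerSimplex n), ∀ b : Fin (n + 1) → ℝ,
      ∑ k, simplexLift n y k * b k = 0 →
        -2 * ∑ i, lineDeriv ℝ F y (Pi.single i 1) * (y i * b i.succ) - (∑ k, b k ^ 2) / 4 ≤ K y) :
    ENNReal.ofReal (∫ y in cornerSimplex n, Real.exp (-ψ y) * F y ^ 2) ≤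
      ∫⁻ y in cornerSimplex n, ENNReal.ofReal (Real.exp (-ψ y) * K y) := by
  refine ENNReal.le_of_forall_pos_le_add fun ε hε _ => ?_
  obtain ⟨p, hp⟩ := exists_weightedLaplacian_near hψ (memLp_of_continuous hF.continuous) hF0
    (NNReal.coe_pos.2 hε)
  have hE : Continuous fun y => Real.exp (-ψ y) := hψ.continuous.neg.rexp
  have hL : Continuous (weightedLaplacian ψ p) := continuous_weightedLaplacian hψ p
  have hb : ∀ k, Continuous fun y : Fin n → ℝ => MvPolynomial.eval y (centeredDeriv p k) :=
    fun k => (centeredDeriv p k).continuous_eval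
  have i1 : IntegrableOn (fun y => Real.exp (-ψ y) * (F y - weightedLaplacian ψ p y) ^ 2)
      (cornerSimplex n) := integrableOn_cornerSimplex (hE.mul ((hF.continuous.sub hL).pow 2))
  have i2 : IntegrableOn (fun y => Real.exp (-ψ y) * (F y * weightedLaplacian ψ p y))
      (cornerSimplex n) := integrableOn_cornerSimplex (hE.mul (hF.continuous.mul hL))
  have i3 : IntegrableOn (fun y => Real.exp (-ψ y) * weightedLaplacian ψ p y ^ 2)
      (cornerSimplex n) := integrableOn_cornerSimplex (hE.mul (hL.pow 2))
  have i4 : IntegrableOn (fun y => Real.exp (-ψ y) *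
      ((∑ k, MvPolynomial.eval y (centeredDeriv p k) ^ 2) / 4)) (cornerSimplex n) :=
    integrableOn_cornerSimplex
      (hE.mul ((continuous_finsetSum _ fun k _ => (hb k).pow 2).div_const 4))
  have i5 : IntegrableOn (fun y => Real.exp (-ψ y) * ∑ i, lineDeriv ℝ F y (Pi.single i 1) *
      (y i * MvPolynomial.eval y (centeredDeriv p i.succ))) (cornerSimplex n) := by
    simp only [Finset.mul_sum]
    refine integrable_finsetSum _ fun i _ => ?_
    simp only [mul_left_comm (Real.exp _) (lineDeriv _ _ _ _)]
    refine (integrableOn_cornerSimplex (hE.mul ((continuous_apply i).mul (hb _)))).bdd_mul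
      (c := D * ‖(Pi.single i 1 : Fin n → ℝ)‖) ?_ (Filter.Eventually.of_forall fun y => ?_)
    · exact (measurable_lineDeriv hF.continuous).aestronglyMeasurable
    · exact norm_lineDeriv_le_of_lipschitz ℝ hF
  have h1 : ∫ y in cornerSimplex n, Real.exp (-ψ y) * F y ^ 2 =
      (∫ y in cornerSimplex n, Real.exp (-ψ y) * (F y - weightedLaplacian ψ p y) ^ 2) +
      2 * (∫ y in cornerSimplex n, Real.exp (-ψ y) * (F y * weightedLaplacian ψ p y)) -
      ∫ y in cornerSimplex n, Real.exp (-ψ y) * weightedLaplacian ψ p y ^ 2 := by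
    have i12 : IntegrableOn (fun y => Real.exp (-ψ y) * (F y - weightedLaplacian ψ p y) ^ 2 +
        2 * (Real.exp (-ψ y) * (F y * weightedLaplacian ψ p y))) (cornerSimplex n) :=
      i1.add (i2.const_mul 2)
    rw [← integral_const_mul, ← integral_add i1 (i2.const_mul 2), ← integral_sub i12 i3]
    exact integral_congr_ae (Filter.Eventually.of_forall fun y => by ring)
  have h2 := integral_exp_mul_sum_centeredDeriv_sq_le hψ hbound p
  have h3 := integral_exp_mul_lineDeriv_eq_neg hψ hF p
  have h4 : ∫ y in cornerSimplex n, Real.exp (-ψ y) *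
      (-2 * ∑ i, lineDeriv ℝ F y (Pi.single i 1) *
        (y i * MvPolynomial.eval y (centeredDeriv p i.succ)) -
      (∑ k, MvPolynomial.eval y (centeredDeriv p k) ^ 2) / 4) =
      -2 * (∫ y in cornerSimplex n, Real.exp (-ψ y) * ∑ i, lineDeriv ℝ F y (Pi.single i 1) *
        (y i * MvPolynomial.eval y (centeredDeriv p i.succ))) -
      ∫ y in cornerSimplex n, Real.exp (-ψ y) *
        ((∑ k, MvPolynomial.eval y (centeredDeriv p k) ^ 2) / 4) := by
    rw [← integral_const_mul, ← integral_sub (i5.const_mul (-2)) i4]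
    exact integral_congr_ae (Filter.Eventually.of_forall fun y => by ring)
  have i6 : IntegrableOn (fun y => Real.exp (-ψ y) *
      (-2 * ∑ i, lineDeriv ℝ F y (Pi.single i 1) *
        (y i * MvPolynomial.eval y (centeredDeriv p i.succ)) -
      (∑ k, MvPolynomial.eval y (centeredDeriv p k) ^ 2) / 4)) (cornerSimplex n) :=
    ((i5.const_mul (-2)).sub i4).congr (Filter.Eventually.of_forall fun y => by
      simp only [Pi.sub_apply]; ring)
  have h5 : ∫ y in cornerSimplex n, Real.exp (-ψ y) * F y ^ 2 ≤
      (∫ y in cornerSimplex n, Real.exp (-ψ y) *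
        (-2 * ∑ i, lineDeriv ℝ F y (Pi.single i 1) *
          (y i * MvPolynomial.eval y (centeredDeriv p i.succ)) -
        (∑ k, MvPolynomial.eval y (centeredDeriv p k) ^ 2) / 4)) + ε := by
    have h2' : ∫ y in cornerSimplex n, Real.exp (-ψ y) *
        ((∑ k, MvPolynomial.eval y (centeredDeriv p k) ^ 2) / 4) ≤
        ∫ y in cornerSimplex n, Real.exp (-ψ y) * weightedLaplacian ψ p y ^ 2 := h2
    linarith
  refine (ENNReal.ofReal_le_ofReal h5).trans (ENNReal.ofReal_add_le.trans ?_)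
  rw [ENNReal.ofReal_coe_nnreal]
  refine add_le_add_left ((ofReal_integral_le_lintegral_ofReal i6).trans ?_) _
  refine lintegral_mono_ae ?_
  filter_upwards [hK] with y hy
  exact ENNReal.ofReal_le_ofReal (mul_le_mul_of_nonneg_left
    (hy _ ((isTangent_centeredDeriv p).eval y)) (Real.exp_pos _).le)

/-! ### The weighted measure in the coordinates `x₁, …, xₙ` -/

theorem measurableEmbedding_simplexLift (n : ℕ) : MeasurableEmbedding (simplexLift n) := by
  have h : Function.LeftInverse (Fin.tail : (Fin (n + 1) → ℝ) → Fin n → ℝ) (simplexLift n) :=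
    fun y => Fin.tail_cons _ _
  refine (h.isClosedEmbedding ?_ (continuous_simplexLift n)).measurableEmbedding
  exact continuous_pi fun i => continuous_apply i.succ

section

variable {n : ℕ} {φ g : (Fin (n + 1) → ℝ) → ℝ}

theorem aemeasurable_exp_neg_simplexMeasure (hg : Set.EqOn φ g (simplex n)) (hgc : Continuous g) :
    AEMeasurable (fun x => ENNReal.ofReal (Real.exp (-φ x))) (simplexMeasure n) := by
  refine ⟨fun x => ENNReal.ofReal (Real.exp (-g x)),
    (ENNReal.continuous_ofReal.comp hgc.neg.rexp).measurable, ?_⟩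
  rw [Filter.EventuallyEq, simplexMeasure, (measurableEmbedding_simplexLift n).ae_map_iff]
  refine (ae_restrict_iff' (measurableSet_cornerSimplex n)).2
    (Filter.Eventually.of_forall fun y hy => ?_)
  rw [hg (simplexLift_mem_simplex hy)]

theorem lintegral_weightedMeasure (hg : Set.EqOn φ g (simplex n)) (hgc : Continuous g)
    (u : (Fin (n + 1) → ℝ) → ℝ) :
    ∫⁻ x, ENNReal.ofReal (u x) ∂(weightedMeasure n φ) =
      ∫⁻ y in cornerSimplex n,
        ENNReal.ofReal (Real.exp (-(g ∘ simplexLift n) y) * u (simplexLift n y)) := by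
  rw [weightedMeasure, lintegral_withDensity_eq_lintegral_mul_non_measurable₀ _
    (aemeasurable_exp_neg_simplexMeasure hg hgc)
    (Filter.Eventually.of_forall fun x => ENNReal.ofReal_lt_top), simplexMeasure,
    (measurableEmbedding_simplexLift n).lintegral_map]
  refine setLIntegral_congr_fun (measurableSet_cornerSimplex n) fun y hy => ?_
  simp only [Pi.mul_apply, Function.comp_apply]
  rw [hg (simplexLift_mem_simplex hy), ENNReal.ofReal_mul (Real.exp_pos _).le]

theorem integral_weightedMeasure (hg : Set.EqOn φ g (simplex n)) (hgc : Continuous g)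
    (u : (Fin (n + 1) → ℝ) → ℝ) :
    ∫ x, u x ∂(weightedMeasure n φ) =
      ∫ y in cornerSimplex n, Real.exp (-(g ∘ simplexLift n) y) * u (simplexLift n y) := by
  rw [weightedMeasure, integral_withDensity_eq_integral_toReal_smul₀
    (aemeasurable_exp_neg_simplexMeasure hg hgc)
    (Filter.Eventually.of_forall fun x => ENNReal.ofReal_lt_top), simplexMeasure,
    (measurableEmbedding_simplexLift n).integral_map]
  refine setIntegral_congr_fun (measurableSet_cornerSimplex n) fun y hy => ?_
  simp only [Function.comp_apply, smul_eq_mul]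
  rw [hg (simplexLift_mem_simplex hy), ENNReal.toReal_ofReal (Real.exp_pos _).le]

/-- The Poincaré inequality for a weight with the Hessian bound. -/
theorem lintegral_sq_le_of_hessianBound (hg : Set.EqOn φ g (simplex n)) (hgs : ContDiff ℝ ∞ g)
    (hbound : HessianBound n (g ∘ simplexLift n)) {f : (Fin (n + 1) → ℝ) → ℝ} {C : NNReal}
    (hf : LipschitzOnWith C f (simplex n)) (hf0 : ∫ x, f x ∂(weightedMeasure n φ) = 0) :
    ∫⁻ x, ENNReal.ofReal (f x ^ 2) ∂(weightedMeasure n φ) ≤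
      4 * ∫⁻ x, ENNReal.ofReal (energyDensity f x) ∂(weightedMeasure n φ) := by
  obtain ⟨D, F, hF, hFf⟩ := exists_lipschitzWith_eq_comp_simplexLift hf
  have hψ : ContDiff ℝ ∞ (g ∘ simplexLift n) := hgs.comp contDiff_simplexLift
  have hmeas := measurableSet_cornerSimplex n
  rw [integral_weightedMeasure hg hgs.continuous] at hf0
  have hF0 : ∫ y in cornerSimplex n, Real.exp (-(g ∘ simplexLift n) y) * F y = 0 := by
    rw [← hf0]
    exact setIntegral_congr_fun hmeas fun y hy => by simp only [hFf y hy]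
  have hK : ∀ᵐ y ∂volume.restrict (cornerSimplex n), ∀ b : Fin (n + 1) → ℝ,
      ∑ k, simplexLift n y k * b k = 0 →
        -2 * ∑ i, lineDeriv ℝ F y (Pi.single i 1) * (y i * b i.succ) - (∑ k, b k ^ 2) / 4 ≤
        4 * energyDensity f (simplexLift n y) := by
    have hhalf : ∀ᵐ y : Fin n → ℝ, ∀ k, simplexLift n y k ≠ 1 / 2 :=
      ae_all_iff.2 fun k => ae_simplexLift_ne (by norm_num) (by norm_num) k
    refine (ae_restrict_iff' hmeas).2 ?_
    filter_upwards [hF.ae_differentiableAt, hhalf] with y hd hh hy b hb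
    have h := neg_two_mul_sum_sub_le (mem_cornerSimplex_iff.1 hy) (sum_simplexLift y) hh hb
      (d := Fin.cons 0 fun l => lineDeriv ℝ F y (Pi.single l 1))
    rw [Fin.sum_univ_succ] at h
    simp only [Fin.cons_zero, zero_mul, zero_add, Fin.cons_succ, simplexLift_succ] at h
    simp only [energyDensity, tangentDeriv_simplexLift hFf hy hd]
    exact h
  have key := ofReal_integral_exp_mul_sq_le hψ hbound hF hF0 hK
  have i : IntegrableOn (fun y => Real.exp (-(g ∘ simplexLift n) y) * F y ^ 2)
      (cornerSimplex n) :=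
    integrableOn_cornerSimplex (hψ.continuous.neg.rexp.mul (hF.continuous.pow 2))
  rw [ofReal_integral_eq_lintegral_ofReal i (Filter.Eventually.of_forall fun y =>
    mul_nonneg (Real.exp_pos _).le (sq_nonneg _))] at key
  rw [lintegral_weightedMeasure hg hgs.continuous, lintegral_weightedMeasure hg hgs.continuous,
    ← lintegral_const_mul' _ _ (by simp)]
  refine Eq.trans_le ?_ (key.trans_eq ?_)
  · exact setLIntegral_congr_fun hmeas fun y hy => by simp only [hFf y hy]
  · refine lintegral_congr fun y => ?_
    rw [mul_left_comm, ENNReal.ofReal_mul (by norm_num : (0 : ℝ) ≤ 4)]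
    simp

end

end SimplexPoincare

theorem theorem4p5 (n : ℕ) (q : ℝ) (hq : 0 ≤ q) (φ : (Fin (n + 1) → ℝ) → ℝ)
    (hφ_convex : IsPConvex (1 / 2) φ)
    (hφ_smooth : SmoothUpToBoundary n φ)
    (hφ_hom : IsHomogeneousOfDegree q φ)
    (hφ_bound : sSup (φ '' simplex n) * q ≤ n ∨ CurvatureCondition n q φ)
    (f : (Fin (n + 1) → ℝ) → ℝ)
    (hf_lip : ∃ C : NNReal, LipschitzOnWith C f (simplex n))
    (hf_mean : ∫ x, f x ∂(weightedMeasure n φ) = 0) :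
    ∫⁻ x, ENNReal.ofReal (f x ^ 2) ∂(weightedMeasure n φ) ≤
      4 * ∫⁻ x, ENNReal.ofReal (energyDensity f x) ∂(weightedMeasure n φ) := by
  obtain ⟨g, hgs, hg⟩ := hφ_smooth
  obtain ⟨C, hC⟩ := hf_lip
  refine lintegral_sq_le_of_hessianBound hg hgs ?_ hC hf_mean
  rcases hφ_bound with hM | hcurv
  · exact hessianBound_of_convex hφ_convex hg hgs hφ_hom hq hM
  · exact hessianBound_of_curvatureCondition hcurv hg hgs hφ_hom
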